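/- Let $G$ be a compact connected Lie group whose Lie algebra $\mathfrak g$ is simple, let $B$ be the negative of the Killing form of $\mathfrak g$, let $\mathfrak t\subset\mathfrak g$ be a maximal abelian subalgebra, $\Delta$ the root system of $\mathfrak g^{\mathbb C}$ with respect to $\mathfrak t^{\mathbb C}$, $\Pi=\{\alpha_1,\dots,\alpha_\ell\}$ a fundamental system of $\Delta$, and $\tilde\alpha$ the highest root. Fix $\alpha_{i_0}\in\Pi$ and let $\Delta_k$ be the set of positive roots $\sum_j m_j\alpha_j$ with $m_{i_0}=k$. Put $$\mathfrak h=\mathfrak t+\sum_{\beta\in\Delta_0}\bigl((\mathfrak g^{\mathbb C}_\beta+\mathfrak g^{\mathbb C}_{-\beta})\cap\mathfrak g\bigr),\qquad \mathfrak m_k=\sum_{\beta\in\Delta_k}\bigl((\mathfrak g^{\mathbb C}_\beta+\mathfrak g^{\mathbb C}_{-\beta})\cap\mathfrak g\bigr)\quad(k\ge1).$$ Assume that the associated Kähler C-space is of Type IIb: the largest coefficient of $\alpha_{i_0}$ in a root is $2$ (so that $\mathfrak g=\mathfrak h\oplus\mathfrak m_1\oplus\mathfrak m_2$), $\alpha_{i_0}$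 is orthogonal to $\tilde\alpha$ (it is not next to $-\tilde\alpha$ in the extended Dynkin diagram), and removing $\alpha_{i_0}$ from the Dynkin diagram leaves exactly two connected components. Write $\mathfrak h=\mathfrak h_0\oplus\mathfrak h_1\oplus\mathfrak h_2$, where $\mathfrak h_0$ is the center of $\mathfrak h$ and $\mathfrak h_1,\mathfrak h_2$ are simple ideals, numbered so that $[\mathfrak h_2,\mathfrak m_2]=0$. Let $d_1=\dim\mathfrak h_1$, $d_2=\dim\mathfrak h_2$, $d_3=\dim\mathfrak m_1$, $d_4=\dim\mathfrak m_2$. Then for all $u_0,u_1,u_2,x_1,x_2>0$ the Ricci tensor of the left-invariant Riemannian metric on $G$ given on $\mathfrak g$ by $$\langle\cdot,\cdot\rangle=u_0B|_{\mathfrak h_0}+u_1B|_{\mathfrak h_1}+u_2B|_{\mathfrak h_2}+x_1B|_{\mathfrak m_1}+x_2B|_{\mathfrak m_2}$$ is the left-invariant tensor $$r_0u_0B|_{\mathfrak h_0}+r_1u_1B|_{\mathfrak h_1}+r_2u_2B|_{\mathfrak h_2}+r_3x_1B|_{\mathfrak m_1}+r_4x_2B|_{\mathfrak m_2},$$ where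 $$r_0=\frac{u_0}{4x_1^2}\frac{d_3}{d_3+4d_4}+\frac{u_0}{x_2^2}\frac{d_4}{d_3+4d_4},$$ $$r_1=\frac{1}{2d_1u_1}\frac{d_4(2d_1+2-d_4)}{d_3+4d_4}+\frac{u_1}{4x_1^2}\frac{d_3}{d_3+4d_4}+\frac{u_1}{2d_1x_2^2}\frac{d_4(d_4-2)}{d_3+4d_4},$$ $$r_2=\frac{1}{4d_2u_2}\left(d_2-\frac{d_3(d_3+2d_4-2d_1-2)}{2(d_3+4d_4)}\right)+\frac{u_2}{4d_2x_1^2}\frac{d_3(d_3+2d_4-2d_1-2)}{2(d_3+4d_4)},$$ $$r_3=\frac{1}{2x_1}-\frac{x_2}{2x_1^2}\frac{d_4}{d_3+4d_4}-\frac{1}{2x_1^2}\left(u_0\frac{1}{d_3+4d_4}+u_1\frac{d_1}{d_3+4d_4}+u_2\frac{d_3+2d_4-2d_1-2}{2(d_3+4d_4)}\right),$$ $$r_4=\frac{1}{x_2}\frac{2d_4}{d_3+4d_4}+\frac{x_2}{4x_1^2}\frac{d_3}{d_3+4d_4}-\frac{1}{x_2^2}\left(u_0\frac{2}{d_3+4d_4}+u_1\frac{d_4-2}{d_3+4d_4}\right).$$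 -/

import Mathlib

open scoped TensorProduct Manifold ContDiff Bundle

noncomputable section

namespace KaehlerC

/-! ### Compact Lie algebra, maximal torus, roots -/

section LieAlgebraPart

variable {L : Type*} [LieRing L] [LieAlgebra ℝ L]

/-- `B`: the negative of the Killing form. -/
def negKilling (v w : L) : ℝ := -killingForm ℝ L v w

/-- `t` is a maximal abelian subalgebra. -/
def IsMaximalAbelian (t : LieSubalgebra ℝ L) : Prop :=
  Maximal (fun s : LieSubalgebra ℝ L => IsLieAbelian s) t

/-- The subspace of the complexification `ℂ ⊗ L` on which every `H ∈ t` acts as `i α(H)`. The roots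
of a compact Lie algebra are purely imaginary on `t`, so that they are encoded by the real
functionals `α` (the root in the usual sense is `i α`). -/
def rootSpace (t : LieSubalgebra ℝ L) (α : Module.Dual ℝ t) : Submodule ℂ (ℂ ⊗[ℝ] L) :=
  ⨅ H : t, Module.End.eigenspace (LieAlgebra.ad ℂ (ℂ ⊗[ℝ] L) ((1 : ℂ) ⊗ₜ[ℝ] (H : L)))
    (Complex.I * (α H : ℂ))

/-- The root system `Δ`. -/
def roots (t : LieSubalgebra ℝ L) : Set (Module.Dual ℝ t) :=
  {α | α ≠ 0 ∧ rootSpace t α ≠ ⊥}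

/-- `α` is a fundamental system (system of simple roots) of the root system of `t`. -/
structure IsFundamentalSystem {ι : Type*} [Fintype ι] (t : LieSubalgebra ℝ L)
    (α : ι → Module.Dual ℝ t) : Prop where
  linearIndependent : LinearIndependent ℝ α
  mem_roots : ∀ j, α j ∈ roots t
  exists_coeff : ∀ β ∈ roots t, ∃ m : ι → ℕ,
    β = ∑ j, (m j : ℝ) • α j ∨ β = -∑ j, (m j : ℝ) • α j

/-- `Δ_k`: the positive roots whose coefficient at the simple root `α i₀` is `k`. -/
def rootsOfLevel {ι : Type*} [Fintype ι] (t : LieSubalgebra ℝ L) (α : ι → Module.Dual ℝ t)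
    (i₀ : ι) (k : ℕ) : Set (Module.Dual ℝ t) :=
  {β | β ∈ roots t ∧ ∃ m : ι → ℕ, β = ∑ j, (m j : ℝ) • α j ∧ m i₀ = k}

/-- The highest root. -/
def IsHighestRoot {ι : Type*} [Fintype ι] (t : LieSubalgebra ℝ L) (α : ι → Module.Dual ℝ t)
    (θ : Module.Dual ℝ t) : Prop :=
  θ ∈ roots t ∧ ∀ β ∈ roots t, ∃ m : ι → ℕ, θ - β = ∑ j, (m j : ℝ) • α j

/-- `α` and `β` are orthogonal for the inner product on the dual of `t` induced by `B`: if `H` is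
the vector of `t` dual to `α`, then `β(H) = 0`. -/
def RootOrthogonal (t : LieSubalgebra ℝ L) (α β : Module.Dual ℝ t) : Prop :=
  ∃ H : t, (∀ K : t, negKilling (H : L) (K : L) = α K) ∧ β H = 0

/-- The Dynkin diagram as a graph: distinct simple roots are joined if they are not orthogonal. -/
def dynkinGraph {ι : Type*} (t : LieSubalgebra ℝ L) (α : ι → Module.Dual ℝ t) : SimpleGraph ι :=
  SimpleGraph.fromRel fun j k => ¬ RootOrthogonal t (α j) (α k)

/-- The painted Dynkin diagram with the single black vertex `i₀` is of Type IIb: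
* the largest coefficient of `α i₀` in a root is `2` (so that `𝔪 = 𝔪₁ ⊕ 𝔪₂`);
* `α i₀` is not joined to the negative of the highest root in the extended Dynkin diagram;
* removing `α i₀` from the Dynkin diagram leaves exactly two connected components. -/
structure IsTypeIIb {ι : Type*} [Fintype ι] (t : LieSubalgebra ℝ L) (α : ι → Module.Dual ℝ t)
    (i₀ : ι) : Prop where
  two_summands : IsGreatest {k : ℕ | (rootsOfLevel t α i₀ k).Nonempty} 2
  not_adjacent : ∃ θ, IsHighestRoot t α θ ∧ RootOrthogonal t θ (α i₀)
  separates : Nat.card ((dynkinGraph t α).induce {j | j ≠ i₀}).ConnectedComponent = 2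

/-- The real points of `𝔤_β ⊕ 𝔤_{-β}`, that is
`ℝ (E_β + E_{-β}) + ℝ √-1 (E_β - E_{-β})` for a Weyl basis. -/
def realRootPlane (t : LieSubalgebra ℝ L) (β : Module.Dual ℝ t) : Submodule ℝ L :=
  ((rootSpace t β ⊔ rootSpace t (-β)).restrictScalars ℝ).comap (TensorProduct.mk ℝ ℂ L 1)

/-- `∑_{β ∈ Δ_k} (ℝ (E_β + E_{-β}) + ℝ √-1 (E_β - E_{-β}))`; for `k ≥ 1` this is `𝔪_k`. -/
def levelSpace {ι : Type*} [Fintype ι] (t : LieSubalgebra ℝ L) (α : ι → Module.Dual ℝ t)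
    (i₀ : ι) (k : ℕ) : Submodule ℝ L :=
  ⨆ β ∈ rootsOfLevel t α i₀ k, realRootPlane t β

/-- `𝔥`, the Lie algebra of the isotropy group `H` of the Kähler C-space `G/H`. -/
def isotropy {ι : Type*} [Fintype ι] (t : LieSubalgebra ℝ L) (α : ι → Module.Dual ℝ t)
    (i₀ : ι) : Submodule ℝ L :=
  t.toSubmodule ⊔ levelSpace t α i₀ 0

/-- The center of a subspace `h` of `L` that is a subalgebra. -/
def centerOf (h : Submodule ℝ L) : Submodule ℝ L where
  carrier := {x | x ∈ h ∧ ∀ y ∈ h, ⁅x, y⁆ = 0}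
  add_mem' := by
    rintro a b ⟨ha, ha'⟩ ⟨hb, hb'⟩
    exact ⟨h.add_mem ha hb, fun y hy => by rw [add_lie, ha' y hy, hb' y hy, add_zero]⟩
  zero_mem' := ⟨h.zero_mem, fun y _ => zero_lie y⟩
  smul_mem' := by
    rintro c a ⟨ha, ha'⟩
    exact ⟨h.smul_mem c ha, fun y hy => by rw [smul_lie, ha' y hy, smul_zero]⟩

/-- `a` is a simple ideal of the subalgebra `h`. -/
structure IsSimpleIdealOf (a : LieSubalgebra ℝ L) (h : Submodule ℝ L) : Prop where
  le : a.toSubmodule ≤ h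
  lie_mem : ∀ x ∈ h, ∀ y ∈ a, ⁅x, y⁆ ∈ a
  simple : LieAlgebra.IsSimple ℝ a

/-- `𝔥 = 𝔥₀ ⊕ 𝔥₁ ⊕ 𝔥₂` with `𝔥₀` the center of `𝔥` and `𝔥₁`, `𝔥₂` simple ideals, which are
numbered in such a way that `[𝔥₂, 𝔪₂] = 0`. -/
structure IsIsotropyDecomposition {ι : Type*} [Fintype ι] (t : LieSubalgebra ℝ L)
    (α : ι → Module.Dual ℝ t) (i₀ : ι) (h₁ h₂ : LieSubalgebra ℝ L) : Prop where
  ideal₁ : IsSimpleIdealOf h₁ (isotropy t α i₀)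
  ideal₂ : IsSimpleIdealOf h₂ (isotropy t α i₀)
  independent : iSupIndep ![centerOf (isotropy t α i₀), h₁.toSubmodule, h₂.toSubmodule]
  span : centerOf (isotropy t α i₀) ⊔ h₁.toSubmodule ⊔ h₂.toSubmodule = isotropy t α i₀
  numbering : ∀ x ∈ h₂, ∀ y ∈ levelSpace t α i₀ 2, ⁅x, y⁆ = 0

/-- The summands `𝔥₀, 𝔥₁, 𝔥₂, 𝔪₁, 𝔪₂` of `𝔤`. -/
def summands {ι : Type*} [Fintype ι] (t : LieSubalgebra ℝ L) (α : ι → Module.Dual ℝ t) (i₀ : ι)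
    (h₁ h₂ : LieSubalgebra ℝ L) : Fin 5 → Submodule ℝ L :=
  ![centerOf (isotropy t α i₀), h₁.toSubmodule, h₂.toSubmodule,
    levelSpace t α i₀ 1, levelSpace t α i₀ 2]

/-- `β = c₀ B|_{w₀} + ⋯ + c₄ B|_{w₄}` (for a form `β` on `w₀ ⊕ ⋯ ⊕ w₄`). -/
def IsDiagonalForm (w : Fin 5 → Submodule ℝ L) (c : Fin 5 → ℝ) (β : L → L → ℝ) : Prop :=
  ∀ i j, ∀ v ∈ w i, ∀ v' ∈ w j, β v v' = if i = j then c i * negKilling v v' else 0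

end LieAlgebraPart

/-! ### Left-invariant metrics on a Lie group, Levi-Civita connection, Ricci tensor -/

section GroupPart

variable {n : ℕ} {G : Type*} [TopologicalSpace G] [ChartedSpace (EuclideanSpace ℝ (Fin n)) G]
  [Group G]

instance instLieGroupMinSmoothness [LieGroup (𝓡 n) ∞ G] : LieGroup (𝓡 n) (minSmoothness ℝ 3) G := by
  rw [minSmoothness_of_isRCLikeNormedField]
  infer_instance

variable [LieGroup (𝓡 n) ∞ G]

variable (n G) in
/-- Smooth Riemannian metrics on `G`. -/
abbrev Metric := Bundle.ContMDiffRiemannianMetric (𝓡 n) ∞ (EuclideanSpace ℝ (Fin n))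
  (TangentSpace (𝓡 n) : G → Type)

variable (n G) in
/-- Affine connections on `G`; `cov Y x (X x)` is `(∇_X Y)(x)`. -/
abbrev Connection := CovariantDerivative (𝓡 n) (EuclideanSpace ℝ (Fin n))
  (TangentSpace (𝓡 n) : G → Type)

/-- Left translations are isometries of `g`. -/
def IsLeftInvariant (g : Metric n G) : Prop :=
  ∀ (x : G) (v w : GroupLieAlgebra (𝓡 n) G),
    g.inner x (mulInvariantVectorField v x) (mulInvariantVectorField w x) = g.inner 1 v w

/-- `cov` is the Levi-Civita connection of `g`: torsion-free and compatible with `g`. -/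
structure IsLeviCivita (g : Metric n G) (cov : Connection n G) : Prop where
  torsion_free : cov.torsion = 0
  metric : letI : Bundle.RiemannianBundle (TangentSpace (𝓡 n) : G → Type) :=
      ⟨g.toRiemannianMetric⟩
    cov.IsMetricCompatible

/-- `R(X, Y) Z = ∇_X ∇_Y Z - ∇_Y ∇_X Z - ∇_[X, Y] Z`. -/
def curvature (cov : Connection n G) (X Y Z : Π x : G, TangentSpace (𝓡 n) x) (x : G) :
    TangentSpace (𝓡 n) x :=
  cov (fun y => cov Z y (Y y)) x (X x) - cov (fun y => cov Z y (X y)) x (Y x)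
    - cov Z x (VectorField.mlieBracket (𝓡 n) X Y x)

instance instFiniteDimensionalTangentSpace (x : G) :
    FiniteDimensional ℝ (TangentSpace (𝓡 n) x) :=
  inferInstanceAs (FiniteDimensional ℝ (EuclideanSpace ℝ (Fin n)))

/-- The Ricci tensor at `x`, on the values at `x` of the left-invariant fields of `v` and `w`:
the trace of `Z ↦ R(Z, v) w`, computed in a left-invariant frame. Since `R` is a tensor, its
arguments may be taken to be left-invariant. -/
def ricci (cov : Connection n G) (x : G) (v w : GroupLieAlgebra (𝓡 n) G) : ℝ :=
  let e := Module.finBasis ℝ (GroupLieAlgebra (𝓡 n) G)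
  ∑ i, e.coord i (mfderiv (𝓡 n) (𝓡 n) (fun y : G => x⁻¹ * y) x
    (curvature cov (mulInvariantVectorField (e i)) (mulInvariantVectorField v)
      (mulInvariantVectorField w) x))

end GroupPart

end KaehlerC

end

/-!
The Ricci tensor of a left-invariant metric is a trace in the Lie algebra `L` of `G`, and the
assumption of Type IIb determines all the traces that occur by the dimensions of the summands.

*The invariant form.* Since `G` is compact, an inner product on `L` can be averaged over `G` to one
that is invariant under the adjoint representation; differentiating, `ad` is skew for it
(`exists_isInvariantInner`). The derivative of `Ad (x⁻¹) v` at the identity is found from the fact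
that left- and right-invariant vector fields commute (`mlieBracket_rightField`). As `L` is simple,
the negative `B` of the Killing form is then itself an invariant inner product
(`IsInvariantInner.neg_killingForm`).

*The grading.* Let `z ∈ t` be the vector on which `α i₀` is `1` and the other simple roots vanish.
Then `h`, `m₁`, `m₂` are the eigenspaces of `(ad z)²` for `0`, `-1`, `-4`
(`IsTypeIIb.isTwoStepGrading`), so that `[m₁, m₂] ⊆ m₁` and `[m₂, m₂] ⊆ h`, and the center of `h` is
spanned by `z` (`centerOf_isotropy`). The `h`-module `m₁` is irreducible (`IsTypeIIb.irreducible`),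
because `t` and the real root vectors of the simple roots generate `L`. As `α i₀` is orthogonal to the
highest root, `h₁` acts nontrivially on `m₂` (`IsTypeIIb.exists_lie_ne_zero`). From there on only
these properties are used, collected in `IsSplitGrading`. No complexification is needed after the
roots have been described by real root vectors (`IsRootPair`).

*Curvature.* Let `c i` be the coefficients of a metric that is diagonal with respect to the
decomposition of `L`. By Koszul's formula its Levi-Civita connection on left-invariant fields is
`∇_x v = N_v x` with `N_v` expressed by `ad v` and the `c i` (`eq_nablaMap`), and since all traces
linear in `ad` vanish, `Ric (v, v') = -tr (N_v N_v')`. Splitting into blocks gives a linear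
combination, with coefficients that are rational in the `c i`, of the partial Killing forms
`Q_ij (v, v') = -tr (π_j ∘ ad v ∘ π_i ∘ ad v')` with `π_i` the orthogonal projection to the `i`-th
summand (`trace_curvature`).

*The partial Killing forms.* They are invariant under `h`, so that distinct summands are orthogonal
for them (`pform_off_diagonal`). On `m₁`, `h₁` and `h₂` they are multiples of `B` by irreducibility
(`exists_scalar`), and on `h₀` trivially; on `m₂` those that occur are found directly, though `m₂`
is not assumed to be irreducible. The constants come from four facts: `∑ Q_ij = B` (`total`); hence
`B (z, z) = d₃ + 4 d₄` (`form_z_z`); the trace form of `m₁` is one and the same multiple of `B` on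
`h₁` and on `m₂`, because `h₀ + h₁ + m₂` is generated, as an ideal of `h + m₂`, by `z`
(`pform_m₁_m₁`); and the trace of `Q_ij` over the `k`-th summand is symmetric in `i, j, k`
(`ptrace_swap_right`), which carries a constant from one summand to another. Substituting them
yields the formula (`sum_curvature`).
-/


open scoped Topology

noncomputable section

namespace KaehlerC

/-! ### Positive definite forms on finite-dimensional real vector spaces -/

section PositiveDefinite

variable {V : Type*} [AddCommGroup V] [Module ℝ V]

/-- A symmetric positive definite bilinear form. It is kept as a predicate on forms, so that no
norm is put on the underlying space. -/
structure IsInner (B : LinearMap.BilinForm ℝ V) : Prop where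
  symm : ∀ x y, B x y = B y x
  pos : ∀ x, x ≠ 0 → 0 < B x x

namespace IsInner

variable {B : LinearMap.BilinForm ℝ V}

lemma nonneg (hB : IsInner B) (x : V) : 0 ≤ B x x := by
  rcases eq_or_ne x 0 with rfl | hx
  · simp
  · exact (hB.pos x hx).le

lemma eq_zero (hB : IsInner B) {x : V} (h : B x x = 0) : x = 0 := by
  by_contra hx
  exact (hB.pos x hx).ne' h

lemma restrict (hB : IsInner B) (W : Submodule ℝ V) : IsInner (B.restrict W) where
  symm x y := hB.symm x y
  pos x hx := hB.pos x (by simpa using hx)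

/-- The inner product space structure given by a positive definite form. -/
@[reducible] def core (hB : IsInner B) : InnerProductSpace.Core ℝ V where
  inner x y := B x y
  conj_inner_symm x y := hB.symm y x
  re_inner_nonneg x := hB.nonneg x
  add_left x y z := by simp
  smul_left x y r := by simp
  definite x h := hB.eq_zero h

lemma exists_orthonormal_basis [FiniteDimensional ℝ V] (hB : IsInner B) :
    ∃ e : Module.Basis (Fin (Module.finrank ℝ V)) ℝ V,
      ∀ a b, B (e a) (e b) = if a = b then 1 else 0 := by
  let _ : NormedAddCommGroup V := hB.core.toNormedAddCommGroup
  let _ : InnerProductSpace ℝ V := InnerProductSpace.ofCore hB.core.toCore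
  refine ⟨(stdOrthonormalBasis ℝ V).toBasis, fun a b => ?_⟩
  rw [OrthonormalBasis.coe_toBasis]
  exact orthonormal_iff_ite.1 (stdOrthonormalBasis ℝ V).orthonormal a b

/-- A symmetric form is a multiple of `B` on some nonzero vector. -/
lemma exists_eigenvector_top [FiniteDimensional ℝ V] [Nontrivial V] (hB : IsInner B)
    (F : LinearMap.BilinForm ℝ V) (hF : ∀ x y, F x y = F y x) :
    ∃ c : ℝ, ∃ v, v ≠ 0 ∧ ∀ y, F v y = c * B v y := by
  let _ : NormedAddCommGroup V := hB.core.toNormedAddCommGroup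
  let _ : InnerProductSpace ℝ V := InnerProductSpace.ofCore hB.core.toCore
  obtain ⟨e, he⟩ := hB.exists_orthonormal_basis
  -- The operator that represents `F` with respect to `B`.
  let T : V →ₗ[ℝ] V := ∑ a, (F.flip (e a)).smulRight (e a)
  have hT : ∀ x y, B (T x) y = F x y := by
    intro x y
    have : (B ∘ₗ T) x = F x := by
      refine e.ext fun b => ?_
      simp [T, he]
    exact congrArg (fun f => f y) this
  have hsym : T.IsSymmetric := fun x y => by
    change B (T x) y = B x (T y)
    rw [hB.symm x, hT, hT, hF]
  obtain ⟨c, hc⟩ : ∃ c : ℝ, Module.End.HasEigenvalue T c := by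
    by_contra! h
    exact not_subsingleton V (hsym.subsingleton_of_no_eigenvalue_finiteDimensional
      fun c => by simpa [Module.End.HasEigenvalue, Module.End.HasUnifEigenvalue] using h c)
  obtain ⟨v, hv⟩ := hc.exists_hasEigenvector
  refine ⟨c, v, hv.2, fun y => ?_⟩
  rw [← hT, hv.apply_eq_smul]
  simp

lemma exists_eigenvector [FiniteDimensional ℝ V] (hB : IsInner B)
    (F : LinearMap.BilinForm ℝ V) (W : Submodule ℝ V) (hF : ∀ x ∈ W, ∀ y ∈ W, F x y = F y x)
    (hW : W ≠ ⊥) :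
    ∃ c : ℝ, ∃ v ∈ W, v ≠ 0 ∧ ∀ y ∈ W, F v y = c * B v y := by
  have := Submodule.nontrivial_iff_ne_bot.2 hW
  obtain ⟨c, v, hv, h⟩ := (hB.restrict W).exists_eigenvector_top (F.restrict W)
    fun x y => hF x x.2 y y.2
  exact ⟨c, v, v.2, by simpa using hv, fun y hy => h ⟨y, hy⟩⟩

lemma exists_add_orthogonal [FiniteDimensional ℝ V] (hB : IsInner B) (W : Submodule ℝ V) (x : V) :
    ∃ y ∈ W, ∃ z, (∀ w ∈ W, B w z = 0) ∧ x = y + z := by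
  obtain ⟨e, he⟩ := (hB.restrict W).exists_orthonormal_basis
  have he' : ∀ a b, B (e a) (e b) = if a = b then 1 else 0 := he
  refine ⟨∑ a, B (e a) x • (e a : V), W.sum_mem fun a _ => W.smul_mem _ (e a).2,
    x - ∑ a, B (e a) x • (e a : V), fun w hw => ?_, by abel⟩
  have key : ∀ b, B (e b) (x - ∑ a, B (e a) x • (e a : V)) = 0 := by
    intro b
    simp [he']
  have h0 : (B.flip (x - ∑ a, B (e a) x • (e a : V))) ∘ₗ W.subtype = 0 :=
    e.ext fun b => by simpa using key b
  simpa using congrArg (fun f => f ⟨w, hw⟩) h0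

lemma eq_top_of_orthogonal [FiniteDimensional ℝ V] (hB : IsInner B) (W : Submodule ℝ V)
    (h : ∀ x, (∀ w ∈ W, B w x = 0) → x = 0) : W = ⊤ := by
  refine eq_top_iff.2 fun x _ => ?_
  obtain ⟨y, hy, z, hz, rfl⟩ := hB.exists_add_orthogonal W x
  rwa [h z hz, add_zero]

end IsInner

end PositiveDefinite

/-! ### Real root vectors -/

section RootPairs

variable {L : Type*} [LieRing L] [LieAlgebra ℝ L]

/-- A positive definite form that is invariant under the adjoint representation. -/
structure IsInvariantInner (B : LinearMap.BilinForm ℝ L) : Prop extends IsInner B where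
  inv : ∀ x y z : L, B ⁅x, y⁆ z = -B y ⁅x, z⁆

/-- `X - i Y` is a vector of the root space of `β` (possibly zero, and `β = 0` is allowed): the
real form of the eigenvalue equations. -/
def IsRootPair (t : LieSubalgebra ℝ L) (β : Module.Dual ℝ t) (X Y : L) : Prop :=
  ∀ H : t, ⁅(H : L), X⁆ = β H • Y ∧ ⁅(H : L), Y⁆ = -(β H • X)

namespace IsRootPair

variable {t : LieSubalgebra ℝ L} {β γ : Module.Dual ℝ t} {X Y V W : L}

lemma neg (h : IsRootPair t β X Y) : IsRootPair t (-β) X (-Y) := fun H => by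
  simp [(h H).1, (h H).2]

lemma swap (h : IsRootPair t β X Y) : IsRootPair t β Y (-X) := fun H => by
  simp [(h H).1, (h H).2]

lemma add (h : IsRootPair t β X Y) (h' : IsRootPair t β V W) :
    IsRootPair t β (X + V) (Y + W) := fun H => by
  simp only [lie_add, (h H).1, (h H).2, (h' H).1, (h' H).2, smul_add, neg_add, and_self]

lemma smul (h : IsRootPair t β X Y) (c : ℝ) : IsRootPair t β (c • X) (c • Y) := fun H => by
  simp only [lie_smul, (h H).1, (h H).2, smul_neg, smul_comm c, and_self]

lemma right_ne_zero (h : IsRootPair t β X Y) (hβ : β ≠ 0) (hX : X ≠ 0) : Y ≠ 0 := by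
  rintro rfl
  obtain ⟨H, hH⟩ : ∃ H, β H ≠ 0 := by
    by_contra! hc
    exact hβ (LinearMap.ext hc)
  have := (h H).2
  simp [hH, hX] at this

lemma left_ne_zero (h : IsRootPair t β X Y) (hβ : β ≠ 0) (hY : Y ≠ 0) : X ≠ 0 := by
  have := h.swap.right_ne_zero hβ hY
  simpa using this

/-- The bracket of `X + i Y` (a vector for `-β`) and `V - i W` (a vector for `γ`). -/
lemma lie_conj (h : IsRootPair t β X Y) (h' : IsRootPair t γ V W) :
    IsRootPair t (γ - β) (⁅X, V⁆ + ⁅Y, W⁆) (⁅X, W⁆ - ⁅Y, V⁆) := fun H => by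
  have e : ∀ A C : L, ⁅(H : L), ⁅A, C⁆⁆ = ⁅⁅(H : L), A⁆, C⁆ + ⁅A, ⁅(H : L), C⁆⁆ :=
    fun A C => leibniz_lie _ _ _
  constructor
  · simp only [lie_add, e, (h H).1, (h H).2, (h' H).1, (h' H).2, smul_lie, neg_lie, lie_neg,
      lie_smul, LinearMap.sub_apply]
    module
  · simp only [lie_sub, e, (h H).1, (h H).2, (h' H).1, (h' H).2, smul_lie, neg_lie, lie_neg,
      lie_smul, LinearMap.sub_apply]
    module

lemma lie_self_commute (h : IsRootPair t β X Y) (H : t) : ⁅(H : L), ⁅X, Y⁆⁆ = 0 := by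
  rw [leibniz_lie, (h H).1, (h H).2]
  simp

/-- `[X, Y]` is a positive multiple of the vector of `t` dual to `β`. -/
lemma form_lie (h : IsRootPair t β X Y) {B : LinearMap.BilinForm ℝ L} (hB : IsInvariantInner B)
    (H : t) : B ⁅X, Y⁆ (H : L) = β H * B X X := by
  rw [← lie_skew, map_neg, LinearMap.neg_apply, hB.inv, ← lie_skew, (h H).2]
  simp

end IsRootPair

/-- A nonzero subspace invariant under a torus `t` contains a real root vector: on a minimal
invariant subspace the symmetric operators `ad H ∘ ad H'` are scalars. -/
lemma exists_isRootPair [FiniteDimensional ℝ L] {B : LinearMap.BilinForm ℝ L}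
    (hB : IsInvariantInner B) (t : LieSubalgebra ℝ L)
    (ht : ∀ H ∈ t, ∀ K ∈ t, ⁅H, K⁆ = 0) (N : Submodule ℝ L)
    (hN : ∀ H ∈ t, ∀ x ∈ N, ⁅H, x⁆ ∈ N) (hN0 : N ≠ ⊥) :
    ∃ β X Y, X ∈ N ∧ Y ∈ N ∧ X ≠ 0 ∧ IsRootPair t β X Y := by
  obtain ⟨U, ⟨hUN, hU, hU0⟩, hmin⟩ := wellFounded_lt.has_min
    {U : Submodule ℝ L | U ≤ N ∧ (∀ H ∈ t, ∀ x ∈ U, ⁅H, x⁆ ∈ U) ∧ U ≠ ⊥} ⟨N, le_rfl, hN, hN0⟩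
  have comm : ∀ H ∈ t, ∀ K ∈ t, ∀ x : L, ⁅H, ⁅K, x⁆⁆ = ⁅K, ⁅H, x⁆⁆ := fun H hH K hK x => by
    rw [leibniz_lie, ht H hH K hK, zero_lie, zero_add]
  have scalar : ∀ H ∈ t, ∀ K ∈ t, ∃ c : ℝ, ∀ x ∈ U, ⁅H, ⁅K, x⁆⁆ = c • x := by
    intro H hH K hK
    let A : L →ₗ[ℝ] L := LieAlgebra.ad ℝ L H ∘ₗ LieAlgebra.ad ℝ L K
    obtain ⟨c, v, hv, hv0, hc⟩ := hB.exists_eigenvector (B ∘ₗ A) U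
      (fun x _ y _ => by
        simp only [A, LinearMap.comp_apply, LieAlgebra.ad_apply]
        rw [hB.inv, hB.inv, neg_neg, comm K hK H hH, hB.symm]) hU0
    have hAv : A v - c • v = 0 := by
      have hmem : A v - c • v ∈ U := U.sub_mem (hU H hH _ (hU K hK _ hv)) (U.smul_mem c hv)
      refine hB.eq_zero ?_
      have := hc _ hmem
      rw [LinearMap.comp_apply] at this
      have e : B (A v - c • v) (A v - c • v) =
          B (A v) (A v - c • v) - c * B v (A v - c • v) := by simp
      rw [e, this, sub_self]
    have hle : U ≤ LinearMap.ker (A - c • LinearMap.id) := by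
      have hU' : U ⊓ LinearMap.ker (A - c • LinearMap.id) = U := by
        by_contra hne
        refine hmin _ ⟨inf_le_left.trans hUN, ?_, ?_⟩ (lt_of_le_of_ne inf_le_left hne)
        · rintro J hJ x ⟨hx, hx'⟩
          refine ⟨hU J hJ x hx, ?_⟩
          have hx'' : ⁅H, ⁅K, x⁆⁆ - c • x = 0 := by simpa [A] using hx'
          have : ⁅J, ⁅H, ⁅K, x⁆⁆ - c • x⁆ = 0 := by rw [hx'', lie_zero]
          rw [lie_sub, lie_smul, comm J hJ H hH, comm J hJ K hK] at this
          simpa [A] using this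
        · refine (Submodule.ne_bot_iff _).2 ⟨v, ⟨hv, ?_⟩, hv0⟩
          simpa using hAv
      exact inf_eq_left.1 hU'
    refine ⟨c, fun x hx => ?_⟩
    have := hle hx
    simpa [A, sub_eq_zero] using this
  by_cases hall : ∀ H ∈ t, ∀ x ∈ U, ⁅H, x⁆ = 0
  · obtain ⟨x, hx, hx0⟩ := (Submodule.ne_bot_iff _).1 hU0
    exact ⟨0, x, 0, hUN hx, N.zero_mem, hx0, fun H => by simp [hall H H.2 x hx]⟩
  push Not at hall
  obtain ⟨H₀, hH₀, X, hX, hne⟩ := hall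
  obtain ⟨c, hc⟩ := scalar H₀ hH₀ H₀ hH₀
  have hX0 : X ≠ 0 := by
    rintro rfl
    simp at hne
  have hcneg : c < 0 := by
    have h1 : c * B X X = -B ⁅H₀, X⁆ ⁅H₀, X⁆ := by
      rw [← hB.inv, hc X hX]
      simp
    have h2 := hB.pos X hX0
    have h3 := hB.pos _ hne
    nlinarith
  set r : ℝ := (√(-c))⁻¹ with hr
  have hrc : r * r * c = -1 := by
    have : √(-c) * √(-c) = -c := Real.mul_self_sqrt (by linarith)
    have hc0 := hcneg.ne
    rw [hr, ← mul_inv, this, inv_neg, neg_mul, inv_mul_cancel₀ hc0]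
  have hr0 : r ≠ 0 := by
    rintro h0
    rw [h0] at hrc
    norm_num at hrc
  set Y : L := r • ⁅H₀, X⁆ with hY
  have hYU : Y ∈ U := U.smul_mem r (hU _ hH₀ _ hX)
  have hY0 : Y ≠ 0 := smul_ne_zero hr0 hne
  have hk : ∀ H ∈ t, ∃ k : ℝ, ⁅H, X⁆ = k • Y ∧ ⁅H, Y⁆ = -(k • X) := by
    intro H hH
    obtain ⟨d, hd⟩ := scalar H hH H₀ hH₀
    refine ⟨-(r * d), ?_, ?_⟩
    · have h1 : c • ⁅H, X⁆ = d • ⁅H₀, X⁆ := by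
        rw [← hc _ (hU H hH X hX), comm H₀ hH₀ H hH, hd X hX, lie_smul]
      have h2 : ⁅H, X⁆ = -(r * r * c) • ⁅H, X⁆ := by rw [hrc]; simp
      rw [h2, neg_smul, mul_smul, h1, hY]
      module
    · rw [hY, lie_smul, hd X hX]
      module
  let β : Module.Dual ℝ t := -((B Y Y)⁻¹ • (B.flip Y ∘ₗ LieAlgebra.ad ℝ L X ∘ₗ
    t.toSubmodule.subtype))
  refine ⟨β, X, Y, hUN hX, hUN hYU, hX0, fun H => ?_⟩
  obtain ⟨k, hk1, hk2⟩ := hk H H.2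
  have hβ : β H = k := by
    have : β H = (B Y Y)⁻¹ * B ⁅(H : L), X⁆ Y := by
      rw [← lie_skew, LinearMap.map_neg₂, mul_neg]
      rfl
    rw [this, hk1]
    have := (hB.pos Y hY0).ne'
    simp
    field_simp
  rw [hβ]
  exact ⟨hk1, hk2⟩

/-! ### The complexification in terms of real root vectors -/

/-- The real part of an element of the complexification. -/
def complexRe : ℂ ⊗[ℝ] L →ₗ[ℝ] L := TensorProduct.lid ℝ L ∘ₗ LinearMap.rTensor L Complex.reLm

/-- The imaginary part of an element of the complexification. -/
def complexIm : ℂ ⊗[ℝ] L →ₗ[ℝ] L := TensorProduct.lid ℝ L ∘ₗ LinearMap.rTensor L Complex.imLm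

@[simp] lemma complexRe_tmul (c : ℂ) (x : L) : complexRe (c ⊗ₜ[ℝ] x) = c.re • x := by
  simp [complexRe]

@[simp] lemma complexIm_tmul (c : ℂ) (x : L) : complexIm (c ⊗ₜ[ℝ] x) = c.im • x := by
  simp [complexIm]

lemma exists_tmul_sub_tmul (z : ℂ ⊗[ℝ] L) :
    ∃ X Y : L, z = (1 : ℂ) ⊗ₜ[ℝ] X - Complex.I ⊗ₜ[ℝ] Y := by
  induction z with
  | zero => exact ⟨0, 0, by simp⟩
  | tmul c x =>
    refine ⟨c.re • x, -(c.im • x), ?_⟩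
    rw [TensorProduct.tmul_neg, ← TensorProduct.smul_tmul, ← TensorProduct.smul_tmul,
      sub_neg_eq_add, ← TensorProduct.add_tmul]
    congr 1
    apply Complex.ext <;> simp
  | add x y hx hy =>
    obtain ⟨X, Y, rfl⟩ := hx
    obtain ⟨V, W, rfl⟩ := hy
    exact ⟨X + V, Y + W, by simp only [TensorProduct.tmul_add]; abel⟩

lemma tmul_sub_tmul_inj {X Y V W : L}
    (h : (1 : ℂ) ⊗ₜ[ℝ] X - Complex.I ⊗ₜ[ℝ] Y = (1 : ℂ) ⊗ₜ[ℝ] V - Complex.I ⊗ₜ[ℝ] W) :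
    X = V ∧ Y = W :=
  ⟨by simpa using congrArg complexRe h, by simpa using congrArg complexIm h⟩

variable (t : LieSubalgebra ℝ L) (β : Module.Dual ℝ t)

lemma mem_rootSpace_iff (X Y : L) :
    (1 : ℂ) ⊗ₜ[ℝ] X - Complex.I ⊗ₜ[ℝ] Y ∈ rootSpace t β ↔ IsRootPair t β X Y := by
  simp only [rootSpace, Submodule.mem_iInf, Module.End.mem_eigenspace_iff, IsRootPair]
  refine forall_congr' fun H => ?_
  have e1 : (LieAlgebra.ad ℂ (ℂ ⊗[ℝ] L) ((1 : ℂ) ⊗ₜ[ℝ] (H : L)))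
      ((1 : ℂ) ⊗ₜ[ℝ] X - Complex.I ⊗ₜ[ℝ] Y) =
      (1 : ℂ) ⊗ₜ[ℝ] ⁅(H : L), X⁆ - Complex.I ⊗ₜ[ℝ] ⁅(H : L), Y⁆ := by
    simp [LieAlgebra.ExtendScalars.bracket_tmul]
  have e2 : (Complex.I * (β H : ℂ)) • ((1 : ℂ) ⊗ₜ[ℝ] X - Complex.I ⊗ₜ[ℝ] Y) =
      (1 : ℂ) ⊗ₜ[ℝ] (β H • Y) - Complex.I ⊗ₜ[ℝ] (-(β H • X)) := by
    rw [smul_sub, TensorProduct.smul_tmul', TensorProduct.smul_tmul', TensorProduct.tmul_neg,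
      ← TensorProduct.smul_tmul, ← TensorProduct.smul_tmul, sub_neg_eq_add, add_comm,
      sub_eq_add_neg, ← TensorProduct.neg_tmul]
    congr 2 <;> apply Complex.ext <;> simp
  rw [e1, e2]
  exact ⟨fun h => tmul_sub_tmul_inj h, fun h => by rw [h.1, h.2]⟩

lemma mem_roots_iff : β ∈ roots t ↔ β ≠ 0 ∧ ∃ X Y : L, X ≠ 0 ∧ IsRootPair t β X Y := by
  refine and_congr_right fun hβ => ?_
  rw [Submodule.ne_bot_iff]
  constructor
  · rintro ⟨z, hz, hz0⟩
    obtain ⟨X, Y, rfl⟩ := exists_tmul_sub_tmul z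
    rw [mem_rootSpace_iff] at hz
    refine ⟨X, Y, fun hX => hz0 ?_, hz⟩
    have hY : Y = 0 := by
      by_contra hY
      exact hz.left_ne_zero hβ hY hX
    simp [hX, hY]
  · rintro ⟨X, Y, hX, h⟩
    refine ⟨_, (mem_rootSpace_iff t β X Y).2 h, fun h0 => hX ?_⟩
    simpa using congrArg complexRe h0

lemma mem_realRootPlane_iff (X : L) : X ∈ realRootPlane t β ↔ ∃ Y, IsRootPair t β X Y := by
  rw [realRootPlane, Submodule.mem_comap, Submodule.restrictScalars_mem, Submodule.mem_sup]
  constructor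
  · rintro ⟨a, ha, b, hb, hab⟩
    obtain ⟨X₁, Y₁, rfl⟩ := exists_tmul_sub_tmul a
    obtain ⟨X₂, Y₂, rfl⟩ := exists_tmul_sub_tmul b
    rw [mem_rootSpace_iff] at ha hb
    have h1 : X₁ + X₂ = X := by simpa using congrArg complexRe hab
    have hb' := hb.neg
    rw [neg_neg] at hb'
    exact ⟨_, h1 ▸ ha.add hb'⟩
  · rintro ⟨Y, h⟩
    refine ⟨_, (mem_rootSpace_iff t β _ _).2 (h.smul 2⁻¹), _,
      (mem_rootSpace_iff t (-β) _ _).2 (h.neg.smul 2⁻¹), ?_⟩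
    have : (1 : ℂ) ⊗ₜ[ℝ] ((2 : ℝ)⁻¹ • X) + (1 : ℂ) ⊗ₜ[ℝ] ((2 : ℝ)⁻¹ • X) = (1 : ℂ) ⊗ₜ[ℝ] X := by
      rw [← TensorProduct.tmul_add, ← add_smul]
      norm_num
    simp only [smul_neg, TensorProduct.tmul_neg, TensorProduct.mk_apply]
    rw [← this]
    abel

end RootPairs

/-! ### Gradings with two summands -/

section Grading

variable {L : Type*} [LieRing L] [LieAlgebra ℝ L]

/-- The decomposition `L = h ⊕ m₁ ⊕ m₂` into the eigenspaces of `(ad z)²` for the eigenvalues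
`0`, `-1` and `-4`. -/
structure IsTwoStepGrading (B : LinearMap.BilinForm ℝ L) (z : L) (h m₁ m₂ : Submodule ℝ L) :
    Prop extends IsInvariantInner B where
  mem_h : ∀ x, x ∈ h ↔ ⁅z, x⁆ = 0
  mem_m₁ : ∀ x, x ∈ m₁ ↔ ⁅z, ⁅z, x⁆⁆ = -x
  mem_m₂ : ∀ x, x ∈ m₂ ↔ ⁅z, ⁅z, x⁆⁆ = -((4 : ℝ) • x)
  span : h ⊔ m₁ ⊔ m₂ = ⊤

lemma IsInvariantInner.lie_eq_zero_of_sq {B : LinearMap.BilinForm ℝ L} (hB : IsInvariantInner B)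
    {z x : L} (hx : ⁅z, ⁅z, x⁆⁆ = 0) : ⁅z, x⁆ = 0 := by
  apply hB.eq_zero
  rw [hB.inv, hx]
  simp

lemma IsInvariantInner.inv_sq {B : LinearMap.BilinForm ℝ L} (hB : IsInvariantInner B)
    (z x y : L) : B ⁅z, ⁅z, x⁆⁆ y = B x ⁅z, ⁅z, y⁆⁆ := by
  rw [hB.inv, hB.inv, neg_neg]

namespace IsTwoStepGrading

variable {B : LinearMap.BilinForm ℝ L} {z : L} {h m₁ m₂ : Submodule ℝ L}

lemma exists_add (hg : IsTwoStepGrading B z h m₁ m₂) (x : L) :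
    ∃ a ∈ h, ∃ b ∈ m₁, ∃ c ∈ m₂, x = a + b + c := by
  have hx : x ∈ h ⊔ m₁ ⊔ m₂ := hg.span ▸ Submodule.mem_top
  obtain ⟨y, hy, c, hc, rfl⟩ := Submodule.mem_sup.1 hx
  obtain ⟨a, ha, b, hb, rfl⟩ := Submodule.mem_sup.1 hy
  exact ⟨a, ha, b, hb, c, hc, rfl⟩

lemma orthogonal_h_m₁ (hg : IsTwoStepGrading B z h m₁ m₂) {x y : L} (hx : x ∈ h) (hy : y ∈ m₁) :
    B x y = 0 := by
  have := hg.inv_sq z x y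
  rw [(hg.mem_h x).1 hx, (hg.mem_m₁ y).1 hy] at this
  simpa using this

lemma orthogonal_h_m₂ (hg : IsTwoStepGrading B z h m₁ m₂) {x y : L} (hx : x ∈ h) (hy : y ∈ m₂) :
    B x y = 0 := by
  have := hg.inv_sq z x y
  rw [(hg.mem_h x).1 hx, (hg.mem_m₂ y).1 hy] at this
  simpa using this

lemma orthogonal_m₁_m₂ (hg : IsTwoStepGrading B z h m₁ m₂) {x y : L} (hx : x ∈ m₁)
    (hy : y ∈ m₂) : B x y = 0 := by
  have := hg.inv_sq z x y
  rw [(hg.mem_m₁ x).1 hx, (hg.mem_m₂ y).1 hy] at this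
  simp only [map_neg, map_smul, LinearMap.neg_apply, smul_eq_mul] at this
  linarith

lemma z_mem (hg : IsTwoStepGrading B z h m₁ m₂) : z ∈ h := (hg.mem_h z).2 (lie_self z)

lemma lie_h_h (hg : IsTwoStepGrading B z h m₁ m₂) {x y : L} (hx : x ∈ h) (hy : y ∈ h) :
    ⁅x, y⁆ ∈ h := by
  rw [hg.mem_h] at hx hy ⊢
  rw [leibniz_lie, hx, hy, zero_lie, lie_zero, add_zero]

/-- `ad h` commutes with `ad z`. -/
lemma lie_z_comm (hg : IsTwoStepGrading B z h m₁ m₂) {x : L} (hx : x ∈ h) (y : L) :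
    ⁅z, ⁅x, y⁆⁆ = ⁅x, ⁅z, y⁆⁆ := by
  rw [leibniz_lie, (hg.mem_h x).1 hx, zero_lie, zero_add]

lemma lie_h_m₁ (hg : IsTwoStepGrading B z h m₁ m₂) {x y : L} (hx : x ∈ h) (hy : y ∈ m₁) :
    ⁅x, y⁆ ∈ m₁ := by
  rw [hg.mem_m₁, hg.lie_z_comm hx, hg.lie_z_comm hx, (hg.mem_m₁ y).1 hy, lie_neg]

lemma lie_h_m₂ (hg : IsTwoStepGrading B z h m₁ m₂) {x y : L} (hx : x ∈ h) (hy : y ∈ m₂) :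
    ⁅x, y⁆ ∈ m₂ := by
  rw [hg.mem_m₂, hg.lie_z_comm hx, hg.lie_z_comm hx, (hg.mem_m₂ y).1 hy, lie_neg, lie_smul]

/-- The second derivative of a bracket along `ad z`. -/
lemma lie_lie_lie (z x y : L) : ⁅z, ⁅z, ⁅x, y⁆⁆⁆ =
    ⁅⁅z, ⁅z, x⁆⁆, y⁆ + (2 : ℝ) • ⁅⁅z, x⁆, ⁅z, y⁆⁆ + ⁅x, ⁅z, ⁅z, y⁆⁆⁆ := by
  have e : ∀ A C : L, ⁅z, ⁅A, C⁆⁆ = ⁅⁅z, A⁆, C⁆ + ⁅A, ⁅z, C⁆⁆ := fun A C => leibniz_lie _ _ _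
  rw [e x y, lie_add, e ⁅z, x⁆ y, e x ⁅z, y⁆, two_smul]
  abel

lemma lie_z_m₁ (hg : IsTwoStepGrading B z h m₁ m₂) {x : L} (hx : x ∈ m₁) : ⁅z, x⁆ ∈ m₁ :=
  hg.lie_h_m₁ hg.z_mem hx

lemma lie_z_m₂ (hg : IsTwoStepGrading B z h m₁ m₂) {x : L} (hx : x ∈ m₂) : ⁅z, x⁆ ∈ m₂ :=
  hg.lie_h_m₂ hg.z_mem hx

lemma lie_add_mem_h (hg : IsTwoStepGrading B z h m₁ m₂) {x y : L} (hx : x ∈ m₁) (hy : y ∈ m₁) :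
    ⁅x, y⁆ + ⁅⁅z, x⁆, ⁅z, y⁆⁆ ∈ h := by
  rw [hg.mem_h]
  apply hg.lie_eq_zero_of_sq
  rw [lie_add, lie_add, lie_lie_lie z x y, lie_lie_lie z ⁅z, x⁆ ⁅z, y⁆,
    (hg.mem_m₁ x).1 hx, (hg.mem_m₁ y).1 hy]
  simp only [neg_lie, lie_neg, neg_neg]
  module

lemma lie_sub_mem_m₂ (hg : IsTwoStepGrading B z h m₁ m₂) {x y : L} (hx : x ∈ m₁) (hy : y ∈ m₁) :
    ⁅x, y⁆ - ⁅⁅z, x⁆, ⁅z, y⁆⁆ ∈ m₂ := by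
  rw [hg.mem_m₂]
  rw [lie_sub, lie_sub, lie_lie_lie z x y, lie_lie_lie z ⁅z, x⁆ ⁅z, y⁆,
    (hg.mem_m₁ x).1 hx, (hg.mem_m₁ y).1 hy]
  simp only [neg_lie, lie_neg, neg_neg]
  module

lemma lie_m₁_m₁ (hg : IsTwoStepGrading B z h m₁ m₂) {x y : L} (hx : x ∈ m₁) (hy : y ∈ m₁) :
    ⁅x, y⁆ ∈ h ⊔ m₂ := by
  have e : ⁅x, y⁆ = (2 : ℝ)⁻¹ • (⁅x, y⁆ + ⁅⁅z, x⁆, ⁅z, y⁆⁆) +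
      (2 : ℝ)⁻¹ • (⁅x, y⁆ - ⁅⁅z, x⁆, ⁅z, y⁆⁆) := by module
  rw [e]
  exact Submodule.add_mem_sup (h.smul_mem _ (hg.lie_add_mem_h hx hy))
    (m₂.smul_mem _ (hg.lie_sub_mem_m₂ hx hy))

/-- An eigenvector of `(ad z)²` for `-c` vanishes unless `c` is `0`, `1` or `4`. -/
lemma eq_zero_of_eigenvector (hg : IsTwoStepGrading B z h m₁ m₂) {x : L} {c : ℝ}
    (hx : ⁅z, ⁅z, x⁆⁆ = -(c • x)) (h0 : c ≠ 0) (h1 : c ≠ 1) (h4 : c ≠ 4) : x = 0 := by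
  apply hg.eq_zero
  obtain ⟨a, ha, b, hb, d, hd, hs⟩ := hg.exists_add x
  have h2 : B x x = B x a + B x b + B x d := by
    rw [← map_add, ← map_add, ← hs]
  have ea := hg.inv_sq z x a
  have eb := hg.inv_sq z x b
  have ed := hg.inv_sq z x d
  rw [hx, (hg.mem_h a).1 ha] at ea
  rw [hx, (hg.mem_m₁ b).1 hb] at eb
  rw [hx, (hg.mem_m₂ d).1 hd] at ed
  simp only [map_neg, map_smul, LinearMap.neg_apply, LinearMap.smul_apply, smul_eq_mul, lie_zero,
    map_zero, neg_eq_zero, mul_eq_zero, neg_inj] at ea eb ed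
  have eb' : (c - 1) * B x b = 0 := by linarith
  have ed' : (c - 4) * B x d = 0 := by linarith
  rw [h2, ea.resolve_left h0, (mul_eq_zero.1 eb').resolve_left (sub_ne_zero.2 h1),
    (mul_eq_zero.1 ed').resolve_left (sub_ne_zero.2 h4)]
  simp

lemma lie_m₁_m₂ (hg : IsTwoStepGrading B z h m₁ m₂) {x y : L} (hx : x ∈ m₁) (hy : y ∈ m₂) :
    ⁅x, y⁆ ∈ m₁ := by
  -- A multiple of the component of `⁅x, y⁆` in degree `3`, an eigenvector of `(ad z)²` for `-9`.
  have h0 : ⁅⁅z, x⁆, ⁅z, y⁆⁆ - (2 : ℝ) • ⁅x, y⁆ = 0 := by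
    refine hg.eq_zero_of_eigenvector (c := 9) ?_ (by norm_num) (by norm_num) (by norm_num)
    rw [lie_sub, lie_sub, lie_smul, lie_smul, lie_lie_lie z x y, lie_lie_lie z ⁅z, x⁆ ⁅z, y⁆,
      (hg.mem_m₁ x).1 hx, (hg.mem_m₂ y).1 hy]
    simp only [neg_lie, lie_neg, neg_neg, smul_neg, lie_smul]
    module
  rw [hg.mem_m₁, lie_lie_lie, (hg.mem_m₁ x).1 hx, (hg.mem_m₂ y).1 hy, sub_eq_zero.1 h0]
  simp only [neg_lie, lie_neg, lie_smul]
  module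

lemma lie_m₂_m₂ (hg : IsTwoStepGrading B z h m₁ m₂) {x y : L} (hx : x ∈ m₂) (hy : y ∈ m₂) :
    ⁅x, y⁆ ∈ h := by
  -- A multiple of the component of `⁅x, y⁆` in degree `4`.
  have h0 : ⁅⁅z, x⁆, ⁅z, y⁆⁆ - (4 : ℝ) • ⁅x, y⁆ = 0 := by
    refine hg.eq_zero_of_eigenvector (c := 16) ?_ (by norm_num) (by norm_num) (by norm_num)
    rw [lie_sub, lie_sub, lie_smul, lie_smul, lie_lie_lie z x y, lie_lie_lie z ⁅z, x⁆ ⁅z, y⁆,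
      (hg.mem_m₂ x).1 hx, (hg.mem_m₂ y).1 hy]
    simp only [neg_lie, lie_neg, neg_neg, smul_neg, lie_smul, smul_lie]
    module
  rw [hg.mem_h]
  apply hg.lie_eq_zero_of_sq
  rw [lie_lie_lie, (hg.mem_m₂ x).1 hx, (hg.mem_m₂ y).1 hy, sub_eq_zero.1 h0]
  simp only [neg_lie, lie_neg, lie_smul, smul_lie]
  module

/-- The subalgebra generated by `h` and an `h`-submodule `E` of `m₁` meets `m₁` in `E` only. In the
complexification this says that the subalgebra is `n + h + n̄` with `n` generated by the part of `E`
of type `(1, 0)`. -/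
lemma exists_lieSubalgebra (hg : IsTwoStepGrading B z h m₁ m₂) [FiniteDimensional ℝ L]
    (E : Submodule ℝ L) (hE : E ≤ m₁) (hinv : ∀ x ∈ h, ∀ y ∈ E, ⁅x, y⁆ ∈ E) :
    ∃ S : LieSubalgebra ℝ L, h ≤ S.toSubmodule ∧ E ≤ S.toSubmodule ∧
      ∀ u ∈ m₁, (∀ e ∈ E, B e u = 0) → ∀ s ∈ S, B s u = 0 := by
  let M : Submodule ℝ L := Submodule.span ℝ {v | ∃ x ∈ E, ∃ y ∈ E, v = ⁅x, y⁆ - ⁅⁅z, x⁆, ⁅z, y⁆⁆}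
  have hM : ∀ x ∈ E, ∀ y ∈ E, ⁅x, y⁆ - ⁅⁅z, x⁆, ⁅z, y⁆⁆ ∈ M := fun x hx y hy =>
    Submodule.subset_span ⟨x, hx, y, hy, rfl⟩
  have hMm : M ≤ m₂ := by
    refine Submodule.span_le.2 ?_
    rintro _ ⟨x, hx, y, hy, rfl⟩
    exact hg.lie_sub_mem_m₂ (hE hx) (hE hy)
  have hz : ∀ x ∈ E, ⁅z, x⁆ ∈ E := fun x hx => hinv z hg.z_mem x hx
  have hhM : ∀ a ∈ h, ∀ v ∈ M, ⁅a, v⁆ ∈ M := by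
    intro a ha v hv
    induction hv using Submodule.span_induction with
    | mem v hv =>
      obtain ⟨x, hx, y, hy, rfl⟩ := hv
      have e : ⁅a, ⁅x, y⁆ - ⁅⁅z, x⁆, ⁅z, y⁆⁆⁆ = (⁅⁅a, x⁆, y⁆ - ⁅⁅z, ⁅a, x⁆⁆, ⁅z, y⁆⁆) +
          (⁅x, ⁅a, y⁆⁆ - ⁅⁅z, x⁆, ⁅z, ⁅a, y⁆⁆⁆) := by
        rw [hg.lie_z_comm ha, hg.lie_z_comm ha, lie_sub, leibniz_lie a x y,
          leibniz_lie a ⁅z, x⁆ ⁅z, y⁆]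
        abel
      rw [e]
      exact M.add_mem (hM _ (hinv a ha x hx) _ hy) (hM _ hx _ (hinv a ha y hy))
    | zero => simp
    | add v w _ _ hv hw => rw [lie_add]; exact M.add_mem hv hw
    | smul c v _ hv => rw [lie_smul]; exact M.smul_mem c hv
  have hME : ∀ v ∈ M, ∀ w ∈ E, ⁅v, w⁆ ∈ E := by
    intro v hv w hw
    induction hv using Submodule.span_induction with
    | mem v hv =>
      obtain ⟨x, hx, y, hy, rfl⟩ := hv
      -- `m + i m'` is the bracket of the `(1, 0)` parts of `x` and `y`.
      set m := ⁅x, y⁆ - ⁅⁅z, x⁆, ⁅z, y⁆⁆ with hm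
      set m' := ⁅⁅z, x⁆, y⁆ + ⁅x, ⁅z, y⁆⁆ with hm'
      have hxx := (hg.mem_m₁ x).1 (hE hx)
      have hyy := (hg.mem_m₁ y).1 (hE hy)
      have hww := (hg.mem_m₁ w).1 (hE hw)
      have hzm : ⁅z, m⁆ = (2 : ℝ) • m' := by
        rw [hm, hm', lie_sub, leibniz_lie z x y, leibniz_lie z ⁅z, x⁆, hxx, hyy, neg_lie, lie_neg]
        module
      have hmm : m ∈ m₂ := hg.lie_sub_mem_m₂ (hE hx) (hE hy)
      -- There is nothing in degree `3`.
      have h3 : ⁅m, w⁆ = ⁅m', ⁅z, w⁆⁆ := by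
        have h4 : ⁅m, w⁆ ∈ m₁ := by
          rw [← lie_skew]
          exact m₁.neg_mem (hg.lie_m₁_m₂ (hE hw) hmm)
        have h5 := (hg.mem_m₁ _).1 h4
        rw [lie_lie_lie, (hg.mem_m₂ m).1 hmm, hww, hzm] at h5
        simp only [neg_lie, lie_neg, smul_lie] at h5
        have h6 : (4 : ℝ) • (⁅m, w⁆ - ⁅m', ⁅z, w⁆⁆) = 0 := by
          have : (4 : ℝ) • (⁅m, w⁆ - ⁅m', ⁅z, w⁆⁆) = -⁅m, w⁆ -
            (-((4 : ℝ) • ⁅m, w⁆) + (2 : ℝ) • (2 : ℝ) • ⁅m', ⁅z, w⁆⁆ + -⁅m, w⁆) := by module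
          rw [this, h5, sub_self]
        exact sub_eq_zero.1 ((smul_eq_zero.1 h6).resolve_left (by norm_num))
      have key : ⁅m, w⁆ + ⁅m', ⁅z, w⁆⁆ =
          ⁅x, ⁅y, w⁆ + ⁅⁅z, y⁆, ⁅z, w⁆⁆⁆ + ⁅⁅z, x⁆, ⁅y, ⁅z, w⁆⁆ - ⁅⁅z, y⁆, w⁆⁆
          - ⁅y, ⁅x, w⁆ + ⁅⁅z, x⁆, ⁅z, w⁆⁆⁆ - ⁅⁅z, y⁆, ⁅x, ⁅z, w⁆⁆ - ⁅⁅z, x⁆, w⁆⁆ := by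
        rw [hm, hm']
        simp only [sub_lie, add_lie, lie_lie, lie_add, lie_sub]
        abel
      have ha : ∀ y ∈ E, ⁅y, w⁆ + ⁅⁅z, y⁆, ⁅z, w⁆⁆ ∈ h := fun y hy =>
        hg.lie_add_mem_h (hE hy) (hE hw)
      have hb : ∀ y ∈ E, ⁅y, ⁅z, w⁆⁆ - ⁅⁅z, y⁆, w⁆ ∈ h := fun y hy => by
        have := hg.lie_add_mem_h (hE hy) (hE (hz w hw))
        rwa [hww, lie_neg, ← sub_eq_add_neg] at this
      have hr : ∀ x ∈ E, ∀ a ∈ h, ⁅x, a⁆ ∈ E := fun x hx a ha => by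
        rw [← lie_skew]
        exact E.neg_mem (hinv a ha x hx)
      have h7 : ⁅m, w⁆ + ⁅m', ⁅z, w⁆⁆ ∈ E := by
        rw [key]
        exact E.sub_mem (E.sub_mem (E.add_mem (hr _ hx _ (ha y hy)) (hr _ (hz x hx) _ (hb y hy)))
          (hr _ hy _ (ha x hx))) (hr _ (hz y hy) _ (hb x hx))
      have h8 : ⁅m, w⁆ = (2 : ℝ)⁻¹ • (⁅m, w⁆ + ⁅m', ⁅z, w⁆⁆) := by rw [← h3]; module
      rw [h8]
      exact E.smul_mem _ h7
    | zero => simp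
    | add v w _ _ hv hw => rw [add_lie]; exact E.add_mem hv hw
    | smul c v _ hv => rw [smul_lie]; exact E.smul_mem c hv
  have hmem : ∀ a ∈ h, ∀ b ∈ E, ∀ c ∈ M, a + b + c ∈ h ⊔ E ⊔ M := fun a ha b hb c hc =>
    Submodule.add_mem_sup (Submodule.add_mem_sup ha hb) hc
  have hhS : h ≤ h ⊔ E ⊔ M := le_sup_left.trans le_sup_left
  have hES : E ≤ h ⊔ E ⊔ M := le_sup_right.trans le_sup_left
  have hMS : M ≤ h ⊔ E ⊔ M := le_sup_right
  have hEE : ∀ x ∈ E, ∀ y ∈ E, ⁅x, y⁆ ∈ h ⊔ E ⊔ M := by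
    intro x hx y hy
    have e : ⁅x, y⁆ = (2 : ℝ)⁻¹ • (⁅x, y⁆ + ⁅⁅z, x⁆, ⁅z, y⁆⁆) +
        (2 : ℝ)⁻¹ • (⁅x, y⁆ - ⁅⁅z, x⁆, ⁅z, y⁆⁆) := by module
    rw [e]
    exact Submodule.add_mem _ (Submodule.smul_mem _ _ (hhS (hg.lie_add_mem_h (hE hx) (hE hy))))
      (Submodule.smul_mem _ _ (hMS (hM x hx y hy)))
  refine ⟨{ h ⊔ E ⊔ M with lie_mem' := ?_ }, hhS, hES, ?_⟩
  · intro x y hx hy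
    obtain ⟨p, hp, c, hc, rfl⟩ := Submodule.mem_sup.1 hx
    obtain ⟨a, ha, b, hb, rfl⟩ := Submodule.mem_sup.1 hp
    obtain ⟨q, hq, c', hc', rfl⟩ := Submodule.mem_sup.1 hy
    obtain ⟨a', ha', b', hb', rfl⟩ := Submodule.mem_sup.1 hq
    change _ ∈ h ⊔ E ⊔ M
    have swap : ∀ {u v : L}, ⁅u, v⁆ ∈ h ⊔ E ⊔ M → ⁅v, u⁆ ∈ h ⊔ E ⊔ M := fun {u v} huv => by
      rw [← lie_skew]
      exact Submodule.neg_mem _ huv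
    simp only [add_lie, lie_add]
    repeat' apply Submodule.add_mem
    all_goals first
      | exact hhS (hg.lie_h_h ha ha')
      | exact swap (hES (hinv a' ha' b hb))
      | exact swap (hMS (hhM a' ha' c hc))
      | exact hES (hinv a ha b' hb')
      | exact hEE b hb b' hb'
      | exact hES (hME c hc b' hb')
      | exact hMS (hhM a ha c' hc')
      | exact swap (hES (hME c' hc' b hb))
      | exact hhS (hg.lie_m₂_m₂ (hMm hc) (hMm hc'))
  · intro u hu huE s hs
    obtain ⟨p, hp, c, hc, rfl⟩ := Submodule.mem_sup.1 (show s ∈ h ⊔ E ⊔ M from hs)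
    obtain ⟨a, ha, b, hb, rfl⟩ := Submodule.mem_sup.1 hp
    rw [map_add, map_add, LinearMap.add_apply, LinearMap.add_apply, hg.orthogonal_h_m₁ ha hu,
      huE b hb, hg.symm c u, hg.orthogonal_m₁_m₂ hu (hMm hc)]
    simp

end IsTwoStepGrading

end Grading

/-! ### Simple Lie algebras -/

section Simple

variable {L : Type*} [LieRing L] [LieAlgebra ℝ L]

lemma eq_top_of_lie_mem (hs : LieAlgebra.IsSimple ℝ L) (I : Submodule ℝ L)
    (hI : ∀ x : L, ∀ y ∈ I, ⁅x, y⁆ ∈ I) (h0 : I ≠ ⊥) : I = ⊤ := by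
  let J : LieIdeal ℝ L := { I with lie_mem := fun {x y} hy => hI x y hy }
  rcases hs.eq_bot_or_eq_top J with h | h
  · exact absurd (congrArg LieSubmodule.toSubmodule h) h0
  · exact congrArg LieSubmodule.toSubmodule h

lemma exists_lie_ne_zero (hs : LieAlgebra.IsSimple ℝ L) : ∃ x y : L, ⁅x, y⁆ ≠ 0 := by
  by_contra! h
  exact hs.non_abelian ⟨h⟩

lemma eq_zero_of_central (hs : LieAlgebra.IsSimple ℝ L) {x : L} (hx : ∀ y : L, ⁅y, x⁆ = 0) :
    x = 0 := by
  by_contra hx0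
  have htop : Submodule.span ℝ {x} = ⊤ := by
    refine eq_top_of_lie_mem hs _ (fun w y hy => ?_) (by simpa using hx0)
    obtain ⟨c, rfl⟩ := Submodule.mem_span_singleton.1 hy
    simp [hx]
  obtain ⟨y, w, hyw⟩ := exists_lie_ne_zero hs
  obtain ⟨c, rfl⟩ := Submodule.mem_span_singleton.1 (htop ▸ Submodule.mem_top : w ∈ _)
  simp [hx] at hyw

lemma span_lie_eq_top (hs : LieAlgebra.IsSimple ℝ L) :
    Submodule.span ℝ {v : L | ∃ x y : L, v = ⁅x, y⁆} = ⊤ := by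
  refine eq_top_of_lie_mem hs _ (fun w y _ => Submodule.subset_span ⟨w, y, rfl⟩) ?_
  obtain ⟨x, y, hxy⟩ := exists_lie_ne_zero hs
  exact (Submodule.ne_bot_iff _).2 ⟨_, Submodule.subset_span ⟨x, y, rfl⟩, hxy⟩

end Simple

/-! ### Root space decomposition -/

section Roots

variable {L : Type*} [LieRing L] [LieAlgebra ℝ L] {t : LieSubalgebra ℝ L}

lemma IsMaximalAbelian.lie_eq_zero (ht : IsMaximalAbelian t) {H K : L} (hH : H ∈ t) (hK : K ∈ t) :
    ⁅H, K⁆ = 0 := by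
  have : IsLieAbelian t := ht.1
  exact congrArg Subtype.val (trivial_lie_zero t t ⟨H, hH⟩ ⟨K, hK⟩)

/-- A maximal abelian subalgebra is its own centralizer. -/
lemma IsMaximalAbelian.mem_of_commute (ht : IsMaximalAbelian t) {x : L}
    (hx : ∀ H ∈ t, ⁅H, x⁆ = 0) : x ∈ t := by
  have key : ∀ a ∈ t.toSubmodule ⊔ Submodule.span ℝ {x},
      ∀ b ∈ t.toSubmodule ⊔ Submodule.span ℝ {x}, ⁅a, b⁆ = 0 := by
    intro a ha b hb
    obtain ⟨H, hH, y, hy, rfl⟩ := Submodule.mem_sup.1 ha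
    obtain ⟨c, rfl⟩ := Submodule.mem_span_singleton.1 hy
    obtain ⟨K, hK, w, hw, rfl⟩ := Submodule.mem_sup.1 hb
    obtain ⟨d, rfl⟩ := Submodule.mem_span_singleton.1 hw
    have h1 : ⁅x, K⁆ = 0 := by rw [← lie_skew, hx K hK, neg_zero]
    simp [ht.lie_eq_zero hH hK, hx H hH, h1]
  let s : LieSubalgebra ℝ L :=
    { t.toSubmodule ⊔ Submodule.span ℝ {x} with
      lie_mem' := fun {a b} ha hb => by
        rw [key a ha b hb]
        exact Submodule.zero_mem _ }
  have hs : IsLieAbelian s := ⟨fun a b => Subtype.ext (key a a.2 b b.2)⟩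
  have hts : t ≤ s := fun H hH => Submodule.mem_sup_left (S := t.toSubmodule) hH
  have hle : s ≤ t := ht.2 hs hts
  exact hle (Submodule.mem_sup_right (S := t.toSubmodule) (Submodule.mem_span_singleton_self x))

lemma IsRootPair.mem_of_zero (ht : IsMaximalAbelian t) {X Y : L} (h : IsRootPair t 0 X Y) :
    X ∈ t :=
  ht.mem_of_commute fun H hH => by simpa using (h ⟨H, hH⟩).1

lemma realRootPlane_neg (β : Module.Dual ℝ t) : realRootPlane t (-β) = realRootPlane t β := by
  unfold realRootPlane
  rw [neg_neg, sup_comm]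

lemma neg_mem_roots {β : Module.Dual ℝ t} (hβ : β ∈ roots t) : -β ∈ roots t := by
  obtain ⟨h0, X, Y, hX, h⟩ := (mem_roots_iff t β).1 hβ
  exact (mem_roots_iff t _).2 ⟨neg_ne_zero.2 h0, X, -Y, hX, h.neg⟩

lemma sup_iSup_realRootPlane [FiniteDimensional ℝ L] {B : LinearMap.BilinForm ℝ L}
    (hB : IsInvariantInner B) (ht : IsMaximalAbelian t) :
    t.toSubmodule ⊔ ⨆ β ∈ roots t, realRootPlane t β = ⊤ := by
  set W := t.toSubmodule ⊔ ⨆ β ∈ roots t, realRootPlane t β with hW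
  have hinv : ∀ H ∈ t, ∀ x ∈ W, ⁅H, x⁆ ∈ W := by
    intro H hH x hx
    have hle : W ≤ W.comap (LieAlgebra.ad ℝ L H : L →ₗ[ℝ] L) := by
      refine sup_le (fun K hK => ?_) (iSup₂_le fun β hβ X hX => ?_)
      · have : ⁅H, K⁆ = 0 := ht.lie_eq_zero hH hK
        simp [this]
      · obtain ⟨Y, hXY⟩ := (mem_realRootPlane_iff t β X).1 hX
        rw [Submodule.mem_comap, LieAlgebra.ad_apply, (hXY ⟨H, hH⟩).1]
        refine W.smul_mem _ (Submodule.mem_sup_right (Submodule.mem_iSup_of_mem β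
          (Submodule.mem_iSup_of_mem hβ ?_)))
        exact (mem_realRootPlane_iff t β Y).2 ⟨_, hXY.swap⟩
    exact hle hx
  refine hB.eq_top_of_orthogonal W ?_
  by_contra! hne
  obtain ⟨x, hx, hx0⟩ := hne
  obtain ⟨β, X, Y, hX, -, hX0, h⟩ := exists_isRootPair hB t (fun H hH K hK => ht.lie_eq_zero hH hK)
    (B.orthogonal W) (fun H hH y hy => by
      rw [LinearMap.BilinForm.mem_orthogonal_iff] at hy ⊢
      intro w hw
      have := hy _ (hinv H hH w hw)
      rw [hB.inv] at this
      linarith) ((Submodule.ne_bot_iff _).2 ⟨x, fun w hw => hx w hw, hx0⟩)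
  have hXW : X ∈ W := by
    rcases eq_or_ne β 0 with rfl | hβ
    · exact Submodule.mem_sup_left (h.mem_of_zero ht)
    · have hr : β ∈ roots t := (mem_roots_iff t β).2 ⟨hβ, X, Y, hX0, h⟩
      exact Submodule.mem_sup_right (Submodule.mem_iSup_of_mem β
          (Submodule.mem_iSup_of_mem hr ((mem_realRootPlane_iff t β X).2 ⟨Y, h⟩)))
  exact hX0 (hB.eq_zero (hX X hXW))

/-- There is a basis of `t` dual to linearly independent functionals. -/
lemma exists_dual_vector {ι : Type*} {α : ι → Module.Dual ℝ t} [FiniteDimensional ℝ L]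
    [DecidableEq ι] (hα : LinearIndependent ℝ α)
    (i : ι) :
    ∃ z : t, ∀ j, α j z = if j = i then 1 else 0 := by
  obtain ⟨φ, hφ⟩ := LinearMap.exists_extend
    ((Finsupp.lapply i : (ι →₀ ℝ) →ₗ[ℝ] ℝ) ∘ₗ hα.repr)
  refine ⟨(Module.evalEquiv ℝ t).symm φ, fun j => ?_⟩
  have h1 : α j ((Module.evalEquiv ℝ t).symm φ) = φ (α j) :=
    Module.apply_evalEquiv_symm_apply ℝ t (α j) φ
  have h2 := congrArg (fun f => f (⟨α j, Submodule.subset_span ⟨j, rfl⟩⟩ :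
    Submodule.span ℝ (Set.range α))) hφ
  simp only [LinearMap.comp_apply, Submodule.subtype_apply] at h2
  rw [h1, h2]
  have h3 := hα.repr_eq_single j ⟨α j, Submodule.subset_span ⟨j, rfl⟩⟩ rfl
  simp only [h3, Finsupp.lapply_apply, Finsupp.single_apply]

variable {ι : Type*} [Fintype ι] {α : ι → Module.Dual ℝ t}

lemma IsFundamentalSystem.coeff_unique (hα : IsFundamentalSystem t α) {m m' : ι → ℝ}
    (h : ∑ j, m j • α j = ∑ j, m' j • α j) : m = m' := by
  have := Fintype.linearIndependent_iff.1 hα.linearIndependent (fun j => m j - m' j)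
    (by simp only [sub_smul, Finset.sum_sub_distrib, h, sub_self])
  exact funext fun j => sub_eq_zero.1 (this j)

lemma IsFundamentalSystem.eq_zero_of_apply (hα : IsFundamentalSystem t α) [FiniteDimensional ℝ L]
    (hs : LieAlgebra.IsSimple ℝ L) {B : LinearMap.BilinForm ℝ L} (hB : IsInvariantInner B)
    (ht : IsMaximalAbelian t) (H : t) (hH : ∀ j, α j H = 0) : H = 0 := by
  have hroot : ∀ β ∈ roots t, β H = 0 := by
    intro β hβ
    obtain ⟨m, rfl | rfl⟩ := hα.exists_coeff β hβ <;> simp [hH]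
  have hle : t.toSubmodule ⊔ ⨆ β ∈ roots t, realRootPlane t β ≤
      LinearMap.ker (LieAlgebra.ad ℝ L (H : L) : L →ₗ[ℝ] L) := by
    refine sup_le (fun K hK => ?_) (iSup₂_le fun β hβ X hX => ?_)
    · exact ht.lie_eq_zero H.2 hK
    · obtain ⟨Y, hXY⟩ := (mem_realRootPlane_iff t β X).1 hX
      rw [LinearMap.mem_ker, LieAlgebra.ad_apply, (hXY H).1, hroot β hβ, zero_smul]
  rw [sup_iSup_realRootPlane hB ht] at hle
  refine Subtype.ext (eq_zero_of_central hs fun y => ?_)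
  rw [← lie_skew, neg_eq_zero]
  exact hle Submodule.mem_top

/-- For `X - i Y` in the root space of `α`, `V - i W` in that of `β` killed by `X + i Y`, the
inner product of `α` and `β` is not positive. -/
lemma IsRootPair.apply_lie_nonpos {B : LinearMap.BilinForm ℝ L} (hB : IsInvariantInner B)
    {β : Module.Dual ℝ t} {X Y V W : L} (h' : IsRootPair t β V W)
    (h1 : ⁅X, V⁆ + ⁅Y, W⁆ = 0) (h2 : ⁅X, W⁆ - ⁅Y, V⁆ = 0) (hW : W ≠ 0) (K : t)
    (hK : (K : L) = ⁅X, Y⁆) : β K ≤ 0 := by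
  have e : B ⁅⁅X, Y⁆, V⁆ W = β K * B W W := by
    rw [← hK, (h' K).1]
    simp
  have e1 : B ⁅X, ⁅Y, V⁆⁆ W = -B ⁅Y, V⁆ ⁅Y, V⁆ := by rw [hB.inv, sub_eq_zero.1 h2]
  have e2 : B ⁅Y, ⁅X, V⁆⁆ W = B ⁅X, V⁆ ⁅X, V⁆ := by
    rw [hB.inv, eq_neg_of_add_eq_zero_right h1, map_neg, neg_neg]
  rw [lie_lie, map_sub, LinearMap.sub_apply, e1, e2] at e
  have p1 := hB.nonneg ⁅Y, V⁆
  have p2 := hB.nonneg ⁅X, V⁆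
  have p3 := hB.pos W hW
  by_contra! hc
  nlinarith

/-- Together with `t`, the real root vectors of the simple roots generate `L`; one root vector for
each simple root suffices.
Otherwise the orthogonal complement of the subalgebra contains a root vector whose root `β` has
minimal height. It is a lowest weight vector, so that `(β, α j) ≤ 0` for all `j`, whence
`(β, β) ≤ 0`. -/
lemma IsFundamentalSystem.eq_top_of_mem (hα : IsFundamentalSystem t α) [FiniteDimensional ℝ L]
    {B : LinearMap.BilinForm ℝ L} (hB : IsInvariantInner B) (ht : IsMaximalAbelian t)
    (S : LieSubalgebra ℝ L) (htS : t ≤ S)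
    (hS : ∀ j, ∃ X Y, X ∈ S ∧ Y ∈ S ∧ X ≠ 0 ∧ IsRootPair t (α j) X Y) : S = ⊤ := by
  classical
  suffices hN : B.orthogonal S.toSubmodule = ⊥ by
    rw [← LieSubalgebra.toSubmodule_inj, LieSubalgebra.top_toSubmodule]
    refine hB.eq_top_of_orthogonal S.toSubmodule fun x hx => ?_
    have : x ∈ B.orthogonal S.toSubmodule := fun w hw => hx w hw
    rwa [hN, Submodule.mem_bot] at this
  set N := B.orthogonal S.toSubmodule with hNdef
  have hSN : ∀ s ∈ S, ∀ x ∈ N, ⁅s, x⁆ ∈ N := by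
    intro s hs x hx w hw
    have := hx _ (S.lie_mem hs hw)
    rw [hB.inv] at this
    linarith
  have htN : ∀ x ∈ N, x ∈ t → x = 0 := fun x hx hxt => hB.eq_zero (hx x (htS hxt))
  choose X Y hX hY hX0 hXY using hS
  -- The heights of the positive roots that occur in `N`.
  let P : ℕ → Prop := fun k => ∃ m : ι → ℕ, ∑ j, m j = k ∧
    ∃ V W, V ∈ N ∧ W ∈ N ∧ V ≠ 0 ∧ IsRootPair t (∑ j, (m j : ℝ) • α j) V W
  have pos_root : ∀ β V W, V ∈ N → W ∈ N → V ≠ 0 → IsRootPair t β V W →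
      ∃ m : ι → ℕ, β = ∑ j, (m j : ℝ) • α j ∨ β = -∑ j, (m j : ℝ) • α j := by
    intro β V W hV hW hV0 h
    refine hα.exists_coeff β ((mem_roots_iff t β).2 ⟨?_, V, W, hV0, h⟩)
    rintro rfl
    exact hV0 (htN V hV (h.mem_of_zero ht))
  by_contra hne
  have hP : ∃ k, P k := by
    obtain ⟨β, V, W, hV, hW, hV0, h⟩ := exists_isRootPair hB t
      (fun H hH K hK => ht.lie_eq_zero hH hK) N (fun H hH => hSN H (htS hH)) hne
    obtain ⟨m, rfl | rfl⟩ := pos_root β V W hV hW hV0 h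
    · exact ⟨_, m, rfl, V, W, hV, hW, hV0, h⟩
    · exact ⟨_, m, rfl, V, -W, hV, N.neg_mem hW, hV0, by simpa using h.neg⟩
  obtain ⟨m, hm, V, W, hV, hW, hV0, h⟩ := Nat.find_spec hP
  set β := ∑ j, (m j : ℝ) • α j with hβ
  have hβ0 : β ≠ 0 := by
    intro h0
    rw [h0] at h
    exact hV0 (htN V hV (h.mem_of_zero ht))
  have hW0 : W ≠ 0 := h.right_ne_zero hβ0 hV0
  have kill : ∀ j V' W', V' ∈ N → W' ∈ N → IsRootPair t (β - α j) V' W' → V' = 0 := by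
    intro j V' W' hV' hW' h'
    by_contra hV'0
    obtain ⟨m', hm'⟩ := pos_root _ V' W' hV' hW' hV'0 h'
    let δ : ι → ℝ := fun k => if k = j then 1 else 0
    have hδ : ∑ k, δ k • α k = α j := by
      simp only [δ, ite_smul, one_smul, zero_smul, Finset.sum_ite_eq', Finset.mem_univ, if_true]
    have hsum : β - α j = ∑ k, ((m k : ℝ) - δ k) • α k := by
      rw [hβ, Finset.sum_congr rfl fun k _ => sub_smul (m k : ℝ) (δ k) (α k),
        Finset.sum_sub_distrib, hδ]
    rcases hm' with hm' | hm'
    · have hc := hα.coeff_unique (hsum.symm.trans hm')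
      have hcn : ∀ k, m k = m' k + if k = j then 1 else 0 := fun k => by
        have := congrFun hc k
        simp only [δ] at this
        split_ifs at this ⊢ with hk
        · have h1 : (m k : ℝ) = ((m' k + 1 : ℕ) : ℝ) := by push_cast; linarith
          exact_mod_cast h1
        · have h1 : (m k : ℝ) = m' k := by linarith
          exact_mod_cast h1
      have hlt : ∑ k, m' k < Nat.find hP := by
        rw [← hm, Finset.sum_congr rfl fun k _ => hcn k, Finset.sum_add_distrib]
        simp
      exact Nat.find_min hP hlt ⟨m', rfl, V', W', hV', hW', hV'0, hm' ▸ h'⟩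
    · have hm'' : β - α j = ∑ k, (-(m' k : ℝ)) • α k := by
        rw [hm']
        rw [Finset.sum_congr rfl fun k _ => neg_smul (m' k : ℝ) (α k), Finset.sum_neg_distrib]
      have hc := hα.coeff_unique (hsum.symm.trans hm'')
      have hk0 : ∀ k, k ≠ j → m k = 0 := fun k hk => by
        have := congrFun hc k
        simp only [δ, if_neg hk, sub_zero] at this
        have p1 : (0 : ℝ) ≤ m k := Nat.cast_nonneg _
        have p2 : (0 : ℝ) ≤ m' k := Nat.cast_nonneg _
        have : (m k : ℝ) = 0 := by linarith
        exact_mod_cast this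
      have hj := congrFun hc j
      simp only [δ, if_true] at hj
      have hβj : β = (m j : ℝ) • α j := by
        rw [hβ]
        exact Finset.sum_eq_single_of_mem j (Finset.mem_univ j) fun k _ hk => by
          simp [hk0 k hk]
      have p2 : (0 : ℝ) ≤ m' j := Nat.cast_nonneg _
      have hmj : m j ≤ 1 := by
        have : (m j : ℝ) ≤ 1 := by linarith
        exact_mod_cast this
      interval_cases hmj' : m j
      · exact hβ0 (by simpa using hβj)
      · have : β - α j = 0 := by simp [hβj]
        rw [this] at h'
        exact hV'0 (htN V' hV' (h'.mem_of_zero ht))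
  have hle : ∀ j, ∀ K : t, (K : L) = ⁅X j, Y j⁆ → β K ≤ 0 := by
    intro j K hK
    have hmem1 : ⁅X j, V⁆ + ⁅Y j, W⁆ ∈ N := N.add_mem (hSN _ (hX j) _ hV) (hSN _ (hY j) _ hW)
    have hmem2 : ⁅X j, W⁆ - ⁅Y j, V⁆ ∈ N := N.sub_mem (hSN _ (hX j) _ hW) (hSN _ (hY j) _ hV)
    have hb := (hXY j).lie_conj h
    exact IsRootPair.apply_lie_nonpos hB h (kill j _ _ hmem1 hmem2 hb)
      (kill j _ _ hmem2 (N.neg_mem hmem1) hb.swap) hW0 K hK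
  have hKt : ∀ j, ⁅X j, Y j⁆ ∈ t := fun j =>
    ht.mem_of_commute fun H hH => (hXY j).lie_self_commute ⟨H, hH⟩
  -- The vector of `t` dual to `β`.
  let T : t := ∑ j, ((m j : ℝ) / B (X j) (X j)) • (⟨⁅X j, Y j⁆, hKt j⟩ : t)
  have hT : ∀ H : t, B (T : L) (H : L) = β H := by
    intro H
    have : (T : L) = ∑ j, ((m j : ℝ) / B (X j) (X j)) • ⁅X j, Y j⁆ := by
      simp [T]
    rw [this, hβ]
    simp only [map_sum, map_smul, LinearMap.sum_apply, LinearMap.smul_apply, smul_eq_mul]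
    refine Finset.sum_congr rfl fun j _ => ?_
    rw [(hXY j).form_lie hB H]
    have := (hB.pos _ (hX0 j)).ne'
    field_simp
  have hTle : β T ≤ 0 := by
    simp only [T, map_sum, map_smul, smul_eq_mul]
    refine Finset.sum_nonpos fun j _ => mul_nonpos_of_nonneg_of_nonpos
      (div_nonneg (Nat.cast_nonneg _) (hB.nonneg _)) (hle j _ rfl)
  have hT0 : (T : L) = 0 := by
    refine hB.eq_zero (le_antisymm ?_ (hB.nonneg _))
    rw [hT]
    exact hTle
  refine hβ0 (LinearMap.ext fun H => ?_)
  rw [← hT, hT0]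
  simp

end Roots

/-! ### The decomposition of Type IIb -/

section TypeIIb

variable {L : Type*} [LieRing L] [LieAlgebra ℝ L] {t : LieSubalgebra ℝ L}
  {ι : Type*} [Fintype ι] {α : ι → Module.Dual ℝ t} {i₀ : ι}
  {B : LinearMap.BilinForm ℝ L}

lemma mem_levelSpace_of_isRootPair {β : Module.Dual ℝ t} {k : ℕ} (hβ : β ∈ rootsOfLevel t α i₀ k)
    {X Y : L} (h : IsRootPair t β X Y) : X ∈ levelSpace t α i₀ k :=
  Submodule.mem_iSup_of_mem β
    (Submodule.mem_iSup_of_mem hβ ((mem_realRootPlane_iff t β X).2 ⟨Y, h⟩))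

lemma apply_of_level [DecidableEq ι] {z : t} (hz : ∀ j, α j z = if j = i₀ then 1 else 0)
    (m : ι → ℕ) : (∑ j, (m j : ℝ) • α j) z = m i₀ := by
  simp [LinearMap.sum_apply, hz]

lemma lie_lie_of_mem_levelSpace [DecidableEq ι] {z : t}
    (hz : ∀ j, α j z = if j = i₀ then 1 else 0) {k : ℕ} {x : L}
    (hx : x ∈ levelSpace t α i₀ k) : ⁅(z : L), ⁅(z : L), x⁆⁆ = -((k ^ 2 : ℝ) • x) := by
  let A : L →ₗ[ℝ] L := LieAlgebra.ad ℝ L (z : L) ∘ₗ LieAlgebra.ad ℝ L (z : L) +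
    (k ^ 2 : ℝ) • LinearMap.id
  have hle : levelSpace t α i₀ k ≤ LinearMap.ker A := by
    refine iSup₂_le fun β hβ X hX => ?_
    obtain ⟨-, m, rfl, hm⟩ := hβ
    obtain ⟨Y, h⟩ := (mem_realRootPlane_iff t _ X).1 hX
    have h1 := h z
    rw [apply_of_level hz, hm] at h1
    simp only [A, LinearMap.mem_ker, LinearMap.add_apply, LinearMap.comp_apply, LieAlgebra.ad_apply,
      LinearMap.smul_apply, LinearMap.id_apply, h1.1, lie_smul, h1.2]
    module
  have := hle hx
  simp only [A, LinearMap.mem_ker, LinearMap.add_apply, LinearMap.comp_apply, LieAlgebra.ad_apply,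
      LinearMap.smul_apply, LinearMap.id_apply] at this
  exact eq_neg_of_add_eq_zero_left this

lemma lie_of_mem_isotropy [DecidableEq ι] (ht : IsMaximalAbelian t) {z : t}
    (hz : ∀ j, α j z = if j = i₀ then 1 else 0) {x : L} (hx : x ∈ isotropy t α i₀) :
    ⁅(z : L), x⁆ = 0 := by
  have hle : isotropy t α i₀ ≤ LinearMap.ker (LieAlgebra.ad ℝ L (z : L) : L →ₗ[ℝ] L) := by
    refine sup_le (fun K hK => ht.lie_eq_zero z.2 hK) (iSup₂_le fun β hβ X hX => ?_)
    obtain ⟨-, m, rfl, hm⟩ := hβ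
    obtain ⟨Y, h⟩ := (mem_realRootPlane_iff t _ X).1 hX
    have h1 := (h z).1
    rw [apply_of_level hz, hm] at h1
    simpa using h1
  exact hle hx

lemma IsTypeIIb.span_eq_top [FiniteDimensional ℝ L] (hIIb : IsTypeIIb t α i₀)
    (hB : IsInvariantInner B) (ht : IsMaximalAbelian t) (hα : IsFundamentalSystem t α) :
    isotropy t α i₀ ⊔ levelSpace t α i₀ 1 ⊔ levelSpace t α i₀ 2 = ⊤ := by
  have hpos : ∀ β ∈ roots t, ∀ m : ι → ℕ, β = ∑ j, (m j : ℝ) • α j →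
      realRootPlane t β ≤ isotropy t α i₀ ⊔ levelSpace t α i₀ 1 ⊔ levelSpace t α i₀ 2 := by
    intro β hβ m hm
    have hmem : β ∈ rootsOfLevel t α i₀ (m i₀) := ⟨hβ, m, hm, rfl⟩
    have hle : m i₀ ≤ 2 := hIIb.two_summands.2 ⟨β, hmem⟩
    have hp : realRootPlane t β ≤ levelSpace t α i₀ (m i₀) :=
      le_iSup₂ (f := fun β (_ : β ∈ rootsOfLevel t α i₀ (m i₀)) => realRootPlane t β) β hmem
    refine hp.trans ?_
    interval_cases m i₀
    · exact le_sup_right.trans (le_sup_left.trans le_sup_left)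
    · exact le_sup_right.trans le_sup_left
    · exact le_sup_right
  rw [eq_top_iff, ← sup_iSup_realRootPlane hB ht]
  refine sup_le (le_sup_left.trans (le_sup_left.trans le_sup_left)) (iSup₂_le fun β hβ => ?_)
  obtain ⟨m, hm | hm⟩ := hα.exists_coeff β hβ
  · exact hpos β hβ m hm
  · rw [← realRootPlane_neg]
    exact hpos _ (neg_mem_roots hβ) m (by rw [hm, neg_neg])

/-- The element `z` of `t` on which `α i₀` is `1` and the other simple roots vanish defines the
grading of `L`. -/
lemma IsTypeIIb.isTwoStepGrading [FiniteDimensional ℝ L] [DecidableEq ι]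
    (hIIb : IsTypeIIb t α i₀) (hB : IsInvariantInner B) (ht : IsMaximalAbelian t)
    (hα : IsFundamentalSystem t α) {z : t} (hz : ∀ j, α j z = if j = i₀ then 1 else 0) :
    IsTwoStepGrading B (z : L) (isotropy t α i₀) (levelSpace t α i₀ 1) (levelSpace t α i₀ 2) := by
  have h0 : ∀ x ∈ isotropy t α i₀, ⁅(z : L), x⁆ = 0 := fun x hx => lie_of_mem_isotropy ht hz hx
  have h1 : ∀ x ∈ levelSpace t α i₀ 1, ⁅(z : L), ⁅(z : L), x⁆⁆ = -x := fun x hx => by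
    simpa using lie_lie_of_mem_levelSpace hz hx
  have h2 : ∀ x ∈ levelSpace t α i₀ 2, ⁅(z : L), ⁅(z : L), x⁆⁆ = -((4 : ℝ) • x) := fun x hx => by
    rw [lie_lie_of_mem_levelSpace hz hx]
    norm_num
  have hspan := hIIb.span_eq_top hB ht hα
  have dec : ∀ x : L, ∃ a ∈ isotropy t α i₀, ∃ b ∈ levelSpace t α i₀ 1,
      ∃ c ∈ levelSpace t α i₀ 2, x = a + b + c ∧ ⁅(z : L), ⁅(z : L), x⁆⁆ = -b - (4 : ℝ) • c := by
    intro x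
    obtain ⟨y, hy, c, hc, rfl⟩ := Submodule.mem_sup.1 (hspan ▸ Submodule.mem_top : x ∈ _)
    obtain ⟨a, ha, b, hb, rfl⟩ := Submodule.mem_sup.1 hy
    refine ⟨a, ha, b, hb, c, hc, rfl, ?_⟩
    simp only [lie_add]
    rw [h1 b hb, h2 c hc, h0 a ha]
    simp only [lie_zero]
    module
  refine { hB with
    mem_h := fun x => ⟨h0 x, fun hx => ?_⟩
    mem_m₁ := fun x => ⟨h1 x, fun hx => ?_⟩
    mem_m₂ := fun x => ⟨h2 x, fun hx => ?_⟩
    span := hspan }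
  all_goals
    obtain ⟨a, ha, b, hb, c, hc, rfl, e⟩ := dec x
  · rw [hx, lie_zero] at e
    have e' := congrArg (fun v => ⁅(z : L), ⁅(z : L), v⁆⁆) e
    simp only [lie_zero, lie_sub, lie_neg, lie_smul, h1 b hb, h2 c hc] at e'
    have hc0 : c = (12 : ℝ)⁻¹ • ((-b - (4 : ℝ) • c) +
      (- -b - (4 : ℝ) • -((4 : ℝ) • c))) := by module
    rw [← e, ← e', add_zero, smul_zero] at hc0
    rw [hc0, smul_zero, sub_zero, eq_comm, neg_eq_zero] at e
    rwa [hc0, e, add_zero, add_zero]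
  · rw [hx] at e
    have ha3 : a = (3 : ℝ) • c := by
      have : a = (3 : ℝ) • c + ((-b - (4 : ℝ) • c) - -(a + b + c)) := by module
      rwa [← e, sub_self, add_zero] at this
    have e' := congrArg (fun v => ⁅(z : L), ⁅(z : L), v⁆⁆) ha3
    simp only [lie_smul, h0 a ha, h2 c hc, lie_zero] at e'
    have hc0 : c = 0 := by
      have : c = (-(12 : ℝ)⁻¹) • ((3 : ℝ) • -((4 : ℝ) • c)) := by module
      rwa [← e', smul_zero] at this
    rwa [ha3, hc0, smul_zero, zero_add, add_zero]
  · rw [hx] at e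
    have ha3 : b = (-(4 / 3) : ℝ) • a := by
      have : b = (-(4 / 3) : ℝ) • a +
        (1 / 3 : ℝ) • ((-b - (4 : ℝ) • c) - -((4 : ℝ) • (a + b + c))) := by module
      rwa [← e, sub_self, smul_zero, add_zero] at this
    have e' := congrArg (fun v => ⁅(z : L), ⁅(z : L), v⁆⁆) ha3
    simp only [lie_smul, h0 a ha, h1 b hb, lie_zero, smul_zero, neg_eq_zero] at e'
    have ha0 : a = 0 := by
      have : a = (-(3 / 4) : ℝ) • ((-(4 / 3) : ℝ) • a) := by module
      rwa [← ha3, e', smul_zero] at this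
    rwa [e', ha0, zero_add, zero_add]

lemma mem_rootsOfLevel_simple (hα : IsFundamentalSystem t α) [DecidableEq ι] (j : ι) :
    α j ∈ rootsOfLevel t α i₀ (if i₀ = j then 1 else 0) :=
  ⟨hα.mem_roots j, fun k => if k = j then 1 else 0, by
    rw [Finset.sum_eq_single_of_mem j (Finset.mem_univ j) fun k _ hk => by simp [hk]]
    simp, rfl⟩

/-- Every simple root other than `α i₀` has a real root vector in `isotropy`. -/
lemma exists_isRootPair_isotropy (hα : IsFundamentalSystem t α) {j : ι} (hj : j ≠ i₀) :
    ∃ X Y, X ∈ isotropy t α i₀ ∧ Y ∈ isotropy t α i₀ ∧ X ≠ 0 ∧ IsRootPair t (α j) X Y := by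
  classical
  obtain ⟨-, X, Y, hX0, h⟩ := (mem_roots_iff t (α j)).1 (hα.mem_roots j)
  have hl := mem_rootsOfLevel_simple (i₀ := i₀) hα j
  rw [if_neg hj.symm] at hl
  exact ⟨X, Y, Submodule.mem_sup_right (mem_levelSpace_of_isRootPair hl h),
    Submodule.mem_sup_right (mem_levelSpace_of_isRootPair hl h.swap), hX0, h⟩

/-- The center of `h` is one-dimensional. -/
lemma centerOf_isotropy [FiniteDimensional ℝ L] [DecidableEq ι] (hs : LieAlgebra.IsSimple ℝ L)
    (hB : IsInvariantInner B) (ht : IsMaximalAbelian t)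
    (hα : IsFundamentalSystem t α) {z : t} (hz : ∀ j, α j z = if j = i₀ then 1 else 0) :
    centerOf (isotropy t α i₀) = Submodule.span ℝ {(z : L)} := by
  apply le_antisymm
  · rintro x ⟨-, hx⟩
    have hxt : x ∈ t := ht.mem_of_commute fun H hH => by
      rw [← lie_skew, hx H (Submodule.mem_sup_left hH), neg_zero]
    have h0 : ∀ j, j ≠ i₀ → α j ⟨x, hxt⟩ = 0 := by
      intro j hj
      obtain ⟨X, Y, hX, -, hX0, h⟩ := exists_isRootPair_isotropy hα hj
      have h1 := (h ⟨x, hxt⟩).1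
      rw [hx X hX, eq_comm, smul_eq_zero] at h1
      exact h1.resolve_right (h.right_ne_zero ((mem_roots_iff t _).1 (hα.mem_roots j)).1 hX0)
    have h2 := hα.eq_zero_of_apply hs hB ht (⟨x, hxt⟩ - (α i₀ ⟨x, hxt⟩) • z) fun j => by
      by_cases hj : j = i₀
      · subst hj
        simp [hz]
      · simp [hz, hj, h0 j hj]
    have h3 := congrArg Subtype.val (sub_eq_zero.1 h2)
    exact Submodule.mem_span_singleton.2 ⟨_, h3.symm⟩
  · rw [Submodule.span_singleton_le_iff_mem]
    exact ⟨Submodule.mem_sup_left z.2, fun y hy => lie_of_mem_isotropy ht hz hy⟩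

/-- `m₁` is an irreducible `h`-module. A root vector of `α i₀` splits into components in a submodule
`E` and in its complement; one of them is a nonzero root vector of `α i₀`. The submodule that
contains it generates, together with `h`, all of `L`, and hence is `m₁`. -/
lemma IsTypeIIb.irreducible [FiniteDimensional ℝ L]
    (hIIb : IsTypeIIb t α i₀) (hB : IsInvariantInner B) (ht : IsMaximalAbelian t)
    (hα : IsFundamentalSystem t α) (E : Submodule ℝ L) (hE : E ≤ levelSpace t α i₀ 1)
    (hinv : ∀ x ∈ isotropy t α i₀, ∀ y ∈ E, ⁅x, y⁆ ∈ E) : E = ⊥ ∨ E = levelSpace t α i₀ 1 := by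
  classical
  obtain ⟨z, hz⟩ := exists_dual_vector hα.linearIndependent i₀
  have hg := hIIb.isTwoStepGrading hB ht hα hz
  -- A submodule that contains a root vector for `α i₀` is everything.
  have key : ∀ E' : Submodule ℝ L, E' ≤ levelSpace t α i₀ 1 →
      (∀ x ∈ isotropy t α i₀, ∀ y ∈ E', ⁅x, y⁆ ∈ E') →
      (∃ X Y, X ∈ E' ∧ Y ∈ E' ∧ X ≠ 0 ∧ IsRootPair t (α i₀) X Y) →
      ∀ u ∈ levelSpace t α i₀ 1, (∀ e ∈ E', B e u = 0) → u = 0 := by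
    rintro E' hE' hinv' ⟨X, Y, hX, hY, hX0, h⟩ u hu huE
    obtain ⟨S, hhS, hES, hS⟩ := hg.exists_lieSubalgebra E' hE' hinv'
    have hStop : S = ⊤ := by
      refine hα.eq_top_of_mem hB ht S (fun H hH => hhS (Submodule.mem_sup_left hH)) fun j => ?_
      by_cases hj : j = i₀
      · subst hj
        exact ⟨X, Y, hES hX, hES hY, hX0, h⟩
      · obtain ⟨V, W, hV, hW, hV0, h'⟩ := exists_isRootPair_isotropy hα hj
        exact ⟨V, W, hhS hV, hhS hW, hV0, h'⟩
    exact hB.eq_zero (hS u hu huE u (hStop ▸ LieSubalgebra.mem_top u))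
  obtain ⟨hα0, X, Y, hX0, h⟩ := (mem_roots_iff t (α i₀)).1 (hα.mem_roots i₀)
  have hl := mem_rootsOfLevel_simple (i₀ := i₀) hα i₀
  rw [if_pos rfl] at hl
  have hX := mem_levelSpace_of_isRootPair hl h
  have hY := mem_levelSpace_of_isRootPair hl h.swap
  obtain ⟨e, he, e', he', hXe⟩ := hB.exists_add_orthogonal E X
  obtain ⟨f, hf, f', hf', hYf⟩ := hB.exists_add_orthogonal E Y
  have hoinv : ∀ x ∈ isotropy t α i₀, ∀ y, (∀ w ∈ E, B w y = 0) → ∀ w ∈ E, B w ⁅x, y⁆ = 0 := by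
    intro x hx y hy w hw
    have := hy _ (hinv x hx w hw)
    rw [hB.inv] at this
    linarith
  -- The components of a root vector in `E` and in its complement are root vectors.
  have split : ∀ (p q p' q' : L) (c : ℝ) (H : t), p ∈ E → q ∈ E → (∀ w ∈ E, B w p' = 0) →
      (∀ w ∈ E, B w q' = 0) → ⁅(H : L), p + p'⁆ = c • (q + q') →
      ⁅(H : L), p⁆ = c • q ∧ ⁅(H : L), p'⁆ = c • q' := by
    intro p q p' q' c H hp hq hp' hq' hh
    have hH : (H : L) ∈ isotropy t α i₀ := Submodule.mem_sup_left H.2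
    have hsum : (⁅(H : L), p⁆ - c • q) + (⁅(H : L), p'⁆ - c • q') = 0 := by
      rw [lie_add, smul_add] at hh
      rw [sub_add_sub_comm, hh, sub_self]
    have hmem : ⁅(H : L), p⁆ - c • q ∈ E := E.sub_mem (hinv _ hH _ hp) (E.smul_mem c hq)
    have h0 : ⁅(H : L), p⁆ - c • q = 0 := by
      refine hB.eq_zero ?_
      have h1 : B (⁅(H : L), p⁆ - c • q) (⁅(H : L), p'⁆ - c • q') = 0 := by
        rw [(B _).map_sub, (B _).map_smul, hoinv _ hH _ hp' _ hmem, hq' _ hmem, smul_zero, sub_zero]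
      rw [eq_neg_of_add_eq_zero_right hsum, map_neg, neg_eq_zero] at h1
      exact h1
    exact ⟨sub_eq_zero.1 h0, by rwa [h0, zero_add, sub_eq_zero] at hsum⟩
  have hpair : IsRootPair t (α i₀) e f ∧ IsRootPair t (α i₀) e' f' := by
    have h1 : ∀ H : t, _ := fun H => split e f e' f' (α i₀ H) H he hf he' hf'
      (by rw [← hXe, ← hYf]; exact (h H).1)
    have h2 : ∀ H : t, _ := fun H => split f e f' e' (-α i₀ H) H hf he hf' he'
      (by rw [← hXe, ← hYf, neg_smul]; exact (h H).2)
    exact ⟨fun H => ⟨(h1 H).1, by rw [(h2 H).1, neg_smul]⟩,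
      fun H => ⟨(h1 H).2, by rw [(h2 H).2, neg_smul]⟩⟩
  by_cases he0 : e = 0
  · left
    let E' : Submodule ℝ L := levelSpace t α i₀ 1 ⊓ B.orthogonal E
    have he1 : e' ≠ 0 := by
      rintro rfl
      rw [he0, add_zero] at hXe
      exact hX0 hXe
    have hu := key E' inf_le_left (fun x hx y hy => ⟨hg.lie_h_m₁ hx hy.1, hoinv x hx y hy.2⟩)
      ⟨e', f', ⟨by rw [← sub_eq_of_eq_add' hXe]; exact Submodule.sub_mem _ hX (hE he), he'⟩,
        ⟨by rw [← sub_eq_of_eq_add' hYf]; exact Submodule.sub_mem _ hY (hE hf), hf'⟩, he1,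
        hpair.2⟩
    rw [Submodule.eq_bot_iff]
    exact fun u hu' => hu u (hE hu') fun w hw => by rw [hB.symm]; exact hw.2 u hu'
  · right
    refine le_antisymm hE fun x hx => ?_
    obtain ⟨y, hy, w, hw, rfl⟩ := hB.exists_add_orthogonal E x
    have hwm : w ∈ levelSpace t α i₀ 1 := by
      have := Submodule.sub_mem _ hx (hE hy)
      rwa [add_sub_cancel_left] at this
    rw [key E hE hinv ⟨e, f, he, hf, he0, hpair.1⟩ w hwm hw, add_zero]
    exact hy

end TypeIIb

/-! ### The simple ideals of the isotropy algebra -/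

section Decomposition

variable {L : Type*} [LieRing L] [LieAlgebra ℝ L]

/-- A simple subalgebra is spanned by its brackets. -/
lemma induction_simple {a : LieSubalgebra ℝ L} (ha : LieAlgebra.IsSimple ℝ a) {p : L → Prop}
    (lie : ∀ x ∈ a, ∀ y ∈ a, p ⁅x, y⁆) (zero : p 0) (add : ∀ x y, p x → p y → p (x + y))
    (smul : ∀ (c : ℝ) x, p x → p (c • x)) {x : L} (hx : x ∈ a) : p x := by
  have hmem : (⟨x, hx⟩ : a) ∈ Submodule.span ℝ {v : a | ∃ x y : a, v = ⁅x, y⁆} :=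
    span_lie_eq_top ha ▸ Submodule.mem_top
  have : ∀ v : a, v ∈ Submodule.span ℝ {v : a | ∃ x y : a, v = ⁅x, y⁆} → p v := by
    intro v hv
    induction hv using Submodule.span_induction with
    | mem v hv =>
      obtain ⟨x, y, rfl⟩ := hv
      exact lie x x.2 y y.2
    | zero => exact zero
    | add v w _ _ hv hw => exact add _ _ hv hw
    | smul c v _ hv => exact smul c _ hv
  exact this _ hmem

/-- A subspace of a simple subalgebra `a` stable under `a` is trivial. -/
lemma eq_bot_or_eq_of_simple {a : LieSubalgebra ℝ L} (ha : LieAlgebra.IsSimple ℝ a)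
    (E : Submodule ℝ L) (hE : E ≤ a.toSubmodule) (hinv : ∀ x ∈ a, ∀ y ∈ E, ⁅x, y⁆ ∈ E) :
    E = ⊥ ∨ E = a.toSubmodule := by
  by_cases h0 : E.comap a.toSubmodule.subtype = ⊥
  · left
    rw [Submodule.eq_bot_iff] at h0 ⊢
    exact fun x hx => congrArg Subtype.val (h0 ⟨x, hE hx⟩ hx)
  · right
    have := eq_top_of_lie_mem ha (E.comap a.toSubmodule.subtype)
      (fun x y hy => hinv x x.2 y hy) h0
    refine le_antisymm hE fun x hx => ?_
    have hx' : (⟨x, hx⟩ : a) ∈ E.comap a.toSubmodule.subtype := this ▸ Submodule.mem_top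
    exact hx'

/-- A two-step grading whose degree zero part is the sum of a line and of two simple ideals, the
second of which commutes with `m₂`, with `m₁` irreducible. -/
structure IsSplitGrading (B : LinearMap.BilinForm ℝ L) (z : L) (h m₁ m₂ : Submodule ℝ L)
    (h₁ h₂ : LieSubalgebra ℝ L) : Prop extends IsTwoStepGrading B z h m₁ m₂ where
  span_h : Submodule.span ℝ {z} ⊔ h₁.toSubmodule ⊔ h₂.toSubmodule = h
  ideal₁ : IsSimpleIdealOf h₁ h
  ideal₂ : IsSimpleIdealOf h₂ h
  lie_h₁_h₂ : ∀ x ∈ h₁, ∀ y ∈ h₂, ⁅x, y⁆ = 0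
  lie_h₂_m₂ : ∀ x ∈ h₂, ∀ y ∈ m₂, ⁅x, y⁆ = 0
  irreducible : ∀ E ≤ m₁, (∀ x ∈ h, ∀ y ∈ E, ⁅x, y⁆ ∈ E) → E = ⊥ ∨ E = m₁
  exists_lie_ne_zero : ∃ x ∈ h₁, ∃ y ∈ m₂, ⁅x, y⁆ ≠ 0
  m₁_ne_bot : m₁ ≠ ⊥
  z_ne_zero : z ≠ 0

variable {B : LinearMap.BilinForm ℝ L}

lemma IsTwoStepGrading.orthogonal_z {z : L} {h m₁ m₂ : Submodule ℝ L}
    (hg : IsTwoStepGrading B z h m₁ m₂) {a : LieSubalgebra ℝ L} (ha : IsSimpleIdealOf a h)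
    {x : L} (hx : x ∈ a) : B x z = 0 := by
  refine induction_simple ha.simple (p := fun x => B x z = 0) (fun x hx y hy => ?_) (by simp)
    (fun x y hx hy => by simp [hx, hy]) (fun c x hx => by simp [hx]) hx
  have : ⁅x, z⁆ = 0 := by rw [← lie_skew, (hg.mem_h x).1 (ha.le hx), neg_zero]
  rw [hg.inv, this]
  simp

variable {t : LieSubalgebra ℝ L} {ι : Type*} [Fintype ι] {α : ι → Module.Dual ℝ t} {i₀ : ι}
  {h₁ h₂ : LieSubalgebra ℝ L}

/-- The ideal `h₁` acts nontrivially on `m₂`. Otherwise `h` acts on `m₂` through its center, the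
highest root is proportional to the dual of the center, and it is not orthogonal to `α i₀`. -/
lemma IsTypeIIb.exists_lie_ne_zero [FiniteDimensional ℝ L] [DecidableEq ι]
    (hIIb : IsTypeIIb t α i₀) (hB : IsInvariantInner B) (hBK : ∀ x y, B x y = negKilling x y)
    (ht : IsMaximalAbelian t) (hs : LieAlgebra.IsSimple ℝ L)
    (hα : IsFundamentalSystem t α) {z : t} (hz : ∀ j, α j z = if j = i₀ then 1 else 0)
    (hdec : IsIsotropyDecomposition t α i₀ h₁ h₂) :
    ∃ x ∈ h₁, ∃ y ∈ levelSpace t α i₀ 2, ⁅x, y⁆ ≠ 0 := by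
  by_contra! hzero
  have hg := hIIb.isTwoStepGrading hB ht hα hz
  obtain ⟨θ, ⟨hθr, hθ⟩, H, hH, hHα⟩ := hIIb.not_adjacent
  obtain ⟨hθ0, X, Y, hX0, h⟩ := (mem_roots_iff t θ).1 hθr
  obtain ⟨β, hβr, m, hβ, hm⟩ := hIIb.two_summands.1
  obtain ⟨m', hm'⟩ := hθ β hβr
  have hθm : θ = ∑ j, ((m j + m' j : ℕ) : ℝ) • α j := by
    rw [sub_eq_iff_eq_add.1 hm', hβ, ← Finset.sum_add_distrib]
    refine Finset.sum_congr rfl fun j _ => ?_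
    rw [← add_smul, Nat.cast_add, add_comm]
  have hle : m i₀ + m' i₀ ≤ 2 :=
    hIIb.two_summands.2 ⟨θ, hθr, fun j => m j + m' j, hθm, rfl⟩
  have hθ2 : θ ∈ rootsOfLevel t α i₀ 2 := ⟨hθr, fun j => m j + m' j, hθm, by simp only; omega⟩
  have hX : X ∈ levelSpace t α i₀ 2 := mem_levelSpace_of_isRootPair hθ2 h
  have hθz : θ z = 2 := by
    rw [hθm, apply_of_level hz]
    have : m i₀ + m' i₀ = 2 := by omega
    rw [this]
    norm_num
  have hY0 : Y ≠ 0 := h.right_ne_zero hθ0 hX0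
  have key : ∀ K : t, θ K * B z z = 2 * B K z := by
    intro K
    have hK : (K : L) ∈ isotropy t α i₀ := Submodule.mem_sup_left K.2
    rw [← hdec.span, centerOf_isotropy hs hB ht hα hz] at hK
    obtain ⟨p, hp, b, hb, hpb⟩ := Submodule.mem_sup.1 hK
    obtain ⟨q, hq, a, ha, rfl⟩ := Submodule.mem_sup.1 hp
    obtain ⟨c, rfl⟩ := Submodule.mem_span_singleton.1 hq
    have h1 : θ K • Y = (2 * c) • Y := by
      rw [← (h K).1, ← hpb, add_lie, add_lie, smul_lie, (h z).1, hzero a ha X hX,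
        hdec.numbering b hb X hX, hθz]
      module
    have h2 : θ K = 2 * c := by
      have := sub_eq_zero.2 h1
      rw [← sub_smul] at this
      exact sub_eq_zero.1 ((smul_eq_zero.1 this).resolve_right hY0)
    rw [h2, ← hpb]
    simp only [map_add, map_smul, LinearMap.add_apply, LinearMap.smul_apply, smul_eq_mul,
      hg.orthogonal_z hdec.ideal₁ ha, hg.orthogonal_z hdec.ideal₂ hb]
    ring
  have hz0 : (z : L) ≠ 0 := by
    intro h0
    have : z = 0 := Subtype.ext h0
    simp [this] at hθz
  have hBz := hB.pos _ hz0
  -- `H` and `z` are proportional.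
  have hprop : B z z • H - (2 : ℝ) • z = 0 := by
    refine Subtype.ext (hB.eq_zero ?_)
    set K : t := B z z • H - (2 : ℝ) • z with hKdef
    have e : B (K : L) (K : L) = B z z * B H K - 2 * B z K := by
      have e' : ∀ x, B (K : L) x = B z z * B H x - 2 * B z x := fun x => by simp [hKdef]
      exact e' K
    rw [e, hBK H K, hH K, mul_comm, key K, hB.symm K z, sub_self]
  have h3 := congrArg (α i₀) (sub_eq_zero.1 hprop)
  simp [hHα, hz] at h3

/-- The hypotheses on a painted Dynkin diagram of Type IIb in the form in which they are used. -/
lemma IsTypeIIb.isSplitGrading [FiniteDimensional ℝ L] [DecidableEq ι]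
    (hIIb : IsTypeIIb t α i₀) (hB : IsInvariantInner B) (hBK : ∀ x y, B x y = negKilling x y)
    (ht : IsMaximalAbelian t) (hs : LieAlgebra.IsSimple ℝ L)
    (hα : IsFundamentalSystem t α) {z : t} (hz : ∀ j, α j z = if j = i₀ then 1 else 0)
    (hdec : IsIsotropyDecomposition t α i₀ h₁ h₂) :
    IsSplitGrading B (z : L) (isotropy t α i₀) (levelSpace t α i₀ 1) (levelSpace t α i₀ 2)
      h₁ h₂ where
  toIsTwoStepGrading := hIIb.isTwoStepGrading hB ht hα hz
  span_h := by rw [← centerOf_isotropy hs hB ht hα hz]; exact hdec.span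
  ideal₁ := hdec.ideal₁
  ideal₂ := hdec.ideal₂
  lie_h₁_h₂ x hx y hy := by
    have h1 : ⁅x, y⁆ ∈ h₂.toSubmodule := hdec.ideal₂.lie_mem x (hdec.ideal₁.le hx) y hy
    have h2 : ⁅x, y⁆ ∈ h₁.toSubmodule := by
      rw [← lie_skew]
      exact Submodule.neg_mem _ (hdec.ideal₁.lie_mem y (hdec.ideal₂.le hy) x hx)
    have hd : Disjoint h₁.toSubmodule h₂.toSubmodule :=
      hdec.independent.pairwiseDisjoint (show (1 : Fin 3) ≠ 2 by decide)
    exact (Submodule.disjoint_def.1 hd) _ h2 h1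
  lie_h₂_m₂ := hdec.numbering
  irreducible := hIIb.irreducible hB ht hα
  exists_lie_ne_zero := hIIb.exists_lie_ne_zero hB hBK ht hs hα hz hdec
  m₁_ne_bot := by
    obtain ⟨-, X, Y, hX0, h⟩ := (mem_roots_iff t (α i₀)).1 (hα.mem_roots i₀)
    have hl := mem_rootsOfLevel_simple (i₀ := i₀) hα i₀
    rw [if_pos rfl] at hl
    exact (Submodule.ne_bot_iff _).2 ⟨X, mem_levelSpace_of_isRootPair hl h, hX0⟩
  z_ne_zero h0 := by
    have h1 : z = 0 := Subtype.ext h0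
    have := hz i₀
    simp [h1] at this

end Decomposition

/-! ### Orthogonal projections -/

section Projections

variable {V : Type*} [AddCommGroup V] [Module ℝ V] [FiniteDimensional ℝ V]
  {B : LinearMap.BilinForm ℝ V}

/-- An orthonormal basis of a subspace for a positive definite form. -/
def IsInner.onb (hB : IsInner B) (W : Submodule ℝ V) :
    Module.Basis (Fin (Module.finrank ℝ W)) ℝ W :=
  (hB.restrict W).exists_orthonormal_basis.choose

lemma IsInner.onb_apply (hB : IsInner B) (W : Submodule ℝ V) (a b) :
    B (hB.onb W a) (hB.onb W b) = if a = b then 1 else 0 :=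
  (hB.restrict W).exists_orthonormal_basis.choose_spec a b

/-- The orthogonal projection to a subspace, as an endomorphism. -/
def IsInner.proj (hB : IsInner B) (W : Submodule ℝ V) : V →ₗ[ℝ] V :=
  ∑ a, (B (hB.onb W a)).smulRight (hB.onb W a : V)

namespace IsInner

lemma proj_apply (hB : IsInner B) (W : Submodule ℝ V) (x : V) :
    hB.proj W x = ∑ a, B (hB.onb W a) x • (hB.onb W a : V) := by
  simp [proj]

lemma proj_mem (hB : IsInner B) (W : Submodule ℝ V) (x : V) : hB.proj W x ∈ W := by
  rw [proj_apply]
  exact W.sum_mem fun a _ => W.smul_mem _ (hB.onb W a).2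

lemma proj_eq_zero (hB : IsInner B) {W : Submodule ℝ V} {x : V} (hx : ∀ w ∈ W, B w x = 0) :
    hB.proj W x = 0 := by
  rw [proj_apply]
  exact Finset.sum_eq_zero fun a _ => by rw [hx _ (hB.onb W a).2, zero_smul]

lemma proj_eq_self (hB : IsInner B) {W : Submodule ℝ V} {x : V} (hx : x ∈ W) :
    hB.proj W x = x := by
  have h : hB.proj W ∘ₗ W.subtype = W.subtype := by
    refine (hB.onb W).ext fun b => ?_
    simp [proj_apply, hB.onb_apply]
  exact congrArg (fun f => f ⟨x, hx⟩) h

lemma form_proj_sub (hB : IsInner B) {W : Submodule ℝ V} (x : V) {w : V} (hw : w ∈ W) :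
    B w (x - hB.proj W x) = 0 := by
  have h : B.flip (x - hB.proj W x) ∘ₗ W.subtype = 0 := by
    refine (hB.onb W).ext fun b => ?_
    simp [proj_apply, hB.onb_apply]
  simpa using congrArg (fun f => f ⟨w, hw⟩) h

lemma form_proj_of_mem (hB : IsInner B) {W : Submodule ℝ V} (x : V) {w : V} (hw : w ∈ W) :
    B w (hB.proj W x) = B w x := by
  have := hB.form_proj_sub x hw
  rw [map_sub] at this
  linarith

lemma form_proj (hB : IsInner B) (W : Submodule ℝ V) (x y : V) :
    B (hB.proj W x) y = B x (hB.proj W y) := by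
  rw [← hB.form_proj_of_mem y (hB.proj_mem W x), hB.symm x, ← hB.form_proj_of_mem x
    (hB.proj_mem W y), hB.symm]

lemma trace_proj_comp (hB : IsInner B) (W : Submodule ℝ V) (M : V →ₗ[ℝ] V) :
    LinearMap.trace ℝ V (hB.proj W * M) = ∑ a, B (hB.onb W a) (M (hB.onb W a)) := by
  have h : hB.proj W * M = ∑ a, (B (hB.onb W a) ∘ₗ M).smulRight (hB.onb W a : V) := by
    ext x
    simp [proj_apply]
  rw [h, map_sum]
  simp

/-- Maps that preserve a subspace and its orthogonal complement commute with the projection. -/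
lemma proj_comm (hB : IsInner B) {W : Submodule ℝ V} {A : V →ₗ[ℝ] V}
    (h1 : ∀ x ∈ W, A x ∈ W) (h2 : ∀ x, (∀ w ∈ W, B w x = 0) → ∀ w ∈ W, B w (A x) = 0) :
    hB.proj W * A = A * hB.proj W := by
  ext x
  have e : A x = A (hB.proj W x) + A (x - hB.proj W x) := by
    rw [← map_add, add_sub_cancel]
  rw [Module.End.mul_apply, Module.End.mul_apply, e, map_add,
    hB.proj_eq_self (h1 _ (hB.proj_mem W x)),
    hB.proj_eq_zero (h2 _ fun w hw => hB.form_proj_sub x hw), add_zero]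

/-- The trace of the adjoint. -/
lemma trace_eq_of_adjoint (hB : IsInner B) {M N : V →ₗ[ℝ] V}
    (h : ∀ x y, B (M x) y = B x (N y)) : LinearMap.trace ℝ V M = LinearMap.trace ℝ V N := by
  have e : ∀ A : V →ₗ[ℝ] V, hB.proj ⊤ * A = A := fun A => by
    ext x
    exact hB.proj_eq_self Submodule.mem_top
  rw [← e M, ← e N, trace_proj_comp, trace_proj_comp]
  refine Finset.sum_congr rfl fun a _ => ?_
  rw [hB.symm, h]

lemma sum_proj {σ : Type*} [Fintype σ] (hB : IsInner B) {w : σ → Submodule ℝ V}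
    (horth : ∀ i j, i ≠ j → ∀ x ∈ w i, ∀ y ∈ w j, B x y = 0) (hspan : ⨆ i, w i = ⊤) :
    ∑ i, hB.proj (w i) = 1 := by
  classical
  have hle : ⨆ i, w i ≤ LinearMap.ker (∑ i, hB.proj (w i) - 1) := by
    refine iSup_le fun i x hx => ?_
    rw [LinearMap.mem_ker, LinearMap.sub_apply, LinearMap.sum_apply,
      Finset.sum_eq_single_of_mem i (Finset.mem_univ i) fun j _ hj =>
        hB.proj_eq_zero fun y hy => horth j i hj y hy x hx, hB.proj_eq_self hx]
    simp
  rw [hspan] at hle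
  ext x
  exact sub_eq_zero.1 (hle (Submodule.mem_top (x := x)))

end IsInner

end Projections

/-! ### The partial Killing forms -/

section PartialKilling

variable {L : Type*} [LieRing L] [LieAlgebra ℝ L] [FiniteDimensional ℝ L]
  {B : LinearMap.BilinForm ℝ L}

/-- The form `-tr (π' ∘ ad v ∘ π ∘ ad v')`, with `π` and `π'` the orthogonal projections to `W`
and `W'`. It is the part of the negative of the Killing form that comes from the components
`W → W'` of `ad v`. -/
def IsInvariantInner.pform (hB : IsInvariantInner B) (W W' : Submodule ℝ L) :
    LinearMap.BilinForm ℝ L :=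
  LinearMap.mk₂ ℝ (fun v v' => -LinearMap.trace ℝ L
    (hB.proj W' * LieAlgebra.ad ℝ L v * (hB.proj W * LieAlgebra.ad ℝ L v')))
    (fun a b c => by simp only [map_add, mul_add, add_mul, neg_add])
    (fun r a c => by simp only [map_smul, mul_smul_comm, smul_mul_assoc, smul_eq_mul, mul_neg])
    (fun a b c => by simp only [map_add, mul_add, neg_add])
    (fun r a c => by simp only [map_smul, mul_smul_comm, smul_eq_mul, mul_neg])

namespace IsInvariantInner

variable (hB : IsInvariantInner B) (W W' : Submodule ℝ L)

lemma pform_def (v v' : L) : hB.pform W W' v v' = -LinearMap.trace ℝ L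
    (hB.proj W' * LieAlgebra.ad ℝ L v * (hB.proj W * LieAlgebra.ad ℝ L v')) := rfl

lemma pform_apply (v v' : L) : hB.pform W W' v v' =
    ∑ b, ∑ a, B ⁅v, (hB.onb W' b : L)⁆ (hB.onb W a) * B ⁅v', (hB.onb W' b : L)⁆ (hB.onb W a) := by
  rw [pform_def, mul_assoc, hB.trace_proj_comp, ← Finset.sum_neg_distrib]
  refine Finset.sum_congr rfl fun b _ => ?_
  simp only [Module.End.mul_apply, LieAlgebra.ad_apply]
  rw [← hB.inv, hB.proj_apply, map_sum]
  refine Finset.sum_congr rfl fun a _ => ?_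
  rw [map_smul, smul_eq_mul, hB.symm (hB.onb W a), mul_comm]

lemma pform_apply_single (v v' : L) : hB.pform W W' v v' =
    ∑ b, B ⁅v, (hB.onb W' b : L)⁆ (hB.proj W ⁅v', (hB.onb W' b : L)⁆) := by
  rw [pform_def, mul_assoc, hB.trace_proj_comp, ← Finset.sum_neg_distrib]
  refine Finset.sum_congr rfl fun b _ => ?_
  simp only [Module.End.mul_apply, LieAlgebra.ad_apply]
  rw [← hB.inv]

lemma pform_symm (v v' : L) : hB.pform W W' v v' = hB.pform W W' v' v := by
  rw [pform_apply, pform_apply]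
  simp only [mul_comm]

lemma pform_swap (v v' : L) : hB.pform W W' v v' = hB.pform W' W v v' := by
  rw [pform_symm, pform_def, pform_def, LinearMap.trace_mul_comm]

/-- The trace of a partial Killing form over a third subspace. -/
def ptrace (W₁ W₂ W₃ : Submodule ℝ L) : ℝ := ∑ c, hB.pform W₁ W₂ (hB.onb W₃ c) (hB.onb W₃ c)

lemma ptrace_swap_left (W₁ W₂ W₃ : Submodule ℝ L) :
    hB.ptrace W₁ W₂ W₃ = hB.ptrace W₂ W₁ W₃ :=
  Finset.sum_congr rfl fun _ _ => hB.pform_swap _ _ _ _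

/-- The structure constants are antisymmetric, so that the trace is symmetric. -/
lemma ptrace_swap_right (W₁ W₂ W₃ : Submodule ℝ L) :
    hB.ptrace W₁ W₂ W₃ = hB.ptrace W₁ W₃ W₂ := by
  simp only [ptrace, pform_apply]
  rw [Finset.sum_comm]
  refine Finset.sum_congr rfl fun b _ => Finset.sum_congr rfl fun c _ =>
    Finset.sum_congr rfl fun a _ => ?_
  rw [← lie_skew, map_neg, LinearMap.neg_apply, neg_mul_neg]

lemma ptrace_eq {W₁ W₂ W₃ : Submodule ℝ L} {c : ℝ}
    (h : ∀ v ∈ W₃, ∀ v' ∈ W₃, hB.pform W₁ W₂ v v' = c * B v v') :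
    hB.ptrace W₁ W₂ W₃ = c * Module.finrank ℝ W₃ := by
  rw [ptrace, Finset.sum_congr rfl fun a _ => (h _ (hB.onb W₃ a).2 _ (hB.onb W₃ a).2).trans
    (by rw [hB.onb_apply, if_pos rfl, mul_one])]
  simp [mul_comm]

variable {W W'}

/-- `ad x` commutes with the projection to an `ad x`-stable subspace. -/
lemma proj_ad_comm {x : L} (hx : ∀ y ∈ W, ⁅x, y⁆ ∈ W) :
    hB.proj W * LieAlgebra.ad ℝ L x = LieAlgebra.ad ℝ L x * hB.proj W :=
  hB.proj_comm hx fun y hy w hw => by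
    have := hy _ (hx w hw)
    rw [hB.inv] at this
    exact neg_eq_zero.1 this

lemma pform_lie {x : L} (hx : ∀ y ∈ W, ⁅x, y⁆ ∈ W) (hx' : ∀ y ∈ W', ⁅x, y⁆ ∈ W') (v v' : L) :
    hB.pform W W' ⁅x, v⁆ v' = -hB.pform W W' v ⁅x, v'⁆ := by
  have h1 := hB.proj_ad_comm hx
  have h2 := hB.proj_ad_comm hx'
  have had : ∀ a b : L, LieAlgebra.ad ℝ L ⁅a, b⁆ = LieAlgebra.ad ℝ L a * LieAlgebra.ad ℝ L b -
      LieAlgebra.ad ℝ L b * LieAlgebra.ad ℝ L a := fun a b => by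
    ext y
    simp
  rw [pform_def, pform_def, neg_neg, had, had]
  set P := hB.proj W
  set P' := hB.proj W'
  set X := LieAlgebra.ad ℝ L x
  set A := LieAlgebra.ad ℝ L v
  set A' := LieAlgebra.ad ℝ L v'
  have e1 : P' * (X * A - A * X) * (P * A') = X * (P' * A * P * A') - P' * A * (X * P) * A' := by
    rw [mul_sub, sub_mul, ← mul_assoc P' X A, h2]
    noncomm_ring
  have e2 : P' * A * (P * (X * A' - A' * X)) = P' * A * (P * X) * A' - (P' * A * P * A') * X := by
    noncomm_ring
  rw [e1, e2, h1, map_sub, map_sub, LinearMap.trace_mul_comm ℝ X]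
  ring

lemma pform_eq_zero {v : L} (hv : ∀ y ∈ W, ∀ u ∈ W', B ⁅v, y⁆ u = 0) (v' : L) :
    hB.pform W W' v v' = 0 := by
  rw [pform_apply]
  refine Finset.sum_eq_zero fun b _ => Finset.sum_eq_zero fun a _ => ?_
  have := hv _ (hB.onb W a).2 _ (hB.onb W' b).2
  rw [hB.inv, hB.symm, neg_eq_zero] at this
  rw [this, zero_mul]

lemma sum_pform {σ : Type*} [Fintype σ] {w : σ → Submodule ℝ L}
    (horth : ∀ i j, i ≠ j → ∀ x ∈ w i, ∀ y ∈ w j, B x y = 0) (hspan : ⨆ i, w i = ⊤) (v v' : L) :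
    ∑ i, ∑ j, hB.pform (w i) (w j) v v' = -killingForm ℝ L v v' := by
  simp only [pform_def]
  simp only [Finset.sum_neg_distrib, ← map_sum, ← Finset.sum_mul, ← Finset.mul_sum]
  rw [hB.sum_proj horth hspan, one_mul, one_mul, killingForm_apply_apply]
  rfl

/-- Schur's lemma for invariant symmetric forms on an irreducible submodule. -/
lemma exists_scalar (hB : IsInvariantInner B) {h W : Submodule ℝ L}
    (hW : ∀ x ∈ h, ∀ y ∈ W, ⁅x, y⁆ ∈ W)
    (irr : ∀ E ≤ W, (∀ x ∈ h, ∀ y ∈ E, ⁅x, y⁆ ∈ E) → E = ⊥ ∨ E = W)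
    (F : LinearMap.BilinForm ℝ L) (hF : ∀ x y, F x y = F y x)
    (hinv : ∀ x ∈ h, ∀ v v', F ⁅x, v⁆ v' = -F v ⁅x, v'⁆) :
    ∃ c : ℝ, ∀ v ∈ W, ∀ v' ∈ W, F v v' = c * B v v' := by
  by_cases hW0 : W = ⊥
  · subst hW0
    exact ⟨0, fun v hv v' _ => by simp [(Submodule.mem_bot ℝ).1 hv]⟩
  obtain ⟨c, v, hv, hv0, hc⟩ := hB.exists_eigenvector F W (fun x _ y _ => hF x y) hW0
  let E : Submodule ℝ L :=
    { carrier := {v | v ∈ W ∧ ∀ y ∈ W, F v y = c * B v y}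
      add_mem' := fun {a b} ha hb => ⟨W.add_mem ha.1 hb.1, fun y hy => by
        simp only [map_add, LinearMap.add_apply, ha.2 y hy, hb.2 y hy]
        ring⟩
      zero_mem' := ⟨W.zero_mem, fun y _ => by simp⟩
      smul_mem' := fun r a ha => ⟨W.smul_mem r ha.1, fun y hy => by
        simp only [map_smul, LinearMap.smul_apply, smul_eq_mul, ha.2 y hy]
        ring⟩ }
  have hE : E = ⊥ ∨ E = W := irr E (fun x hx => hx.1) fun x hx y hy =>
    ⟨hW x hx y hy.1, fun u hu => by
      rw [hinv x hx, hy.2 _ (hW x hx u hu), hB.inv]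
      ring⟩
  rcases hE with hE | hE
  · exact absurd ((Submodule.mem_bot ℝ).1 (hE ▸ (⟨hv, hc⟩ : v ∈ E))) hv0
  · exact ⟨c, fun x hx => (hE ▸ hx : x ∈ E).2⟩

end IsInvariantInner

end PartialKilling

/-! ### The partial Killing forms of the decomposition of Type IIb -/

section Constants

variable {L : Type*} [LieRing L] [LieAlgebra ℝ L]
  {B : LinearMap.BilinForm ℝ L} {z : L} {h m₁ m₂ : Submodule ℝ L} {h₁ h₂ : LieSubalgebra ℝ L}

/-- The summands `h₀ = ℝ z, h₁, h₂, m₁, m₂`. -/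
def splitSummands (z : L) (m₁ m₂ : Submodule ℝ L) (h₁ h₂ : LieSubalgebra ℝ L) :
    Fin 5 → Submodule ℝ L :=
  ![Submodule.span ℝ {z}, h₁.toSubmodule, h₂.toSubmodule, m₁, m₂]

namespace IsSplitGrading

local notation "𝔴" => splitSummands z m₁ m₂ h₁ h₂

lemma z_mem_summand : z ∈ 𝔴 0 := Submodule.mem_span_singleton_self z

lemma le_h (hS : IsSplitGrading B z h m₁ m₂ h₁ h₂) {i : Fin 5} (h3 : i ≠ 3) (h4 : i ≠ 4) :
    𝔴 i ≤ h := by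
  fin_cases i
  · exact (Submodule.span_singleton_le_iff_mem _ _).2 hS.z_mem
  · exact hS.ideal₁.le
  · exact hS.ideal₂.le
  · exact absurd rfl h3
  · exact absurd rfl h4

lemma lie_mem_summand (hS : IsSplitGrading B z h m₁ m₂ h₁ h₂) {x : L} (hx : x ∈ h) (i : Fin 5)
    {y : L} (hy : y ∈ 𝔴 i) : ⁅x, y⁆ ∈ 𝔴 i := by
  fin_cases i
  · obtain ⟨c, rfl⟩ := Submodule.mem_span_singleton.1 hy
    rw [lie_smul, ← lie_skew, (hS.mem_h x).1 hx, neg_zero, smul_zero]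
    exact Submodule.zero_mem _
  · exact hS.ideal₁.lie_mem x hx y hy
  · exact hS.ideal₂.lie_mem x hx y hy
  · exact hS.lie_h_m₁ hx hy
  · exact hS.lie_h_m₂ hx hy

lemma lie_mem_m₁ (hS : IsSplitGrading B z h m₁ m₂ h₁ h₂) {x : L} (hx : x ∈ m₁) {i : Fin 5}
    (hi : i ≠ 3) {y : L} (hy : y ∈ 𝔴 i) : ⁅x, y⁆ ∈ m₁ := by
  by_cases h4 : i = 4
  · subst h4
    exact hS.lie_m₁_m₂ hx hy
  · rw [← lie_skew]
    exact m₁.neg_mem (hS.lie_h_m₁ (hS.le_h hi h4 hy) hx)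

lemma iSup_summands (hS : IsSplitGrading B z h m₁ m₂ h₁ h₂) : ⨆ i, 𝔴 i = ⊤ := by
  rw [eq_top_iff, ← hS.span, ← hS.span_h]
  have hle : ∀ i, 𝔴 i ≤ ⨆ i, 𝔴 i := le_iSup 𝔴
  exact sup_le (sup_le (sup_le (sup_le (hle 0) (hle 1)) (hle 2)) (hle 3)) (hle 4)

/-- Distinct summands are orthogonal for every symmetric form that is invariant under `h`. -/
lemma apply_eq_zero (hS : IsSplitGrading B z h m₁ m₂ h₁ h₂) {F : LinearMap.BilinForm ℝ L}
    (hF : ∀ x y, F x y = F y x) (hinv : ∀ x ∈ h, ∀ v v', F ⁅x, v⁆ v' = -F v ⁅x, v'⁆)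
    {k l : Fin 5} (hkl : k ≠ l) {v v' : L} (hv : v ∈ 𝔴 k) (hv' : v' ∈ 𝔴 l) : F v v' = 0 := by
  have sq : ∀ v v', F ⁅z, ⁅z, v⁆⁆ v' = F v ⁅z, ⁅z, v'⁆⁆ := fun v v' => by
    rw [hinv z hS.z_mem, hinv z hS.z_mem, neg_neg]
  have e1 : ∀ v ∈ h, ∀ v' ∈ m₁, F v v' = 0 := fun v hv v' hv' => by
    have := sq v v'
    rw [(hS.mem_h v).1 hv, (hS.mem_m₁ v').1 hv'] at this
    simpa using this
  have e2 : ∀ v ∈ h, ∀ v' ∈ m₂, F v v' = 0 := fun v hv v' hv' => by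
    have := sq v v'
    rw [(hS.mem_h v).1 hv, (hS.mem_m₂ v').1 hv'] at this
    simpa using this
  have e3 : ∀ v ∈ m₁, ∀ v' ∈ m₂, F v v' = 0 := fun v hv v' hv' => by
    have := sq v v'
    rw [(hS.mem_m₁ v).1 hv, (hS.mem_m₂ v').1 hv'] at this
    simp only [map_neg, map_smul, LinearMap.neg_apply, smul_eq_mul] at this
    linarith
  -- A simple ideal is orthogonal to everything it commutes with.
  have e4 : ∀ a : LieSubalgebra ℝ L, IsSimpleIdealOf a h → ∀ y, (∀ x ∈ a, ⁅x, y⁆ = 0) →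
      ∀ x ∈ a, F x y = 0 := fun a ha y hy x hx => by
    refine induction_simple ha.simple (p := fun x => F x y = 0) (fun p hp q hq => ?_) (by simp)
      (fun x y hx hy => by simp [hx, hy]) (fun c x hx => by simp [hx]) hx
    rw [hinv p (ha.le hp), hy p hp]
    simp
  have hz : ∀ y ∈ 𝔴 0, ∀ x ∈ h, ⁅x, y⁆ = 0 := fun y hy x hx => by
    obtain ⟨c, rfl⟩ := Submodule.mem_span_singleton.1 hy
    rw [lie_smul, ← lie_skew, (hS.mem_h x).1 hx, neg_zero, smul_zero]
  have main : ∀ k l : Fin 5, k < l → ∀ v ∈ 𝔴 k, ∀ v' ∈ 𝔴 l, F v v' = 0 := by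
    intro k l hlt v hv v' hv'
    by_cases hk3 : k = 3
    · have hl : l = 4 := by omega
      subst hk3 hl
      exact e3 v hv v' hv'
    have hvh : v ∈ h := hS.le_h hk3 (by omega) hv
    by_cases hl3 : l = 3
    · subst hl3
      exact e1 v hvh v' hv'
    by_cases hl4 : l = 4
    · subst hl4
      exact e2 v hvh v' hv'
    obtain ⟨rfl, rfl⟩ | ⟨rfl, rfl⟩ | ⟨rfl, rfl⟩ : k = 0 ∧ l = 1 ∨ k = 0 ∧ l = 2 ∨ k = 1 ∧ l = 2 := by
      omega
    · rw [hF]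
      exact e4 h₁ hS.ideal₁ v (fun x hx => hz v hv x (hS.ideal₁.le hx)) v' hv'
    · rw [hF]
      exact e4 h₂ hS.ideal₂ v (fun x hx => hz v hv x (hS.ideal₂.le hx)) v' hv'
    · exact e4 h₁ hS.ideal₁ v' (fun x hx => hS.lie_h₁_h₂ x hx v' hv') v hv
  rcases lt_or_gt_of_ne hkl with hlt | hlt
  · exact main k l hlt v hv v' hv'
  · rw [hF]
    exact main l k hlt v' hv' v hv

lemma orthogonal (hS : IsSplitGrading B z h m₁ m₂ h₁ h₂) (k l : Fin 5) (hkl : k ≠ l) :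
    ∀ v ∈ 𝔴 k, ∀ v' ∈ 𝔴 l, B v v' = 0 := fun _ hv _ hv' =>
  hS.apply_eq_zero hS.symm (fun x _ => hS.inv x) hkl hv hv'

variable [FiniteDimensional ℝ L]

lemma pform_inv (hS : IsSplitGrading B z h m₁ m₂ h₁ h₂) (i j : Fin 5) {x : L} (hx : x ∈ h)
    (v v' : L) : hS.pform (𝔴 i) (𝔴 j) ⁅x, v⁆ v' = -hS.pform (𝔴 i) (𝔴 j) v ⁅x, v'⁆ :=
  hS.pform_lie (fun _ hy => hS.lie_mem_summand hx i hy)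
    (fun _ hy => hS.lie_mem_summand hx j hy) v v'

lemma pform_off_diagonal (hS : IsSplitGrading B z h m₁ m₂ h₁ h₂) (i j : Fin 5) {k l : Fin 5}
    (hkl : k ≠ l) {v v' : L} (hv : v ∈ 𝔴 k) (hv' : v' ∈ 𝔴 l) :
    hS.pform (𝔴 i) (𝔴 j) v v' = 0 :=
  hS.apply_eq_zero (hS.pform_symm _ _) (fun _ hx => hS.pform_inv i j hx) hkl hv hv'

lemma pform_h_eq_zero (hS : IsSplitGrading B z h m₁ m₂ h₁ h₂) {v : L} (hv : v ∈ h) {i j : Fin 5}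
    (hij : i ≠ j) (v' : L) : hS.pform (𝔴 i) (𝔴 j) v v' = 0 :=
  hS.pform_eq_zero (fun _ hy _ hu => hS.orthogonal i j hij _ (hS.lie_mem_summand hv i hy) _ hu) v'

lemma pform_comm_eq_zero (hS : IsSplitGrading B z h m₁ m₂ h₁ h₂) {v : L} {i : Fin 5} (j : Fin 5)
    (hv : ∀ y ∈ 𝔴 i, ⁅v, y⁆ = 0) (v' : L) : hS.pform (𝔴 i) (𝔴 j) v v' = 0 :=
  hS.pform_eq_zero (fun y hy u _ => by rw [hv y hy]; simp) v'

lemma pform_m₁_eq_zero (hS : IsSplitGrading B z h m₁ m₂ h₁ h₂) {v : L} (hv : v ∈ m₁) {i j : Fin 5}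
    (hi : i ≠ 3) (hj : j ≠ 3) (v' : L) : hS.pform (𝔴 i) (𝔴 j) v v' = 0 :=
  hS.pform_eq_zero (fun _ hy _ hu =>
    hS.orthogonal 3 j hj.symm _ (hS.lie_mem_m₁ hv hi hy) _ hu) v'

lemma pform_m₁_m₁_eq_zero (hS : IsSplitGrading B z h m₁ m₂ h₁ h₂) {v : L} (hv : v ∈ m₁) (v' : L) :
    hS.pform (𝔴 3) (𝔴 3) v v' = 0 :=
  hS.pform_eq_zero (fun y hy u hu => by
    obtain ⟨a, ha, b, hb, hab⟩ := Submodule.mem_sup.1 (hS.lie_m₁_m₁ hv hy)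
    rw [← hab, map_add, LinearMap.add_apply, hS.orthogonal_h_m₁ ha hu, hS.symm b,
      hS.orthogonal_m₁_m₂ hu hb, add_zero]) v'

lemma pform_m₂_eq_zero (hS : IsSplitGrading B z h m₁ m₂ h₁ h₂) {v : L} (hv : v ∈ m₂) {i j : Fin 5}
    (hi : i ≠ 3) (hi' : i ≠ 4) (hj' : j ≠ 4) (v' : L) :
    hS.pform (𝔴 i) (𝔴 j) v v' = 0 :=
  hS.pform_eq_zero (fun y hy u hu => by
    refine hS.orthogonal 4 j hj'.symm _ ?_ _ hu
    rw [← lie_skew]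
    exact Submodule.neg_mem _ (hS.lie_h_m₂ (hS.le_h hi hi' hy) hv)) v'

lemma pform_m₂_m₂_eq_zero (hS : IsSplitGrading B z h m₁ m₂ h₁ h₂) {v : L} (hv : v ∈ m₂) (v' : L) :
    hS.pform (𝔴 4) (𝔴 4) v v' = 0 :=
  hS.pform_eq_zero (fun _ hy _ hu => hS.orthogonal_h_m₂ (hS.lie_m₂_m₂ hv hy) hu) v'

lemma pform_m₂_m₁_eq_zero (hS : IsSplitGrading B z h m₁ m₂ h₁ h₂) {v : L} (hv : v ∈ m₂) {j : Fin 5}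
    (hj : j ≠ 3) (v' : L) : hS.pform (𝔴 3) (𝔴 j) v v' = 0 :=
  hS.pform_eq_zero (fun y hy u hu => by
    refine hS.orthogonal 3 j hj.symm _ ?_ _ hu
    rw [← lie_skew]
    exact Submodule.neg_mem _ (hS.lie_m₁_m₂ hy hv)) v'

/-- A weighted sum of partial Killing forms on `h` involves the diagonal ones only. -/
lemma sum_h (hS : IsSplitGrading B z h m₁ m₂ h₁ h₂) (f : Fin 5 → Fin 5 → ℝ) {v : L} (hv : v ∈ h)
    (v' : L) : ∑ i, ∑ j, f i j * hS.pform (𝔴 i) (𝔴 j) v v' =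
      ∑ i, f i i * hS.pform (𝔴 i) (𝔴 i) v v' := by
  refine Finset.sum_congr rfl fun i _ => ?_
  refine Finset.sum_eq_single_of_mem i (Finset.mem_univ i) fun j _ hj => ?_
  rw [hS.pform_h_eq_zero hv hj.symm, mul_zero]

lemma sum_z (hS : IsSplitGrading B z h m₁ m₂ h₁ h₂) (f : Fin 5 → Fin 5 → ℝ) {v : L} (hv : v ∈ 𝔴 0)
    (v' : L) : ∑ i, ∑ j, f i j * hS.pform (𝔴 i) (𝔴 j) v v' =
      f 3 3 * hS.pform (𝔴 3) (𝔴 3) v v' + f 4 4 * hS.pform (𝔴 4) (𝔴 4) v v' := by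
  have hc : ∀ i : Fin 5, i ≠ 3 → i ≠ 4 → ∀ y ∈ 𝔴 i, ⁅v, y⁆ = 0 := fun i h3 h4 y hy => by
    obtain ⟨c, rfl⟩ := Submodule.mem_span_singleton.1 hv
    rw [smul_lie, (hS.mem_h y).1 (hS.le_h h3 h4 hy), smul_zero]
  rw [hS.sum_h f (hS.le_h (by decide) (by decide) hv), Fin.sum_univ_five,
    hS.pform_comm_eq_zero 0 (hc 0 (by decide) (by decide)),
    hS.pform_comm_eq_zero 1 (hc 1 (by decide) (by decide)),
    hS.pform_comm_eq_zero 2 (hc 2 (by decide) (by decide))]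
  ring

lemma sum_h₁ (hS : IsSplitGrading B z h m₁ m₂ h₁ h₂) (f : Fin 5 → Fin 5 → ℝ) {v : L} (hv : v ∈ 𝔴 1)
    (v' : L) : ∑ i, ∑ j, f i j * hS.pform (𝔴 i) (𝔴 j) v v' =
      f 1 1 * hS.pform (𝔴 1) (𝔴 1) v v' + f 3 3 * hS.pform (𝔴 3) (𝔴 3) v v' +
        f 4 4 * hS.pform (𝔴 4) (𝔴 4) v v' := by
  have hvh : v ∈ h := hS.ideal₁.le hv
  rw [hS.sum_h f hvh, Fin.sum_univ_five, hS.pform_comm_eq_zero 0 (i := 0) fun y hy => by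
      obtain ⟨c, rfl⟩ := Submodule.mem_span_singleton.1 hy
      rw [lie_smul, ← lie_skew, (hS.mem_h v).1 hvh, neg_zero, smul_zero],
    hS.pform_comm_eq_zero 2 (i := 2) fun y hy => hS.lie_h₁_h₂ v hv y hy]
  ring

lemma sum_h₂ (hS : IsSplitGrading B z h m₁ m₂ h₁ h₂) (f : Fin 5 → Fin 5 → ℝ) {v : L} (hv : v ∈ 𝔴 2)
    (v' : L) : ∑ i, ∑ j, f i j * hS.pform (𝔴 i) (𝔴 j) v v' =
      f 2 2 * hS.pform (𝔴 2) (𝔴 2) v v' + f 3 3 * hS.pform (𝔴 3) (𝔴 3) v v' := by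
  have hvh : v ∈ h := hS.ideal₂.le hv
  rw [hS.sum_h f hvh, Fin.sum_univ_five, hS.pform_comm_eq_zero 0 (i := 0) fun y hy => by
      obtain ⟨c, rfl⟩ := Submodule.mem_span_singleton.1 hy
      rw [lie_smul, ← lie_skew, (hS.mem_h v).1 hvh, neg_zero, smul_zero],
    hS.pform_comm_eq_zero 1 (i := 1) fun y hy => by
      rw [← lie_skew, hS.lie_h₁_h₂ y hy v hv, neg_zero],
    hS.pform_comm_eq_zero 4 (i := 4) fun y hy => hS.lie_h₂_m₂ v hv y hy]
  ring

/-- The only partial Killing forms that do not vanish on `m₁` involve `m₁` and another summand. -/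
lemma sum_m₁ (hS : IsSplitGrading B z h m₁ m₂ h₁ h₂) (f : Fin 5 → Fin 5 → ℝ)
    (hf : ∀ i j, f i j = f j i) {v : L} (hv : v ∈ 𝔴 3) (v' : L) :
    ∑ i, ∑ j, f i j * hS.pform (𝔴 i) (𝔴 j) v v' =
      2 * (f 0 3 * hS.pform (𝔴 0) (𝔴 3) v v' + f 1 3 * hS.pform (𝔴 1) (𝔴 3) v v' +
        f 2 3 * hS.pform (𝔴 2) (𝔴 3) v v' + f 3 4 * hS.pform (𝔴 3) (𝔴 4) v v') := by
  have e : ∀ i j : Fin 5, i ≠ 3 → j ≠ 3 → hS.pform (𝔴 i) (𝔴 j) v v' = 0 := fun i j hi hj =>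
    hS.pform_m₁_eq_zero hv hi hj v'
  simp only [Fin.sum_univ_five]
  rw [e 0 0, e 0 1, e 0 2, e 0 4, e 1 0, e 1 1, e 1 2, e 1 4, e 2 0, e 2 1, e 2 2, e 2 4, e 4 0,
    e 4 1, e 4 2, e 4 4, hS.pform_m₁_m₁_eq_zero hv, hS.pform_swap (𝔴 3) (𝔴 0),
    hS.pform_swap (𝔴 3) (𝔴 1), hS.pform_swap (𝔴 3) (𝔴 2), hS.pform_swap (𝔴 4) (𝔴 3),
    hf 3 0, hf 3 1, hf 3 2, hf 4 3]
  · ring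
  all_goals decide

/-- On `m₂` there remain the form of `m₁`, and those that involve `m₂` and `h₀` or `h₁`. -/
lemma sum_m₂ (hS : IsSplitGrading B z h m₁ m₂ h₁ h₂) (f : Fin 5 → Fin 5 → ℝ)
    (hf : ∀ i j, f i j = f j i) {v : L} (hv : v ∈ 𝔴 4) (v' : L) :
    ∑ i, ∑ j, f i j * hS.pform (𝔴 i) (𝔴 j) v v' =
      f 3 3 * hS.pform (𝔴 3) (𝔴 3) v v' + 2 * (f 0 4 * hS.pform (𝔴 0) (𝔴 4) v v' +
        f 1 4 * hS.pform (𝔴 1) (𝔴 4) v v') := by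
  have e : ∀ i j : Fin 5, i ≠ 3 → i ≠ 4 → j ≠ 4 → hS.pform (𝔴 i) (𝔴 j) v v' = 0 :=
    fun i j hi hi' hj => hS.pform_m₂_eq_zero hv hi hi' hj v'
  have e3 : ∀ j : Fin 5, j ≠ 3 → hS.pform (𝔴 3) (𝔴 j) v v' = 0 := fun j hj =>
    hS.pform_m₂_m₁_eq_zero hv hj v'
  have e2 : hS.pform (𝔴 2) (𝔴 4) v v' = 0 := hS.pform_comm_eq_zero 4 (fun y hy => by
    rw [← lie_skew, hS.lie_h₂_m₂ y hy v hv, neg_zero]) v'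
  simp only [Fin.sum_univ_five]
  rw [hS.pform_swap (𝔴 4) (𝔴 3), e 0 0, e 0 1, e 0 2, e 0 3, e 1 0, e 1 1, e 1 2, e 1 3, e 2 0,
    e 2 1, e 2 2, e 2 3, e3 0, e3 1, e3 2, e3 4, hS.pform_swap (𝔴 4) (𝔴 0),
    hS.pform_swap (𝔴 4) (𝔴 1), hS.pform_swap (𝔴 4) (𝔴 2), e2, hS.pform_m₂_m₂_eq_zero hv,
    hf 4 0, hf 4 1]
  · ring
  all_goals decide

end IsSplitGrading

end Constants

/-! ### The partial Killing forms in terms of dimensions -/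

section Constants

variable {L : Type*} [LieRing L] [LieAlgebra ℝ L]
  {B : LinearMap.BilinForm ℝ L} {z : L} {h m₁ m₂ : Submodule ℝ L} {h₁ h₂ : LieSubalgebra ℝ L}

namespace IsSplitGrading

local notation "𝔴" => splitSummands z m₁ m₂ h₁ h₂

lemma form_lie_z_m₁ (hS : IsSplitGrading B z h m₁ m₂ h₁ h₂) {v : L} (hv : v ∈ m₁) (v' : L) :
    B ⁅z, v⁆ ⁅z, v'⁆ = B v v' := by
  rw [hS.symm, hS.inv, (hS.mem_m₁ v).1 hv, map_neg, neg_neg, hS.symm]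

lemma form_lie_z_m₂ (hS : IsSplitGrading B z h m₁ m₂ h₁ h₂) {v : L} (hv : v ∈ m₂) (v' : L) :
    B ⁅z, v⁆ ⁅z, v'⁆ = 4 * B v v' := by
  rw [hS.symm, hS.inv, (hS.mem_m₂ v).1 hv, map_neg, neg_neg, map_smul, hS.symm, smul_eq_mul]

lemma form_z_z_pos (hS : IsSplitGrading B z h m₁ m₂ h₁ h₂) : 0 < B z z := hS.pos z hS.z_ne_zero

variable [FiniteDimensional ℝ L]

/-- The partial Killing forms add up to the negative of the Killing form. The factor `1` brings the
sum into the shape of a weighted sum. -/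
lemma total (hS : IsSplitGrading B z h m₁ m₂ h₁ h₂) (hK : ∀ x y, B x y = -killingForm ℝ L x y)
    (v v' : L) : ∑ i, ∑ j, (1 : ℝ) * hS.pform (𝔴 i) (𝔴 j) v v' = B v v' := by
  simp only [one_mul]
  rw [hS.sum_pform hS.orthogonal hS.iSup_summands, hK]

lemma pform_m₁_z (hS : IsSplitGrading B z h m₁ m₂ h₁ h₂) :
    hS.pform (𝔴 3) (𝔴 3) z z = Module.finrank ℝ m₁ := by
  rw [hS.pform_apply_single, Finset.sum_congr rfl fun b _ => by
    have hb : (hS.onb (𝔴 3) b : L) ∈ m₁ := (hS.onb (𝔴 3) b).2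
    rw [hS.proj_eq_self (hS.lie_mem_summand hS.z_mem 3 (hS.onb (𝔴 3) b).2),
      hS.form_lie_z_m₁ hb, hS.onb_apply, if_pos rfl]]
  rw [Finset.sum_const, Finset.card_univ, Fintype.card_fin, nsmul_eq_mul, mul_one]
  rfl

lemma pform_m₂_z (hS : IsSplitGrading B z h m₁ m₂ h₁ h₂) :
    hS.pform (𝔴 4) (𝔴 4) z z = 4 * Module.finrank ℝ m₂ := by
  rw [hS.pform_apply_single, Finset.sum_congr rfl fun b _ => by
    have hb : (hS.onb (𝔴 4) b : L) ∈ m₂ := (hS.onb (𝔴 4) b).2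
    rw [hS.proj_eq_self (hS.lie_mem_summand hS.z_mem 4 (hS.onb (𝔴 4) b).2),
      hS.form_lie_z_m₂ hb, hS.onb_apply, if_pos rfl]]
  rw [Finset.sum_const, Finset.card_univ, Fintype.card_fin, nsmul_eq_mul, mul_one, mul_comm]
  rfl

lemma form_z_z (hS : IsSplitGrading B z h m₁ m₂ h₁ h₂) (hK : ∀ x y, B x y = -killingForm ℝ L x y) :
    B z z = Module.finrank ℝ m₁ + 4 * Module.finrank ℝ m₂ := by
  have := hS.total hK z z
  rw [hS.sum_z _ z_mem_summand, hS.pform_m₁_z, hS.pform_m₂_z] at this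
  linarith

/-- The trace form of `m₁` is a multiple of `B` on `h₁` and on `m₂`, with the constant determined by
`z`. Indeed the vectors `v` for which `tr (ad v ∘ ad y)` on `m₁` is that multiple of `B v y` for all
`y ∈ h + m₂` form an ideal of `h + m₂` that contains `z`. It contains `m₂ = [z, m₂]`, and it meets
`h₁` since `h₁` acts nontrivially on `m₂`; hence it contains the simple ideal `h₁`. -/
lemma pform_m₁_m₁ (hS : IsSplitGrading B z h m₁ m₂ h₁ h₂) :
    (∀ v ∈ 𝔴 1, ∀ v' ∈ 𝔴 1,
      hS.pform (𝔴 3) (𝔴 3) v v' = Module.finrank ℝ m₁ / B z z * B v v') ∧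
    (∀ v ∈ 𝔴 4, ∀ v' ∈ 𝔴 4,
      hS.pform (𝔴 3) (𝔴 3) v v' = Module.finrank ℝ m₁ / B z z * B v v') := by
  have hD := hS.form_z_z_pos.ne'
  set F := hS.pform (𝔴 3) (𝔴 3) with hF
  set c : ℝ := Module.finrank ℝ m₁ / B z z with hc
  let E : Submodule ℝ L :=
    { carrier := {v | ∀ y ∈ h ⊔ m₂, F v y = c * B v y}
      add_mem' := fun {a b} ha hb y hy => by
        simp only [map_add, LinearMap.add_apply, ha y hy, hb y hy]
        ring
      zero_mem' := fun y _ => by simp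
      smul_mem' := fun r a ha y hy => by
        simp only [map_smul, LinearMap.smul_apply, smul_eq_mul, ha y hy]
        ring }
  have lie_k : ∀ x ∈ h ⊔ m₂, ∀ y ∈ h ⊔ m₂, ⁅x, y⁆ ∈ h ⊔ m₂ := by
    intro x hx y hy
    obtain ⟨a, ha, b, hb, rfl⟩ := Submodule.mem_sup.1 hx
    obtain ⟨a', ha', b', hb', rfl⟩ := Submodule.mem_sup.1 hy
    simp only [add_lie, lie_add]
    refine Submodule.add_mem _ (Submodule.add_mem _ ?_ ?_) (Submodule.add_mem _ ?_ ?_)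
    · exact Submodule.mem_sup_left (hS.lie_h_h ha ha')
    · rw [← lie_skew]
      exact Submodule.neg_mem _ (Submodule.mem_sup_right (hS.lie_h_m₂ ha' hb))
    · exact Submodule.mem_sup_right (hS.lie_h_m₂ ha hb')
    · exact Submodule.mem_sup_left (hS.lie_m₂_m₂ hb hb')
  have lie_m : ∀ x ∈ h ⊔ m₂, ∀ y ∈ m₁, ⁅x, y⁆ ∈ m₁ := by
    intro x hx y hy
    obtain ⟨a, ha, b, hb, rfl⟩ := Submodule.mem_sup.1 hx
    rw [add_lie]
    refine m₁.add_mem (hS.lie_h_m₁ ha hy) ?_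
    rw [← lie_skew]
    exact m₁.neg_mem (hS.lie_m₁_m₂ hy hb)
  have hE : ∀ x ∈ h ⊔ m₂, ∀ y ∈ E, ⁅x, y⁆ ∈ E := by
    intro x hx y hy u hu
    have hxm : ∀ y ∈ 𝔴 3, ⁅x, y⁆ ∈ 𝔴 3 := fun y hy => lie_m x hx y hy
    rw [hF, hS.pform_lie hxm hxm, ← hF, hy _ (lie_k x hx u hu), hS.inv]
    ring
  have hhk : h ≤ h ⊔ m₂ := le_sup_left
  have hmk : m₂ ≤ h ⊔ m₂ := le_sup_right
  -- The summands of `h + m₂` other than the line of `z` are orthogonal to `z` for both forms.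
  have hzE : z ∈ E := by
    have hker : h ⊔ m₂ ≤ LinearMap.ker (F z - c • B z) := by
      rw [← hS.span_h]
      refine sup_le (sup_le (sup_le ?_ ?_) ?_) ?_
      · rw [Submodule.span_singleton_le_iff_mem, LinearMap.mem_ker, LinearMap.sub_apply,
          LinearMap.smul_apply, hF, hS.pform_m₁_z, hc, smul_eq_mul]
        field_simp
        simp
      all_goals
        intro y hy
        rw [LinearMap.mem_ker, LinearMap.sub_apply, LinearMap.smul_apply, hF]
      · rw [hS.pform_off_diagonal 3 3 (k := 0) (l := 1) (by decide) z_mem_summand hy,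
          hS.orthogonal 0 1 (by decide) z z_mem_summand y hy, smul_zero, sub_zero]
      · rw [hS.pform_off_diagonal 3 3 (k := 0) (l := 2) (by decide) z_mem_summand hy,
          hS.orthogonal 0 2 (by decide) z z_mem_summand y hy, smul_zero, sub_zero]
      · rw [hS.pform_off_diagonal 3 3 (k := 0) (l := 4) (by decide) z_mem_summand hy,
          hS.orthogonal 0 4 (by decide) z z_mem_summand y hy, smul_zero, sub_zero]
    exact fun y hy => sub_eq_zero.1 (hker hy)
  have hmE : m₂ ≤ E := fun y hy => by
    have h1 : ⁅⁅z, y⁆, z⁆ ∈ E := hE _ (hmk (hS.lie_z_m₂ hy)) z hzE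
    have h2 : y = (4 : ℝ)⁻¹ • ⁅⁅z, y⁆, z⁆ := by
      rw [← lie_skew, (hS.mem_m₂ y).1 hy]
      module
    rw [h2]
    exact E.smul_mem _ h1
  have h1E : h₁.toSubmodule ≤ E := by
    have hsub : E ⊓ h₁.toSubmodule ≤ h₁.toSubmodule := inf_le_right
    rcases eq_bot_or_eq_of_simple hS.ideal₁.simple (E ⊓ h₁.toSubmodule) hsub
      (fun x hx y hy => ⟨hE x (hhk (hS.ideal₁.le hx)) y hy.1, h₁.lie_mem hx hy.2⟩) with hbot | htop
    · exfalso
      obtain ⟨x, hx, y, hy, hxy⟩ := hS.exists_lie_ne_zero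
      set u := ⁅y, ⁅x, y⁆⁆ with hu
      have hxy2 : ⁅x, y⁆ ∈ m₂ := hS.lie_h_m₂ (hS.ideal₁.le hx) hy
      have huE : u ∈ E := hE _ (hmk hy) _ (hmE hxy2)
      have huh : u ∈ h := hS.lie_m₂_m₂ hy hxy2
      -- The component of `u` in `h₁` is not zero since `u` is not orthogonal to `x`.
      have hBu : B u x ≠ 0 := by
        have : B u x = B ⁅x, y⁆ ⁅x, y⁆ := by
          rw [hu, hS.inv, ← lie_skew y x, map_neg, neg_neg]
        rw [this]
        exact (hS.pos _ hxy).ne'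
      rw [← hS.span_h] at huh
      obtain ⟨p, hp, b, hb, hpb⟩ := Submodule.mem_sup.1 huh
      obtain ⟨q, hq, a, ha, rfl⟩ := Submodule.mem_sup.1 hp
      obtain ⟨r, rfl⟩ := Submodule.mem_span_singleton.1 hq
      have hb0 : b = 0 := by
        refine hS.eq_zero ?_
        have e1 : B u b = 0 := by
          have : ⁅y, b⁆ = 0 := by rw [← lie_skew, hS.lie_h₂_m₂ b hb y hy, neg_zero]
          rw [hu, hS.inv, this, map_zero, neg_zero]
        rw [← hpb, map_add, map_add, map_smul, LinearMap.add_apply, LinearMap.add_apply,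
          LinearMap.smul_apply, hS.orthogonal 0 2 (by decide) z z_mem_summand b hb,
          hS.orthogonal 1 2 (by decide) a ha b hb] at e1
        simpa using e1
      have haE : a ∈ E := by
        have : a = u - r • z := by rw [← hpb, hb0]; abel
        rw [this]
        exact E.sub_mem huE (E.smul_mem r hzE)
      have ha0 : a = 0 := (Submodule.mem_bot ℝ).1 (hbot ▸ (⟨haE, ha⟩ : a ∈ E ⊓ h₁.toSubmodule))
      apply hBu
      rw [← hpb, hb0, ha0, add_zero, add_zero, map_smul, LinearMap.smul_apply,
        hS.orthogonal 0 1 (by decide) z z_mem_summand x hx, smul_zero]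
    · exact htop ▸ inf_le_left
  exact ⟨fun v hv v' hv' => h1E hv v' (hhk (hS.ideal₁.le hv')),
    fun v hv v' hv' => hmE hv v' (hmk hv')⟩

/-- A quadratic function on the line `ℝ z` summed over an orthonormal basis of the line. -/
lemma sum_onb_z (hS : IsSplitGrading B z h m₁ m₂ h₁ h₂) {c : ℝ} (G : L → ℝ)
    (hG : ∀ r : ℝ, G (r • z) = r ^ 2 * c) : ∑ b, G (hS.onb (𝔴 0) b) = c / B z z := by
  have hD := hS.form_z_z_pos.ne'
  have e : ∀ b, G (hS.onb (𝔴 0) b) = c / B z z := fun b => by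
    obtain ⟨r, hr⟩ := Submodule.mem_span_singleton.1 (hS.onb (𝔴 0) b).2
    have h1 := hS.onb_apply (𝔴 0) b b
    rw [if_pos rfl, ← hr] at h1
    simp only [map_smul, LinearMap.smul_apply, smul_eq_mul] at h1
    rw [← hr, hG]
    field_simp
    linear_combination c * h1
  rw [Finset.sum_congr rfl fun b _ => e b]
  have : Module.finrank ℝ (𝔴 0) = 1 := finrank_span_singleton hS.z_ne_zero
  simp [this]

lemma pform_z_m₁ (hS : IsSplitGrading B z h m₁ m₂ h₁ h₂) {v v' : L} (hv : v ∈ 𝔴 3)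
    (hv' : v' ∈ 𝔴 3) : hS.pform (𝔴 0) (𝔴 3) v v' = 1 / B z z * B v v' := by
  rw [hS.pform_swap, hS.pform_apply_single, hS.sum_onb_z (c := B v v')
    (fun e => B ⁅v, e⁆ (hS.proj (𝔴 3) ⁅v', e⁆)) fun r => ?_]
  · ring
  have hm : ⁅v', z⁆ ∈ 𝔴 3 := by
    rw [← lie_skew]
    exact Submodule.neg_mem _ (hS.lie_z_m₁ hv')
  simp only [lie_smul, map_smul, LinearMap.smul_apply, smul_eq_mul]
  rw [hS.proj_eq_self hm, ← lie_skew v z, ← lie_skew v' z, map_neg, map_neg, LinearMap.neg_apply,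
    neg_neg, hS.form_lie_z_m₁ hv]
  ring

lemma pform_z_m₂ (hS : IsSplitGrading B z h m₁ m₂ h₁ h₂) {v v' : L} (hv : v ∈ 𝔴 4)
    (hv' : v' ∈ 𝔴 4) : hS.pform (𝔴 0) (𝔴 4) v v' = 4 / B z z * B v v' := by
  rw [hS.pform_swap, hS.pform_apply_single, hS.sum_onb_z (c := 4 * B v v')
    (fun e => B ⁅v, e⁆ (hS.proj (𝔴 4) ⁅v', e⁆)) fun r => ?_]
  · ring
  have hm : ⁅v', z⁆ ∈ 𝔴 4 := by
    rw [← lie_skew]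
    exact Submodule.neg_mem _ (hS.lie_z_m₂ hv')
  simp only [lie_smul, map_smul, LinearMap.smul_apply, smul_eq_mul]
  rw [hS.proj_eq_self hm, ← lie_skew v z, ← lie_skew v' z, map_neg, map_neg, LinearMap.neg_apply,
    neg_neg, hS.form_lie_z_m₂ hv]
  ring

lemma exists_scalar_simple (hS : IsSplitGrading B z h m₁ m₂ h₁ h₂) {a : LieSubalgebra ℝ L}
    (ha : IsSimpleIdealOf a h) (i j : Fin 5) : ∃ c : ℝ, ∀ v ∈ a.toSubmodule, ∀ v' ∈ a.toSubmodule,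
      hS.pform (𝔴 i) (𝔴 j) v v' = c * B v v' :=
  hS.exists_scalar (h := a.toSubmodule) (fun _ hx _ hy => a.lie_mem hx hy)
    (eq_bot_or_eq_of_simple ha.simple) _ (hS.pform_symm _ _)
    fun _ hx => hS.pform_inv i j (ha.le hx)

lemma exists_scalar_m₁ (hS : IsSplitGrading B z h m₁ m₂ h₁ h₂) (i j : Fin 5) :
    ∃ c : ℝ, ∀ v ∈ 𝔴 3, ∀ v' ∈ 𝔴 3, hS.pform (𝔴 i) (𝔴 j) v v' = c * B v v' :=
  hS.exists_scalar (h := h) (fun _ hx _ hy => hS.lie_h_m₁ hx hy) hS.irreducible _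
    (hS.pform_symm _ _) fun _ hx => hS.pform_inv i j hx

/-- The partial Killing forms on `m₁`. The one that involves `h₂` is what is left of `B`. -/
lemma pform_on_m₁ (hS : IsSplitGrading B z h m₁ m₂ h₁ h₂)
    (hK : ∀ x y, B x y = -killingForm ℝ L x y) {d₁ d₃ d₄ D : ℝ}
    (hd₁ : d₁ = Module.finrank ℝ h₁) (hd₃ : d₃ = Module.finrank ℝ m₁)
    (hd₄ : d₄ = Module.finrank ℝ m₂) (hD : D = d₃ + 4 * d₄) {v v' : L} (hv : v ∈ 𝔴 3)
    (hv' : v' ∈ 𝔴 3) :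
    hS.pform (𝔴 0) (𝔴 3) v v' = 1 / D * B v v' ∧ hS.pform (𝔴 1) (𝔴 3) v v' = d₁ / D * B v v' ∧
    hS.pform (𝔴 2) (𝔴 3) v v' = (d₃ + 2 * d₄ - 2 * d₁ - 2) / (2 * D) * B v v' ∧
    hS.pform (𝔴 3) (𝔴 4) v v' = d₄ / D * B v v' := by
  have hDz : B z z = D := by rw [hS.form_z_z hK, hD, hd₃, hd₄]
  have hD0 : D ≠ 0 := hDz ▸ hS.form_z_z_pos.ne'
  have h33 := hS.pform_m₁_m₁
  rw [hDz, ← hd₃] at h33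
  have hd30 : d₃ ≠ 0 := by
    rw [hd₃]
    exact_mod_cast Nat.one_le_iff_ne_zero.1 (Submodule.one_le_finrank_iff.2 hS.m₁_ne_bot)
  obtain ⟨p1, hp1⟩ := hS.exists_scalar_m₁ 1 3
  obtain ⟨p4, hp4⟩ := hS.exists_scalar_m₁ 3 4
  -- The constants follow from the symmetry of the traces.
  have e1 : p1 * d₃ = d₃ / D * d₁ := by
    rw [hd₃, hd₁]
    refine (hS.ptrace_eq hp1).symm.trans ?_
    rw [hS.ptrace_swap_left, hS.ptrace_swap_right, ← hd₃]
    exact hS.ptrace_eq h33.1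
  have e4 : p4 * d₃ = d₃ / D * d₄ := by
    rw [hd₃, hd₄]
    refine (hS.ptrace_eq hp4).symm.trans ?_
    rw [hS.ptrace_swap_right, ← hd₃]
    exact hS.ptrace_eq h33.2
  have e1' : p1 = d₁ / D := by
    refine mul_right_cancel₀ hd30 (e1.trans ?_)
    ring
  have e4' : p4 = d₄ / D := by
    refine mul_right_cancel₀ hd30 (e4.trans ?_)
    ring
  have q0 := hS.pform_z_m₁ hv hv'
  rw [hDz] at q0
  have q1 := hp1 v hv v' hv'
  have q4 := hp4 v hv v' hv'
  rw [e1'] at q1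
  rw [e4'] at q4
  refine ⟨q0, q1, ?_, q4⟩
  have ht := hS.total hK v v'
  rw [hS.sum_m₁ _ (fun _ _ => rfl) hv, q0, q1, q4] at ht
  have : hS.pform (𝔴 2) (𝔴 3) v v' = B v v' / 2 - (1 / D * B v v' + d₁ / D * B v v' +
    d₄ / D * B v v') := by linarith
  rw [this]
  field_simp
  rw [hD]
  ring

/-- The partial Killing forms on `m₂`: the first two are known directly, the third one is what is
left of `B`. -/
lemma pform_on_m₂ (hS : IsSplitGrading B z h m₁ m₂ h₁ h₂)
    (hK : ∀ x y, B x y = -killingForm ℝ L x y) {d₃ d₄ D : ℝ} (hd₃ : d₃ = Module.finrank ℝ m₁)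
    (hd₄ : d₄ = Module.finrank ℝ m₂) (hD : D = d₃ + 4 * d₄) {v v' : L} (hv : v ∈ 𝔴 4)
    (hv' : v' ∈ 𝔴 4) :
    hS.pform (𝔴 3) (𝔴 3) v v' = d₃ / D * B v v' ∧ hS.pform (𝔴 0) (𝔴 4) v v' = 4 / D * B v v' ∧
    hS.pform (𝔴 1) (𝔴 4) v v' = 2 * (d₄ - 2) / D * B v v' := by
  have hDz : B z z = D := by rw [hS.form_z_z hK, hD, hd₃, hd₄]
  have hD0 : D ≠ 0 := hDz ▸ hS.form_z_z_pos.ne'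
  have q3 := hS.pform_m₁_m₁.2 v hv v' hv'
  have q0 := hS.pform_z_m₂ hv hv'
  rw [hDz, ← hd₃] at q3
  rw [hDz] at q0
  refine ⟨q3, q0, ?_⟩
  have ht := hS.total hK v v'
  rw [hS.sum_m₂ _ (fun _ _ => rfl) hv, q0, q3] at ht
  have : hS.pform (𝔴 1) (𝔴 4) v v' = (B v v' - d₃ / D * B v v') / 2 - 4 / D * B v v' := by linarith
  rw [this]
  field_simp
  rw [hD]
  ring

lemma finrank_ne_zero_of_simple {a : LieSubalgebra ℝ L} (ha : LieAlgebra.IsSimple ℝ a) :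
    (Module.finrank ℝ a : ℝ) ≠ 0 := by
  obtain ⟨x, y, hxy⟩ := KaehlerC.exists_lie_ne_zero ha
  have : Nontrivial a := ⟨_, _, hxy⟩
  exact_mod_cast (Module.finrank_pos (R := ℝ) (M := a)).ne'

/-- The partial Killing forms on `h₁`. That of `m₂` has the same trace as the form on `m₂` that
involves `h₁`. -/
lemma pform_on_h₁ (hS : IsSplitGrading B z h m₁ m₂ h₁ h₂)
    (hK : ∀ x y, B x y = -killingForm ℝ L x y) {d₁ d₃ d₄ D : ℝ}
    (hd₁ : d₁ = Module.finrank ℝ h₁) (hd₃ : d₃ = Module.finrank ℝ m₁)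
    (hd₄ : d₄ = Module.finrank ℝ m₂) (hD : D = d₃ + 4 * d₄) {v v' : L} (hv : v ∈ 𝔴 1)
    (hv' : v' ∈ 𝔴 1) :
    hS.pform (𝔴 1) (𝔴 1) v v' = 2 * d₄ * (2 * d₁ + 2 - d₄) / (d₁ * D) * B v v' ∧
    hS.pform (𝔴 3) (𝔴 3) v v' = d₃ / D * B v v' ∧
    hS.pform (𝔴 4) (𝔴 4) v v' = 2 * d₄ * (d₄ - 2) / (d₁ * D) * B v v' := by
  have hDz : B z z = D := by rw [hS.form_z_z hK, hD, hd₃, hd₄]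
  have hD0 : D ≠ 0 := hDz ▸ hS.form_z_z_pos.ne'
  have hd10 : d₁ ≠ 0 := hd₁ ▸ finrank_ne_zero_of_simple hS.ideal₁.simple
  have q3 := hS.pform_m₁_m₁.1 v hv v' hv'
  rw [hDz, ← hd₃] at q3
  obtain ⟨b, hb⟩ := hS.exists_scalar_simple hS.ideal₁ 4 4
  have e : b * d₁ = 2 * (d₄ - 2) / D * d₄ := by
    rw [hd₁]
    refine (hS.ptrace_eq hb).symm.trans ?_
    rw [hS.ptrace_swap_right, hS.ptrace_swap_left]
    have := hS.ptrace_eq (W₁ := 𝔴 1) (W₂ := 𝔴 4) (W₃ := 𝔴 4) fun v hv v' hv' =>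
      (hS.pform_on_m₂ hK hd₃ hd₄ hD hv hv').2.2
    rw [hd₄] at this ⊢
    exact this
  have hb' : b = 2 * d₄ * (d₄ - 2) / (d₁ * D) := by
    refine mul_right_cancel₀ hd10 (e.trans ?_)
    field_simp
  have q4 := hb v hv v' hv'
  rw [hb'] at q4
  refine ⟨?_, q3, q4⟩
  have ht := hS.total hK v v'
  rw [hS.sum_h₁ _ hv, q3, q4] at ht
  have : hS.pform (𝔴 1) (𝔴 1) v v' = B v v' - d₃ / D * B v v' -
    2 * d₄ * (d₄ - 2) / (d₁ * D) * B v v' := by linarith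
  rw [this]
  field_simp
  rw [hD]
  ring

/-- The partial Killing forms on `h₂`. That of `m₁` has the same trace as the form on `m₁` that
involves `h₂`. -/
lemma pform_on_h₂ (hS : IsSplitGrading B z h m₁ m₂ h₁ h₂)
    (hK : ∀ x y, B x y = -killingForm ℝ L x y) {d₁ d₂ d₃ d₄ D : ℝ}
    (hd₁ : d₁ = Module.finrank ℝ h₁) (hd₂ : d₂ = Module.finrank ℝ h₂)
    (hd₃ : d₃ = Module.finrank ℝ m₁)
    (hd₄ : d₄ = Module.finrank ℝ m₂) (hD : D = d₃ + 4 * d₄) {v v' : L} (hv : v ∈ 𝔴 2)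
    (hv' : v' ∈ 𝔴 2) :
    hS.pform (𝔴 2) (𝔴 2) v v' =
      (1 - d₃ * (d₃ + 2 * d₄ - 2 * d₁ - 2) / (2 * d₂ * D)) * B v v' ∧
    hS.pform (𝔴 3) (𝔴 3) v v' = d₃ * (d₃ + 2 * d₄ - 2 * d₁ - 2) / (2 * d₂ * D) * B v v' := by
  have hDz : B z z = D := by rw [hS.form_z_z hK, hD, hd₃, hd₄]
  have hD0 : D ≠ 0 := hDz ▸ hS.form_z_z_pos.ne'
  have hd20 : d₂ ≠ 0 := hd₂ ▸ finrank_ne_zero_of_simple hS.ideal₂.simple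
  obtain ⟨b, hb⟩ := hS.exists_scalar_simple hS.ideal₂ 3 3
  have e : b * d₂ = (d₃ + 2 * d₄ - 2 * d₁ - 2) / (2 * D) * d₃ := by
    rw [hd₂]
    refine (hS.ptrace_eq hb).symm.trans ?_
    rw [hS.ptrace_swap_right, hS.ptrace_swap_left]
    have := hS.ptrace_eq (W₁ := 𝔴 2) (W₂ := 𝔴 3) (W₃ := 𝔴 3) fun v hv v' hv' =>
      (hS.pform_on_m₁ hK hd₁ hd₃ hd₄ hD hv hv').2.2.1
    rw [hd₃] at this ⊢
    exact this
  have hb' : b = d₃ * (d₃ + 2 * d₄ - 2 * d₁ - 2) / (2 * d₂ * D) := by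
    refine mul_right_cancel₀ hd20 (e.trans ?_)
    field_simp
  have q3 := hb v hv v' hv'
  rw [hb'] at q3
  refine ⟨?_, q3⟩
  have ht := hS.total hK v v'
  rw [hS.sum_h₂ _ hv, q3] at ht
  linarith

/-- The partial Killing forms on the center. -/
lemma pform_on_z (hS : IsSplitGrading B z h m₁ m₂ h₁ h₂)
    (hK : ∀ x y, B x y = -killingForm ℝ L x y) {d₃ d₄ D : ℝ}
    (hd₃ : d₃ = Module.finrank ℝ m₁) (hd₄ : d₄ = Module.finrank ℝ m₂) (hD : D = d₃ + 4 * d₄)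
    {v v' : L} (hv : v ∈ 𝔴 0) (hv' : v' ∈ 𝔴 0) :
    hS.pform (𝔴 3) (𝔴 3) v v' = d₃ / D * B v v' ∧
    hS.pform (𝔴 4) (𝔴 4) v v' = 4 * d₄ / D * B v v' := by
  have hDz : B z z = D := by rw [hS.form_z_z hK, hD, hd₃, hd₄]
  have hD0 : D ≠ 0 := hDz ▸ hS.form_z_z_pos.ne'
  obtain ⟨r, rfl⟩ := Submodule.mem_span_singleton.1 hv
  obtain ⟨s, rfl⟩ := Submodule.mem_span_singleton.1 hv'
  simp only [map_smul, LinearMap.smul_apply, smul_eq_mul, hS.pform_m₁_z, hS.pform_m₂_z, hDz,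
    ← hd₃, ← hd₄]
  constructor <;> field_simp

end IsSplitGrading

end Constants

/-! ### Ricci curvature of a metric that is diagonal for a bi-invariant one -/

section DiagonalMaps

variable {V : Type*} [AddCommGroup V] [Module ℝ V] [FiniteDimensional ℝ V]
  {B : LinearMap.BilinForm ℝ V} {σ : Type*} {w : σ → Submodule ℝ V}

namespace IsInner

lemma proj_mul_proj [DecidableEq σ] (hB : IsInner B)
    (horth : ∀ i j, i ≠ j → ∀ x ∈ w i, ∀ y ∈ w j, B x y = 0) (i j : σ) :
    hB.proj (w i) * hB.proj (w j) = if i = j then hB.proj (w i) else 0 := by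
  ext x
  rw [Module.End.mul_apply]
  split_ifs with h
  · subst h
    exact hB.proj_eq_self (hB.proj_mem _ _)
  · exact hB.proj_eq_zero fun y hy => horth i j h y hy _ (hB.proj_mem _ _)

variable [Fintype σ]

/-- The endomorphism that is multiplication by `c i` on `w i`. -/
def diagonal (hB : IsInner B) (w : σ → Submodule ℝ V) (c : σ → ℝ) : Module.End ℝ V :=
  ∑ i, c i • hB.proj (w i)

lemma diagonal_of_mem (hB : IsInner B)
    (horth : ∀ i j, i ≠ j → ∀ x ∈ w i, ∀ y ∈ w j, B x y = 0) (c : σ → ℝ) {i : σ} {x : V}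
    (hx : x ∈ w i) : hB.diagonal w c x = c i • x := by
  rw [diagonal, LinearMap.sum_apply, Finset.sum_eq_single_of_mem i (Finset.mem_univ i)
    fun j _ hj => by
      rw [LinearMap.smul_apply, hB.proj_eq_zero fun y hy => horth j i hj y hy x hx, smul_zero],
    LinearMap.smul_apply, hB.proj_eq_self hx]

lemma diagonal_mul (hB : IsInner B)
    (horth : ∀ i j, i ≠ j → ∀ x ∈ w i, ∀ y ∈ w j, B x y = 0) (c c' : σ → ℝ) :
    hB.diagonal w c * hB.diagonal w c' = hB.diagonal w (fun i => c i * c' i) := by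
  classical
  simp only [diagonal, Finset.sum_mul, Finset.mul_sum, smul_mul_smul_comm,
    hB.proj_mul_proj horth]
  refine Finset.sum_congr rfl fun i _ => ?_
  simp

lemma diagonal_one (hB : IsInner B) (horth : ∀ i j, i ≠ j → ∀ x ∈ w i, ∀ y ∈ w j, B x y = 0)
    (hspan : ⨆ i, w i = ⊤) : hB.diagonal w (fun _ => 1) = 1 := by
  simp only [diagonal, one_smul]
  exact hB.sum_proj horth hspan

lemma form_diagonal (hB : IsInner B) (c : σ → ℝ) (x y : V) :
    B (hB.diagonal w c x) y = B x (hB.diagonal w c y) := by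
  simp only [diagonal, LinearMap.sum_apply, map_sum, LinearMap.smul_apply, map_smul,
    hB.form_proj]

/-- A bilinear form that is diagonal on the summands is given by a diagonal endomorphism. -/
lemma eq_form_diagonal [DecidableEq σ] (hB : IsInner B)
    (horth : ∀ i j, i ≠ j → ∀ x ∈ w i, ∀ y ∈ w j, B x y = 0) (hspan : ⨆ i, w i = ⊤) (c : σ → ℝ)
    {F : LinearMap.BilinForm ℝ V}
    (hF : ∀ i j, ∀ x ∈ w i, ∀ y ∈ w j, F x y = if i = j then c i * B x y else 0) (x y : V) :
    F x y = B (hB.diagonal w c x) y := by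
  have h1 : ∀ i, ∀ x ∈ w i, ∀ y, F x y = c i * B x y := fun i x hx => by
    have : ⨆ j, w j ≤ LinearMap.ker (F x - c i • B x) := iSup_le fun j y hy => by
      rw [LinearMap.mem_ker, LinearMap.sub_apply, LinearMap.smul_apply, hF i j x hx y hy]
      split_ifs with h
      · simp
      · rw [horth i j h x hx y hy]
        simp
    rw [hspan] at this
    exact fun y => sub_eq_zero.1 (this (Submodule.mem_top (x := y)))
  have h2 : ⨆ j, w j ≤ LinearMap.ker (F - B ∘ₗ hB.diagonal w c) := iSup_le fun j x hx => by
    rw [LinearMap.mem_ker]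
    ext y
    simp [h1 j x hx, hB.diagonal_of_mem horth c hx]
  rw [hspan] at h2
  have := h2 (Submodule.mem_top (x := x))
  rw [LinearMap.mem_ker, LinearMap.sub_apply, sub_eq_zero] at this
  rw [this]
  rfl

/-- The trace of a product of two endomorphisms given by weighted blocks. -/
lemma trace_block_mul (hB : IsInner B)
    (horth : ∀ i j, i ≠ j → ∀ x ∈ w i, ∀ y ∈ w j, B x y = 0) (f f' : σ → σ → ℝ)
    (A A' : Module.End ℝ V) :
    LinearMap.trace ℝ V ((∑ i, ∑ j, f i j • (hB.proj (w j) * A * hB.proj (w i))) *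
      ∑ i, ∑ j, f' i j • (hB.proj (w j) * A' * hB.proj (w i))) =
    ∑ i, ∑ j, f i j * f' j i *
      LinearMap.trace ℝ V (hB.proj (w j) * A * (hB.proj (w i) * A')) := by
  classical
  have key : ∀ i j a b, LinearMap.trace ℝ V (hB.proj (w j) * A * hB.proj (w i) *
      (hB.proj (w b) * A' * hB.proj (w a))) = if i = b then (if a = j then
        LinearMap.trace ℝ V (hB.proj (w j) * A * (hB.proj (w i) * A')) else 0) else 0 := by
    intro i j a b
    have e : hB.proj (w j) * A * hB.proj (w i) * (hB.proj (w b) * A' * hB.proj (w a)) =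
        (hB.proj (w j) * A * ((hB.proj (w i) * hB.proj (w b)) * A')) * hB.proj (w a) := by
      noncomm_ring
    have e' : hB.proj (w a) * (hB.proj (w j) * A * ((hB.proj (w i) * hB.proj (w b)) * A')) =
        (hB.proj (w a) * hB.proj (w j)) * A * ((hB.proj (w i) * hB.proj (w b)) * A') := by
      noncomm_ring
    rw [e, LinearMap.trace_mul_comm, e', hB.proj_mul_proj horth, hB.proj_mul_proj horth]
    split_ifs with h1 h2 h2
    · subst h1 h2
      rfl
    all_goals simp
  simp only [Finset.sum_mul]
  simp only [Finset.mul_sum, smul_mul_smul_comm, map_sum, map_smul, smul_eq_mul,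
    key, mul_ite, mul_zero, Finset.sum_ite_eq, Finset.sum_ite_eq', Finset.mem_univ, if_true]

end IsInner

end DiagonalMaps

section AlgebraicRicci

variable {L : Type*} [LieRing L] [LieAlgebra ℝ L] [FiniteDimensional ℝ L]
  {B : LinearMap.BilinForm ℝ L} {σ : Type*} [Fintype σ] {w : σ → Submodule ℝ L}

namespace IsInvariantInner

lemma trace_ad (hB : IsInvariantInner B) (u : L) :
    LinearMap.trace ℝ L (LieAlgebra.ad ℝ L u) = 0 := by
  have := hB.trace_eq_of_adjoint (M := LieAlgebra.ad ℝ L u) (N := -LieAlgebra.ad ℝ L u)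
    fun x y => by
      rw [LieAlgebra.ad_apply, hB.inv, LinearMap.neg_apply, map_neg, LieAlgebra.ad_apply]
  rw [map_neg] at this
  linarith

lemma trace_diagonal_ad (hB : IsInvariantInner B) (c : σ → ℝ) (u : L) :
    LinearMap.trace ℝ L (hB.diagonal w c * LieAlgebra.ad ℝ L u) = 0 := by
  have := hB.trace_eq_of_adjoint (M := hB.diagonal w c * LieAlgebra.ad ℝ L u)
    (N := -(LieAlgebra.ad ℝ L u * hB.diagonal w c))
    fun x y => by
      rw [Module.End.mul_apply, hB.form_diagonal, LieAlgebra.ad_apply, hB.inv, LinearMap.neg_apply,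
        map_neg, Module.End.mul_apply, LieAlgebra.ad_apply]
  rw [map_neg, LinearMap.trace_mul_comm ℝ (LieAlgebra.ad ℝ L u)] at this
  linarith

/-- The endomorphism `x ↦ ∇_x v`, for the Levi-Civita connection `∇` of the left-invariant metric
`B (P ·) ·` with `P` the diagonal endomorphism with coefficients `c`. -/
def nablaMap (hB : IsInvariantInner B) (w : σ → Submodule ℝ L) (c : σ → ℝ) (v : L) :
    Module.End ℝ L :=
  (1 / 2 : ℝ) • (hB.diagonal w (fun i => (c i)⁻¹) * (LieAlgebra.ad ℝ L v * hB.diagonal w c) -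
    LieAlgebra.ad ℝ L v -
    hB.diagonal w (fun i => (c i)⁻¹) * LieAlgebra.ad ℝ L (hB.diagonal w c v))

/-- Koszul's formula. -/
lemma eq_nablaMap (hB : IsInvariantInner B)
    (horth : ∀ i j, i ≠ j → ∀ x ∈ w i, ∀ y ∈ w j, B x y = 0) (hspan : ⨆ i, w i = ⊤) {c : σ → ℝ}
    (hc : ∀ i, c i ≠ 0) {nabla : L → L → L} (htors : ∀ x y, nabla x y - nabla y x = ⁅x, y⁆)
    (hmetric : ∀ x y u, B (hB.diagonal w c (nabla x y)) u + B (hB.diagonal w c y) (nabla x u) = 0)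
    (x v : L) : nabla x v = hB.nablaMap w c v x := by
  set P := hB.diagonal w c with hP
  set R := hB.diagonal w (fun i => (c i)⁻¹) with hR
  have hRP : R * P = 1 := by
    rw [hR, hP, hB.diagonal_mul horth]
    simp only [inv_mul_cancel₀ (hc _)]
    exact hB.diagonal_one horth hspan
  have hRP' : ∀ y, R (P y) = y := fun y => congrArg (fun f => f y) hRP
  have hsymm : ∀ x y, B (P x) y = B (P y) x := fun x y => by
    rw [hB.form_diagonal, hB.symm]
  have key : P (nabla x v) = (1 / 2 : ℝ) • (⁅v, P x⁆ - P ⁅v, x⁆ - ⁅P v, x⁆) := by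
    have main : ∀ u, B (P (nabla x v) - (1 / 2 : ℝ) • (⁅v, P x⁆ - P ⁅v, x⁆ - ⁅P v, x⁆)) u = 0 := by
      intro u
      have t1 := congrArg (fun y => B (P y) u) (htors x v)
      have t2 := congrArg (fun y => B (P y) v) (htors x u)
      have t3 := congrArg (fun y => B (P y) x) (htors u v)
      have m1 := hmetric x v u
      have m2 := hmetric u x v
      have m3 := hmetric v u x
      have i1 := hB.inv v u (P x)
      have i2 := hB.inv x u (P v)
      simp only [map_sub, LinearMap.sub_apply] at t1 t2 t3
      rw [hsymm v] at m1
      rw [hsymm x] at m2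
      rw [hsymm u] at m3
      rw [hB.symm u] at i1 i2
      have e1 : B (P ⁅v, x⁆) u = -B (P ⁅x, v⁆) u := by
        rw [← lie_skew, map_neg, map_neg, LinearMap.neg_apply]
      have e2 : B ⁅P v, x⁆ u = -B ⁅x, P v⁆ u := by
        rw [← lie_skew, map_neg, LinearMap.neg_apply]
      have e3 : B (P ⁅u, v⁆) x = -B ⁅v, u⁆ (P x) := by
        rw [hB.form_diagonal, ← lie_skew, map_neg, LinearMap.neg_apply]
      have e4 : B (P ⁅x, u⁆) v = B ⁅x, u⁆ (P v) := hB.form_diagonal _ _ _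
      simp only [map_sub, map_smul, LinearMap.sub_apply, LinearMap.smul_apply, smul_eq_mul]
      linarith
    exact sub_eq_zero.1 (hB.eq_zero (main _))
  rw [← hRP' (nabla x v), key]
  simp [nablaMap, hRP', ← hP, ← hR]

lemma trace_nablaMap (hB : IsInvariantInner B)
    (horth : ∀ i j, i ≠ j → ∀ x ∈ w i, ∀ y ∈ w j, B x y = 0) (hspan : ⨆ i, w i = ⊤) {c : σ → ℝ}
    (hc : ∀ i, c i ≠ 0) (u : L) : LinearMap.trace ℝ L (hB.nablaMap w c u) = 0 := by
  have h1 : LinearMap.trace ℝ L (hB.diagonal w (fun i => (c i)⁻¹) *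
      (LieAlgebra.ad ℝ L u * hB.diagonal w c)) = 0 := by
    rw [LinearMap.trace_mul_comm, mul_assoc, hB.diagonal_mul horth]
    simp only [mul_inv_cancel₀ (hc _)]
    rw [hB.diagonal_one horth hspan, mul_one, hB.trace_ad]
  rw [nablaMap, map_smul, map_sub, map_sub, h1, hB.trace_ad, hB.trace_diagonal_ad]
  simp

/-- `∇ v` in terms of the blocks of `ad v`. -/
lemma nablaMap_eq_sum (hB : IsInvariantInner B)
    (horth : ∀ i j, i ≠ j → ∀ x ∈ w i, ∀ y ∈ w j, B x y = 0) (hspan : ⨆ i, w i = ⊤) {c : σ → ℝ}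
    (hc : ∀ i, c i ≠ 0) {k : σ} {v : L} (hv : v ∈ w k) :
    hB.nablaMap w c v = ∑ i, ∑ j, ((c i - c j - c k) / (2 * c j)) •
      (hB.proj (w j) * LieAlgebra.ad ℝ L v * hB.proj (w i)) := by
  have h1 : LieAlgebra.ad ℝ L v = hB.diagonal w (fun _ => 1) * (LieAlgebra.ad ℝ L v *
      hB.diagonal w (fun _ => 1)) := by
    rw [hB.diagonal_one horth hspan, one_mul, mul_one]
  have h2 : hB.diagonal w (fun i => (c i)⁻¹) * LieAlgebra.ad ℝ L v =
      hB.diagonal w (fun i => (c i)⁻¹) * (LieAlgebra.ad ℝ L v * hB.diagonal w (fun _ => 1)) := by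
    rw [hB.diagonal_one horth hspan, mul_one]
  rw [nablaMap, hB.diagonal_of_mem horth c hv, map_smul, mul_smul_comm, h2]
  nth_rewrite 2 [h1]
  simp only [IsInner.diagonal, Finset.sum_mul, Finset.mul_sum, smul_mul_assoc, mul_smul_comm,
    Finset.smul_sum, ← Finset.sum_sub_distrib]
  refine Finset.sum_congr rfl fun i _ => Finset.sum_congr rfl fun j _ => ?_
  rw [mul_assoc]
  simp only [smul_smul, ← sub_smul]
  congr 1
  have := hc j
  field_simp

/-- The Ricci tensor of a diagonal metric in terms of the partial Killing forms. The endomorphism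
`T` is the curvature `x ↦ R(x, v) v'`; for `N_v x = ∇_x v` it differs from `-N_v N_v'` by a
commutator and by `N_u` with `u = ∇_v v'`, which are traceless. -/
lemma trace_curvature (hB : IsInvariantInner B)
    (horth : ∀ i j, i ≠ j → ∀ x ∈ w i, ∀ y ∈ w j, B x y = 0) (hspan : ⨆ i, w i = ⊤) {c : σ → ℝ}
    (hc : ∀ i, c i ≠ 0) {nabla : L → L → L} (htors : ∀ x y, nabla x y - nabla y x = ⁅x, y⁆)
    (hmetric : ∀ x y u, B (hB.diagonal w c (nabla x y)) u + B (hB.diagonal w c y) (nabla x u) = 0)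
    {k l : σ} {v v' : L} (hv : v ∈ w k) (hv' : v' ∈ w l) :
    ∃ T : Module.End ℝ L, (∀ x, T x = nabla x (nabla v v') - nabla v (nabla x v') -
      nabla ⁅x, v⁆ v') ∧ LinearMap.trace ℝ L T = ∑ i, ∑ j,
      (c i - c j - c k) * (c j - c i - c l) / (4 * (c i * c j)) * hB.pform (w i) (w j) v v' := by
  have hN := hB.eq_nablaMap horth hspan hc htors hmetric
  refine ⟨hB.nablaMap w c (nabla v v') -
      (LieAlgebra.ad ℝ L v * hB.nablaMap w c v' - hB.nablaMap w c v' * LieAlgebra.ad ℝ L v) -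
      hB.nablaMap w c v * hB.nablaMap w c v', fun x => ?_, ?_⟩
  · have e : ∀ y, nabla v y = ⁅v, y⁆ + nabla y v := fun y => by rw [← htors v y]; abel
    have e2 : nabla ⁅x, v⁆ v' = -hB.nablaMap w c v' ⁅v, x⁆ := by
      rw [hN, ← lie_skew, map_neg]
    rw [e (nabla x v'), e2]
    simp only [LinearMap.sub_apply, Module.End.mul_apply, LieAlgebra.ad_apply, hN]
    abel
  rw [map_sub, map_sub, map_sub, hB.trace_nablaMap horth hspan hc,
    LinearMap.trace_mul_comm ℝ (LieAlgebra.ad ℝ L v), hB.nablaMap_eq_sum horth hspan hc hv,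
    hB.nablaMap_eq_sum horth hspan hc hv', hB.trace_block_mul horth, sub_self, sub_zero, zero_sub,
    ← Finset.sum_neg_distrib]
  refine Finset.sum_congr rfl fun i _ => ?_
  rw [← Finset.sum_neg_distrib]
  refine Finset.sum_congr rfl fun j _ => ?_
  rw [hB.pform_def]
  have := hc i
  have := hc j
  field_simp
  ring

end IsInvariantInner

end AlgebraicRicci

/-! ### The Ricci tensor in terms of dimensions -/

section RicciFormula

variable {L : Type*} [LieRing L] [LieAlgebra ℝ L] [FiniteDimensional ℝ L]
  {B : LinearMap.BilinForm ℝ L} {z : L} {h m₁ m₂ : Submodule ℝ L} {h₁ h₂ : LieSubalgebra ℝ L}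

namespace IsSplitGrading

local notation "𝔴" => splitSummands z m₁ m₂ h₁ h₂

/-- The Ricci tensor in terms of the dimensions of the summands. -/
lemma sum_curvature (hS : IsSplitGrading B z h m₁ m₂ h₁ h₂)
    (hK : ∀ x y, B x y = -killingForm ℝ L x y) {d₁ d₂ d₃ d₄ : ℝ}
    (hd₁ : d₁ = Module.finrank ℝ h₁) (hd₂ : d₂ = Module.finrank ℝ h₂)
    (hd₃ : d₃ = Module.finrank ℝ m₁) (hd₄ : d₄ = Module.finrank ℝ m₂)
    {u₀ u₁ u₂ x₁ x₂ : ℝ} (hu₀ : u₀ ≠ 0) (hu₁ : u₁ ≠ 0) (hu₂ : u₂ ≠ 0) (hx₁ : x₁ ≠ 0)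
    (hx₂ : x₂ ≠ 0) {r₀ r₁ r₂ r₃ r₄ : ℝ}
    (hr₀ : r₀ = u₀ / (4 * x₁ ^ 2) * (d₃ / (d₃ + 4 * d₄)) + u₀ / x₂ ^ 2 * (d₄ / (d₃ + 4 * d₄)))
    (hr₁ : r₁ = 1 / (2 * d₁ * u₁) * (d₄ * (2 * d₁ + 2 - d₄) / (d₃ + 4 * d₄))
        + u₁ / (4 * x₁ ^ 2) * (d₃ / (d₃ + 4 * d₄))
        + u₁ / (2 * d₁ * x₂ ^ 2) * (d₄ * (d₄ - 2) / (d₃ + 4 * d₄)))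
    (hr₂ : r₂ = 1 / (4 * d₂ * u₂)
          * (d₂ - d₃ * (d₃ + 2 * d₄ - 2 * d₁ - 2) / (2 * (d₃ + 4 * d₄)))
        + u₂ / (4 * d₂ * x₁ ^ 2)
          * (d₃ * (d₃ + 2 * d₄ - 2 * d₁ - 2) / (2 * (d₃ + 4 * d₄))))
    (hr₃ : r₃ = 1 / (2 * x₁) - x₂ / (2 * x₁ ^ 2) * (d₄ / (d₃ + 4 * d₄))
        - 1 / (2 * x₁ ^ 2) * (u₀ * (1 / (d₃ + 4 * d₄)) + u₁ * (d₁ / (d₃ + 4 * d₄))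
          + u₂ * ((d₃ + 2 * d₄ - 2 * d₁ - 2) / (2 * (d₃ + 4 * d₄)))))
    (hr₄ : r₄ = 1 / x₂ * (2 * d₄ / (d₃ + 4 * d₄)) + x₂ / (4 * x₁ ^ 2) * (d₃ / (d₃ + 4 * d₄))
        - 1 / x₂ ^ 2 * (u₀ * (2 / (d₃ + 4 * d₄)) + u₁ * ((d₄ - 2) / (d₃ + 4 * d₄))))
    {c : Fin 5 → ℝ} (hc : c = ![u₀, u₁, u₂, x₁, x₂]) {k l : Fin 5} {v v' : L} (hv : v ∈ 𝔴 k)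
    (hv' : v' ∈ 𝔴 l) :
    ∑ i, ∑ j, (c i - c j - c k) * (c j - c i - c l) / (4 * (c i * c j)) *
      hS.pform (𝔴 i) (𝔴 j) v v' =
    if k = l then ![r₀ * u₀, r₁ * u₁, r₂ * u₂, r₃ * x₁, r₄ * x₂] k * B v v' else 0 := by
  by_cases hkl : k = l
  swap
  · rw [if_neg hkl]
    exact Finset.sum_eq_zero fun i _ => Finset.sum_eq_zero fun j _ => by
      rw [hS.pform_off_diagonal i j hkl hv hv', mul_zero]
  subst hkl
  rw [if_pos rfl]
  set D := d₃ + 4 * d₄ with hD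
  have hD0 : D ≠ 0 := by
    rw [hD, hd₃, hd₄, ← hS.form_z_z hK]
    exact hS.form_z_z_pos.ne'
  have hd₁0 : d₁ ≠ 0 := hd₁ ▸ finrank_ne_zero_of_simple hS.ideal₁.simple
  have hd₂0 : d₂ ≠ 0 := hd₂ ▸ finrank_ne_zero_of_simple hS.ideal₂.simple
  have hf : ∀ k i j, (c i - c j - c k) * (c j - c i - c k) / (4 * (c i * c j)) =
      (c j - c i - c k) * (c i - c j - c k) / (4 * (c j * c i)) := fun k i j => by
    rw [mul_comm (c i) (c j), mul_comm (c i - c j - c k)]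
  have c0 : c 0 = u₀ := by rw [hc]; rfl
  have c1 : c 1 = u₁ := by rw [hc]; rfl
  have c2 : c 2 = u₂ := by rw [hc]; rfl
  have c3 : c 3 = x₁ := by rw [hc]; rfl
  have c4 : c 4 = x₂ := by rw [hc]; rfl
  obtain rfl | rfl | rfl | rfl | rfl : k = 0 ∨ k = 1 ∨ k = 2 ∨ k = 3 ∨ k = 4 := by omega
  · obtain ⟨e3, e4⟩ := hS.pform_on_z hK hd₃ hd₄ hD hv hv'
    rw [hS.sum_z (fun i j => (c i - c j - c 0) * (c j - c i - c 0) / (4 * (c i * c j))) hv, e3, e4]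
    simp only [c0, c3, c4, hr₀, Matrix.cons_val]
    field_simp
    ring
  · obtain ⟨e1, e3, e4⟩ := hS.pform_on_h₁ hK hd₁ hd₃ hd₄ hD hv hv'
    rw [hS.sum_h₁ (fun i j => (c i - c j - c 1) * (c j - c i - c 1) / (4 * (c i * c j))) hv, e1, e3,
      e4]
    simp only [c1, c3, c4, hr₁, Matrix.cons_val]
    field_simp
    ring
  · obtain ⟨e2, e3⟩ := hS.pform_on_h₂ hK hd₁ hd₂ hd₃ hd₄ hD hv hv'
    rw [hS.sum_h₂ (fun i j => (c i - c j - c 2) * (c j - c i - c 2) / (4 * (c i * c j))) hv, e2, e3]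
    simp only [c2, c3, hr₂, Matrix.cons_val]
    field_simp
    ring
  · obtain ⟨e0, e1, e2, e4⟩ := hS.pform_on_m₁ hK hd₁ hd₃ hd₄ hD hv hv'
    rw [hS.sum_m₁ (fun i j => (c i - c j - c 3) * (c j - c i - c 3) / (4 * (c i * c j))) (hf 3) hv,
      e0, e1, e2, e4]
    simp only [c0, c1, c2, c3, c4, hr₃, Matrix.cons_val]
    field_simp
    rw [hD]
    ring
  · obtain ⟨e3, e0, e1⟩ := hS.pform_on_m₂ hK hd₃ hd₄ hD hv hv'
    rw [hS.sum_m₂ (fun i j => (c i - c j - c 4) * (c j - c i - c 4) / (4 * (c i * c j))) (hf 4) hv,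
      e0, e1, e3]
    simp only [c0, c1, c3, c4, hr₄, Matrix.cons_val]
    field_simp
    ring

end IsSplitGrading

end RicciFormula

/-! ### The Levi-Civita connection of a left-invariant metric -/

section LeftInvariant

variable {n : ℕ} {G : Type*} [TopologicalSpace G] [ChartedSpace (EuclideanSpace ℝ (Fin n)) G]
  [Group G]

/-- The inverse of left translation, from the tangent space at `x` to the Lie algebra. -/
def leftTrivial (x : G) : TangentSpace (𝓡 n) x →L[ℝ] GroupLieAlgebra (𝓡 n) G :=
  mfderiv (𝓡 n) (𝓡 n) (fun y : G => x⁻¹ * y) x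

variable [LieGroup (𝓡 n) ∞ G]

lemma mdifferentiableAt_mul_left (a x : G) :
    MDifferentiableAt (𝓡 n) (𝓡 n) (fun y : G => a * y) x :=
  (contMDiff_mul_left (I := 𝓡 n) (n := ∞) (a := a)).contMDiffAt.mdifferentiableAt (by simp)

lemma leftTrivial_mulInvariantVectorField (x : G) (v : GroupLieAlgebra (𝓡 n) G) :
    leftTrivial x (mulInvariantVectorField v x) = v := by
  have h := mfderiv_comp (I := 𝓡 n) (I' := 𝓡 n) (I'' := 𝓡 n) (1 : G) (g := fun y : G => x⁻¹ * y)
    (f := fun y : G => x * y) (mdifferentiableAt_mul_left _ _) (mdifferentiableAt_mul_left _ _)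
  have e : (fun y : G => x⁻¹ * y) ∘ (fun y : G => x * y) = id := by ext; simp
  rw [e, mfderiv_id] at h
  have := congrArg (fun f => f v) h
  rw [mul_one] at this
  exact this.symm

lemma mulInvariantVectorField_leftTrivial (x : G) (u : TangentSpace (𝓡 n) x) :
    mulInvariantVectorField (leftTrivial x u) x = u := by
  have h := mfderiv_comp (I := 𝓡 n) (I' := 𝓡 n) (I'' := 𝓡 n) (x : G) (g := fun y : G => x * y)
    (f := fun y : G => x⁻¹ * y) (mdifferentiableAt_mul_left _ _) (mdifferentiableAt_mul_left _ _)
  have e : (fun y : G => x * y) ∘ (fun y : G => x⁻¹ * y) = id := by ext; simp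
  rw [e, mfderiv_id] at h
  have := congrArg (fun f => f u) h
  rw [inv_mul_cancel] at this
  exact this.symm

lemma mlieBracket_mulInvariantVectorField (v w : GroupLieAlgebra (𝓡 n) G) (x : G) :
    VectorField.mlieBracket (𝓡 n) (mulInvariantVectorField v) (mulInvariantVectorField w) x =
      mulInvariantVectorField ⁅v, w⁆ x := by
  rw [← mulInvariantVector_mlieBracket]
  rfl

namespace IsLeviCivita

variable {g : Metric n G} {cov : Connection n G}

/-- Vanishing of the torsion on left-invariant fields. -/
lemma nabla_sub_nabla (h : IsLeviCivita g cov) (x : G) (v w : GroupLieAlgebra (𝓡 n) G) :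
    leftTrivial x (cov (mulInvariantVectorField w) x (mulInvariantVectorField v x)) -
      leftTrivial x (cov (mulInvariantVectorField v) x (mulInvariantVectorField w x)) = ⁅v, w⁆ := by
  have := cov.torsion_eq_zero_iff.1 h.torsion_free
    (mdifferentiableAt_mulInvariantVectorField v (g := x))
    (mdifferentiableAt_mulInvariantVectorField w (g := x))
  rw [← map_sub, this, mlieBracket_mulInvariantVectorField, leftTrivial_mulInvariantVectorField]

/-- Compatibility with the metric on left-invariant fields, whose inner products are constant. -/
lemma inner_nabla (h : IsLeviCivita g cov) (hg : IsLeftInvariant g) (x : G)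
    (v w u : GroupLieAlgebra (𝓡 n) G) :
    g.inner 1 (leftTrivial x (cov (mulInvariantVectorField w) x (mulInvariantVectorField v x))) u +
    g.inner 1 w (leftTrivial x (cov (mulInvariantVectorField u) x (mulInvariantVectorField v x)))
      = 0 := by
  let : Bundle.RiemannianBundle (TangentSpace (𝓡 n) : G → Type) := ⟨g.toRiemannianMetric⟩
  have hm := CovariantDerivative.IsMetricCompatible.mvfderiv_inner_eq h.metric
    (mulInvariantVectorField v)
    (mdifferentiableAt_mulInvariantVectorField w (g := x))
    (mdifferentiableAt_mulInvariantVectorField u (g := x))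
  have hconst : (fun y : G => inner ℝ (mulInvariantVectorField w y : TangentSpace (𝓡 n) y)
      (mulInvariantVectorField u y)) = fun _ => g.inner 1 w u := by
    ext y
    exact hg y w u
  rw [hconst, mvfderiv_const] at hm
  have e : ∀ (a : TangentSpace (𝓡 n) x) (y : GroupLieAlgebra (𝓡 n) G),
      g.inner 1 (leftTrivial x a) y = g.inner x a (mulInvariantVectorField y x) := fun a y => by
    rw [← hg x, mulInvariantVectorField_leftTrivial]
  rw [g.symm 1 w, e, e, g.symm x _ (mulInvariantVectorField w x)]
  exact hm.symm

/-- The Levi-Civita connection of a left-invariant metric is left-invariant. -/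
lemma exists_nabla (h : IsLeviCivita g cov) (hg : IsLeftInvariant g) :
    ∃ nabla : GroupLieAlgebra (𝓡 n) G → GroupLieAlgebra (𝓡 n) G → GroupLieAlgebra (𝓡 n) G,
      (∀ v w, (fun x => cov (mulInvariantVectorField w) x (mulInvariantVectorField v x)) =
        mulInvariantVectorField (nabla v w)) ∧
      (∀ v w, nabla v w - nabla w v = ⁅v, w⁆) ∧
      ∀ v w u, g.inner 1 (nabla v w) u + g.inner 1 w (nabla v u) = 0 := by
  let N : G → GroupLieAlgebra (𝓡 n) G → GroupLieAlgebra (𝓡 n) G → GroupLieAlgebra (𝓡 n) G :=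
    fun x v w => leftTrivial x (cov (mulInvariantVectorField w) x (mulInvariantVectorField v x))
  have tors : ∀ x v w, N x v w - N x w v = ⁅v, w⁆ := fun x v w => h.nabla_sub_nabla x v w
  have metr : ∀ x v w u, g.inner 1 (N x v w) u + g.inner 1 w (N x v u) = 0 := fun x v w u =>
    h.inner_nabla hg x v w u
  refine ⟨N 1, fun v w => ?_, tors 1, metr 1⟩
  -- The difference of two solutions is symmetric in its arguments and skew for the metric.
  ext x : 1
  have hT : ∀ v w u, g.inner 1 (N x v w - N 1 v w) u = 0 := by
    intro v w u
    set T : GroupLieAlgebra (𝓡 n) G → GroupLieAlgebra (𝓡 n) G → GroupLieAlgebra (𝓡 n) G → ℝ :=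
      fun v w u => g.inner 1 (N x v w - N 1 v w) u with hTdef
    have s1 : ∀ v w u, T v w u = T w v u := fun v w u => by
      have : N x v w - N 1 v w = N x w v - N 1 w v :=
        sub_eq_sub_iff_sub_eq_sub.2 ((tors x v w).trans (tors 1 v w).symm)
      simp only [hTdef, this]
    have s2 : ∀ v w u, T v w u = -T v u w := fun v w u => by
      have a := metr x v w u
      have b := metr 1 v w u
      rw [g.symm 1 w] at a b
      simp only [hTdef, map_sub, _root_.sub_apply]
      linarith
    have := s1 v w u
    have := s2 w v u
    have := s1 w u v
    have := s2 u w v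
    have := s1 u v w
    have := s2 v u w
    change T v w u = 0
    linarith
  have hN : N x v w = N 1 v w := by
    by_contra hne
    exact (g.pos 1 _ (sub_ne_zero.2 hne)).ne' (hT v w _)
  rw [← hN, mulInvariantVectorField_leftTrivial]

/-- The Ricci tensor is the trace of the algebraic curvature. -/
lemma ricci_eq_trace
    {nabla : GroupLieAlgebra (𝓡 n) G → GroupLieAlgebra (𝓡 n) G → GroupLieAlgebra (𝓡 n) G}
    (hn : ∀ v w, (fun x => cov (mulInvariantVectorField w) x (mulInvariantVectorField v x)) =
        mulInvariantVectorField (nabla v w)) (x : G) {v w : GroupLieAlgebra (𝓡 n) G}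
    {T : Module.End ℝ (GroupLieAlgebra (𝓡 n) G)}
    (hT : ∀ u, T u = nabla u (nabla v w) - nabla v (nabla u w) - nabla ⁅u, v⁆ w) :
    ricci cov x v w = LinearMap.trace ℝ _ T := by
  have hn' : ∀ v w, cov (mulInvariantVectorField w) x (mulInvariantVectorField v x) =
      mulInvariantVectorField (nabla v w) x := fun v w => congrFun (hn v w) x
  have hc : ∀ u, curvature cov (mulInvariantVectorField u) (mulInvariantVectorField v)
      (mulInvariantVectorField w) x = mulInvariantVectorField (T u) x := by
    intro u
    rw [curvature, hn, hn, mlieBracket_mulInvariantVectorField, hn', hn', hn', hT]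
    simp only [mulInvariantVectorField, map_sub]
    rfl
  rw [LinearMap.trace_eq_matrix_trace ℝ (Module.finBasis ℝ (GroupLieAlgebra (𝓡 n) G)) T,
    Matrix.trace]
  refine Finset.sum_congr rfl fun i _ => ?_
  rw [hc, Matrix.diag_apply, LinearMap.toMatrix_apply]
  exact congrArg (fun y => (Module.finBasis ℝ (GroupLieAlgebra (𝓡 n) G)).coord i y)
    (leftTrivial_mulInvariantVectorField x _)

end IsLeviCivita

end LeftInvariant

/-! ### Right-invariant vector fields -/

section RightInvariant

variable {n : ℕ} {G : Type*} [TopologicalSpace G] [ChartedSpace (EuclideanSpace ℝ (Fin n)) G]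
  [Group G] [LieGroup (𝓡 n) ∞ G]

lemma mdifferentiableAt_mul_right (a x : G) :
    MDifferentiableAt (𝓡 n) (𝓡 n) (fun y : G => y * a) x :=
  (contMDiff_mul_right (I := 𝓡 n) (n := ∞) (a := a)).contMDiffAt.mdifferentiableAt (by simp)

/-- The right-invariant vector field with value `v` at the identity. -/
def rightField (v : GroupLieAlgebra (𝓡 n) G) (x : G) : TangentSpace (𝓡 n) x :=
  mfderiv (𝓡 n) (𝓡 n) (fun y : G => y * x) 1 v

lemma contMDiff_rightField (v : GroupLieAlgebra (𝓡 n) G) :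
    ContMDiff (𝓡 n) (𝓡 n).tangent 1 (fun x : G => (rightField v x : TangentBundle (𝓡 n) G)) := by
  -- The derivative of the multiplication at `(1, x)` maps `(v, 0)` to the value of the field at `x`.
  let E := EuclideanSpace ℝ (Fin n)
  let fg : G → TangentBundle (𝓡 n) G := fun x => Bundle.TotalSpace.mk' E x 0
  have sfg : ContMDiff (𝓡 n) (𝓡 n).tangent 1 fg := Bundle.contMDiff_zeroSection _ _
  let fv : G → TangentBundle (𝓡 n) G := fun _ => Bundle.TotalSpace.mk' E 1 v
  have sfv : ContMDiff (𝓡 n) (𝓡 n).tangent 1 fv := contMDiff_const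
  let F₁ : G → TangentBundle (𝓡 n) G × TangentBundle (𝓡 n) G := fun x => (fv x, fg x)
  have S₁ : ContMDiff (𝓡 n) ((𝓡 n).tangent.prod (𝓡 n).tangent) 1 F₁ := sfv.prodMk sfg
  let F₂ : (TangentBundle (𝓡 n) G × TangentBundle (𝓡 n) G) →
      TangentBundle ((𝓡 n).prod (𝓡 n)) (G × G) := (equivTangentBundleProd (𝓡 n) G (𝓡 n) G).symm
  have S₂ : ContMDiff ((𝓡 n).tangent.prod (𝓡 n).tangent) ((𝓡 n).prod (𝓡 n)).tangent 1 F₂ :=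
    contMDiff_equivTangentBundleProd_symm
  let F₃ : TangentBundle ((𝓡 n).prod (𝓡 n)) (G × G) → TangentBundle (𝓡 n) G :=
    tangentMap ((𝓡 n).prod (𝓡 n)) (𝓡 n) (fun p : G × G => p.1 * p.2)
  have S₃ : ContMDiff ((𝓡 n).prod (𝓡 n)).tangent (𝓡 n).tangent 1 F₃ :=
    (contMDiff_mul (𝓡 n) ∞).contMDiff_tangentMap (m := 1) (by norm_cast)
  let S := (S₃.comp S₂).comp S₁
  convert! S with x
  · simp [F₁, F₂, F₃, fg, fv]
  · simp only [Function.comp_apply, tangentMap, F₃, F₂, F₁, fg, fv]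
    rw [mfderiv_prod_eq_add_apply ((contMDiff_mul (𝓡 n) ∞).mdifferentiableAt (by simp))]
    simp +instances only [rightField]
    exact ((congrArg _ (map_zero (mfderiv (𝓡 n) (𝓡 n) (fun z : G => 1 * z) x))).trans
      (add_zero _)).symm

lemma mdifferentiableAt_rightField (v : GroupLieAlgebra (𝓡 n) G) (x : G) :
    MDifferentiableAt (𝓡 n) (𝓡 n).tangent
      (fun x : G => (rightField v x : TangentBundle (𝓡 n) G)) x :=
  (contMDiff_rightField v).contMDiffAt.mdifferentiableAt one_ne_zero

/-- The multiplication in the chart at the identity. -/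
def chartMul (n : ℕ) (G : Type*) [TopologicalSpace G] [ChartedSpace (EuclideanSpace ℝ (Fin n)) G]
    [Group G] (p : EuclideanSpace ℝ (Fin n) × EuclideanSpace ℝ (Fin n)) :
    EuclideanSpace ℝ (Fin n) :=
  extChartAt (𝓡 n) (1 : G) ((extChartAt (𝓡 n) (1 : G)).symm p.1 *
    (extChartAt (𝓡 n) (1 : G)).symm p.2)

local notation "χ" => extChartAt (𝓡 n) (1 : G)

lemma contDiffAt_chartMul : ContDiffAt ℝ 2 (chartMul n G) (χ 1, χ 1) := by
  rw [← contMDiffAt_iff_contDiffAt]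
  have h1 : ContMDiffAt 𝓘(ℝ, EuclideanSpace ℝ (Fin n)) (𝓡 n) 2 (χ).symm (χ 1) :=
    (contMDiffOn_extChartAt_symm 1).contMDiffAt (extChartAt_target_mem_nhds 1)
  have hs : (χ).symm (χ 1) = 1 := extChartAt_to_inv 1
  have h2 : ContMDiffAt (𝓘(ℝ, EuclideanSpace ℝ (Fin n) × EuclideanSpace ℝ (Fin n))) (𝓡 n) 2
      (fun p : EuclideanSpace ℝ (Fin n) × EuclideanSpace ℝ (Fin n) => (χ).symm p.1 * (χ).symm p.2)
      (χ 1, χ 1) := by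
    have hf : ContMDiffAt (𝓘(ℝ, EuclideanSpace ℝ (Fin n) × EuclideanSpace ℝ (Fin n))) (𝓡 n) 2
      (fun p : EuclideanSpace ℝ (Fin n) × EuclideanSpace ℝ (Fin n) => (χ).symm p.1) (χ 1, χ 1) :=
      h1.comp (χ 1, χ 1) contDiffAt_fst.contMDiffAt
    have hg : ContMDiffAt (𝓘(ℝ, EuclideanSpace ℝ (Fin n) × EuclideanSpace ℝ (Fin n))) (𝓡 n) 2
      (fun p : EuclideanSpace ℝ (Fin n) × EuclideanSpace ℝ (Fin n) => (χ).symm p.2) (χ 1, χ 1) :=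
      h1.comp (χ 1, χ 1) contDiffAt_snd.contMDiffAt
    exact hf.mul hg
  have h3 : ContMDiffAt (𝓡 n) 𝓘(ℝ, EuclideanSpace ℝ (Fin n)) 2 (χ)
      ((χ).symm (χ 1) * (χ).symm (χ 1)) := by
    rw [hs, mul_one]
    exact contMDiffAt_extChartAt
  exact h3.comp (χ 1, χ 1) h2

/-- The chart at the identity maps a translate of a tangent vector to a derivative of the product
in the chart. -/
lemma inverse_mfderivWithin_apply {F : G → G} {p : EuclideanSpace ℝ (Fin n)} (hp : p ∈ (χ).target)
    (hF : MDifferentiableAt (𝓡 n) (𝓡 n) F 1) (hF1 : F 1 = (χ).symm p)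
    (v : GroupLieAlgebra (𝓡 n) G) :
    (mfderivWithin 𝓘(ℝ, EuclideanSpace ℝ (Fin n)) (𝓡 n) (χ).symm (Set.range (𝓡 n)) p).inverse
      (mfderiv (𝓡 n) (𝓡 n) F 1 v) =
    fderiv ℝ (fun q => χ (F ((χ).symm q))) (χ 1) v := by
  have hrange : Set.range (𝓡 n) = Set.univ := ModelWithCorners.range_eq_univ _
  have hs : (χ).symm (χ 1) = 1 := extChartAt_to_inv 1
  rw [ContinuousLinearMap.inverse_eq
    (mfderivWithin_extChartAt_symm_comp_mfderiv_extChartAt (I := 𝓡 n) hp)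
    (mfderiv_extChartAt_comp_mfderivWithin_extChartAt_symm (I := 𝓡 n) hp)]
  have hF2 : (χ).symm p ∈ (chartAt (EuclideanSpace ℝ (Fin n)) (1 : G)).source := by
    rw [← extChartAt_source (I := 𝓡 n)]
    exact (χ).map_target hp
  have d1 : MDifferentiableAt (𝓡 n) 𝓘(ℝ, EuclideanSpace ℝ (Fin n)) (χ) (F 1) := by
    rw [hF1]
    exact mdifferentiableAt_extChartAt hF2
  have d2 : MDifferentiableAt 𝓘(ℝ, EuclideanSpace ℝ (Fin n)) (𝓡 n) (χ).symm (χ 1) := by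
    have := mdifferentiableWithinAt_extChartAt_symm (I := 𝓡 n)
      (mem_extChartAt_target (I := 𝓡 n) (1 : G))
    rwa [hrange, mdifferentiableWithinAt_univ] at this
  have e2 : mfderiv 𝓘(ℝ, EuclideanSpace ℝ (Fin n)) (𝓡 n) (χ).symm (χ 1) =
      ContinuousLinearMap.id ℝ _ := by
    have := mfderivWithin_range_extChartAt_symm (I := 𝓡 n) (x := (1 : G))
    rwa [hrange, mfderivWithin_univ] at this
  have hF' : MDifferentiableAt (𝓡 n) (𝓡 n) F ((χ).symm (χ 1)) := by rwa [hs]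
  have d1' : MDifferentiableAt (𝓡 n) 𝓘(ℝ, EuclideanSpace ℝ (Fin n)) (χ) (F ((χ).symm (χ 1))) := by
    rwa [hs]
  have h3 := mfderiv_comp (χ 1) d1' (hF'.comp (χ 1) d2)
  have h4 := mfderiv_comp (χ 1) hF' d2
  rw [← mfderiv_eq_fderiv]
  change _ = mfderiv 𝓘(ℝ, EuclideanSpace ℝ (Fin n)) 𝓘(ℝ, EuclideanSpace ℝ (Fin n))
    ((χ) ∘ (F ∘ (χ).symm)) (χ 1) v
  have key : ∀ a : G, a = 1 → mfderiv (𝓡 n) 𝓘(ℝ, EuclideanSpace ℝ (Fin n)) (χ) (F 1)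
      (mfderiv (𝓡 n) (𝓡 n) F 1 v) = mfderiv (𝓡 n) 𝓘(ℝ, EuclideanSpace ℝ (Fin n)) (χ) (F a)
      (mfderiv (𝓡 n) (𝓡 n) F a v) := by
    rintro _ rfl
    rfl
  rw [h3, h4, e2, ← hF1]
  exact key _ hs

/-- Left- and right-invariant vector fields commute (at the identity): their derivatives in the
chart are the two mixed second derivatives of the multiplication. -/
lemma mlieBracket_rightField (v w : GroupLieAlgebra (𝓡 n) G) :
    VectorField.mlieBracket (𝓡 n) (mulInvariantVectorField v) (rightField w) (1 : G) = 0 := by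
  have hrange : Set.range (𝓡 n) = Set.univ := ModelWithCorners.range_eq_univ _
  set E := EuclideanSpace ℝ (Fin n)
  set φ := chartMul n G with hφ
  have hφ2 : ContDiffAt ℝ 2 φ (χ 1, χ 1) := contDiffAt_chartMul
  have htarget : ∀ᶠ p in 𝓝 (χ (1 : G)), p ∈ (χ).target := extChartAt_target_mem_nhds 1
  have hs : (χ).symm (χ 1) = 1 := extChartAt_to_inv 1
  have hd := hφ2.eventually (by simp)
  let V' : E → E := VectorField.mpullbackWithin 𝓘(ℝ, E) (𝓡 n) (χ).symm
    (mulInvariantVectorField v) Set.univ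
  let W' : E → E := VectorField.mpullbackWithin 𝓘(ℝ, E) (𝓡 n) (χ).symm (rightField w) Set.univ
  have hleft : V' =ᶠ[𝓝 (χ (1 : G))] fun p => fderiv ℝ φ (p, χ 1) (0, v) := by
    have hc : Filter.Tendsto (fun p : E => (p, χ (1 : G))) (𝓝 (χ 1)) (𝓝 (χ 1, χ 1)) :=
      (Continuous.prodMk continuous_id continuous_const).tendsto _
    filter_upwards [htarget, hc.eventually hd] with p hp hdp
    refine Eq.trans ?_ ((inverse_mfderivWithin_apply hp (mdifferentiableAt_mul_left _ 1)
      (mul_one _) v).trans ?_)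
    · rw [hrange]
      rfl
    have hdp' : ContDiffAt ℝ 2 φ (p, χ 1) := hdp
    have := (hdp'.differentiableAt (by simp)).hasFDerivAt.comp (χ 1)
      (hasFDerivAt_prodMk_right p (χ (1 : G)))
    exact congrArg (fun f => f v) this.fderiv
  have hright : W' =ᶠ[𝓝 (χ (1 : G))] fun p => fderiv ℝ φ (χ 1, p) (w, 0) := by
    have hc : Filter.Tendsto (fun p : E => (χ (1 : G), p)) (𝓝 (χ 1)) (𝓝 (χ 1, χ 1)) :=
      (Continuous.prodMk continuous_const continuous_id).tendsto _
    filter_upwards [htarget, hc.eventually hd] with p hp hdp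
    refine Eq.trans ?_ ((inverse_mfderivWithin_apply hp (mdifferentiableAt_mul_right _ 1)
      (one_mul _) w).trans ?_)
    · rw [hrange]
      rfl
    have hdp' : ContDiffAt ℝ 2 φ (χ 1, p) := hdp
    have := HasFDerivAt.comp (f := fun q => (q, p)) (χ 1)
      (hdp'.differentiableAt (by simp)).hasFDerivAt (hasFDerivAt_prodMk_left (χ (1 : G)) p)
    exact congrArg (fun f => f w) this.fderiv
  have hD : DifferentiableAt ℝ (fderiv ℝ φ) (χ 1, χ 1) :=
    (hφ2.fderiv_right (m := 1) (by norm_num)).differentiableAt (by simp)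
  have hD1 : HasFDerivAt (fun p => fderiv ℝ φ (p, χ 1) (0, v))
      (((ContinuousLinearMap.apply ℝ E ((0, v) : E × E)).comp
        (fderiv ℝ (fderiv ℝ φ) (χ 1, χ 1))).comp (ContinuousLinearMap.inl ℝ E E)) (χ 1) :=
    HasFDerivAt.comp (f := fun p => (p, χ (1 : G))) (χ 1)
      ((ContinuousLinearMap.apply ℝ E ((0, v) : E × E)).hasFDerivAt.comp _ hD.hasFDerivAt)
      (hasFDerivAt_prodMk_left _ _)
  have hD2 : HasFDerivAt (fun p => fderiv ℝ φ (χ 1, p) (w, 0))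
      (((ContinuousLinearMap.apply ℝ E ((w, 0) : E × E)).comp
        (fderiv ℝ (fderiv ℝ φ) (χ 1, χ 1))).comp (ContinuousLinearMap.inr ℝ E E)) (χ 1) :=
    HasFDerivAt.comp (f := fun p => (χ (1 : G), p)) (χ 1)
      ((ContinuousLinearMap.apply ℝ E ((w, 0) : E × E)).hasFDerivAt.comp _ hD.hasFDerivAt)
      (hasFDerivAt_prodMk_right _ _)
  have hv1 : fderiv ℝ φ (χ 1, χ 1) (0, v) = v := by
    have h1 := HasFDerivAt.comp (f := fun q => (χ (1 : G), q)) (χ 1)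
      (hφ2.differentiableAt (by simp)).hasFDerivAt (hasFDerivAt_prodMk_right _ _)
    have h2 : (φ ∘ fun q => (χ (1 : G), q)) =ᶠ[𝓝 (χ 1)] id := by
      filter_upwards [htarget] with q hq
      simp only [hφ, chartMul, Function.comp_apply, hs, one_mul, id]
      exact (χ).right_inv hq
    have h3 := h1.fderiv.symm.trans (h2.fderiv_eq.trans fderiv_id)
    exact congrArg (fun f => f v) h3
  have hw1 : fderiv ℝ φ (χ 1, χ 1) (w, 0) = w := by
    have h1 := HasFDerivAt.comp (f := fun q => (q, χ (1 : G))) (χ 1)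
      (hφ2.differentiableAt (by simp)).hasFDerivAt (hasFDerivAt_prodMk_left _ _)
    have h2 : (φ ∘ fun q => (q, χ (1 : G))) =ᶠ[𝓝 (χ 1)] id := by
      filter_upwards [htarget] with q hq
      simp only [hφ, chartMul, Function.comp_apply, hs, mul_one, id]
      exact (χ).right_inv hq
    have h3 := h1.fderiv.symm.trans (h2.fderiv_eq.trans fderiv_id)
    exact congrArg (fun f => f w) h3
  have main : VectorField.lieBracketWithin ℝ V' W' Set.univ (χ 1) = 0 := by
    have hsymm := hφ2.isSymmSndFDerivAt (by simp) (w, 0) (0, v)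
    rw [VectorField.lieBracketWithin_univ, VectorField.lieBracket_eq]
    have hV : V' (χ 1) = v := hleft.self_of_nhds.trans hv1
    have hW : W' (χ 1) = w := hright.self_of_nhds.trans hw1
    simp only
    rw [hleft.fderiv_eq, hright.fderiv_eq, hD1.fderiv, hD2.fderiv, hV, hW]
    exact sub_eq_zero.2 hsymm.symm
  rw [← VectorField.mlieBracketWithin_univ, VectorField.mlieBracketWithin_apply]
  simp only [hrange, Set.preimage_univ, Set.inter_univ]
  exact (congrArg _ main).trans (map_zero _)

end RightInvariant

/-! ### The adjoint representation -/

section AdjointRep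

variable {n : ℕ} {G : Type*} [TopologicalSpace G] [ChartedSpace (EuclideanSpace ℝ (Fin n)) G]
  [Group G]

lemma rightField_one (v : GroupLieAlgebra (𝓡 n) G) : rightField v (1 : G) = v := by
  have : (fun y : G => y * 1) = id := by ext; simp
  rw [rightField, this, mfderiv_id]
  rfl

lemma mulInvariantVectorField_one (v : GroupLieAlgebra (𝓡 n) G) :
    mulInvariantVectorField v (1 : G) = v := by
  have : (fun y : G => 1 * y) = id := by ext; simp
  rw [mulInvariantVectorField, this, mfderiv_id]
  rfl

/-- The value of `Ad(x⁻¹)` on `v`. -/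
def adInv (x : G) (v : GroupLieAlgebra (𝓡 n) G) : GroupLieAlgebra (𝓡 n) G :=
  leftTrivial x (rightField v x)

lemma adInv_one (v : GroupLieAlgebra (𝓡 n) G) : adInv (1 : G) v = v := by
  have e : (fun y : G => (1 : G)⁻¹ * y) = id := by ext; simp
  rw [adInv, rightField_one, leftTrivial, e, mfderiv_id]
  rfl

lemma adInv_add (x : G) (v w : GroupLieAlgebra (𝓡 n) G) :
    adInv x (v + w) = adInv x v + adInv x w := by
  have : rightField (v + w) x = rightField v x + rightField w x := map_add _ _ _
  rw [adInv, this, map_add]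
  rfl

lemma adInv_smul (x : G) (c : ℝ) (v : GroupLieAlgebra (𝓡 n) G) :
    adInv x (c • v) = c • adInv x v := by
  have : rightField (c • v) x = c • rightField v x := map_smul _ _ _
  rw [adInv, this, map_smul]
  rfl

variable [LieGroup (𝓡 n) ∞ G]

lemma adInv_eq (x : G) (v : GroupLieAlgebra (𝓡 n) G) :
    adInv x v = mfderiv (𝓡 n) (𝓡 n) (fun y : G => x⁻¹ * (y * x)) 1 v := by
  have h := mfderiv_comp (I := 𝓡 n) (I' := 𝓡 n) (I'' := 𝓡 n) (1 : G) (g := fun y : G => x⁻¹ * y)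
    (f := fun y : G => y * x) (mdifferentiableAt_mul_left _ _) (mdifferentiableAt_mul_right _ _)
  have key : ∀ a : G, a = x → mfderiv (𝓡 n) (𝓡 n) (fun y : G => x⁻¹ * y) a (rightField v x) =
      adInv x v := by
    rintro _ rfl
    rfl
  exact (key _ (one_mul x)).symm.trans (congrArg (fun f => f v) h).symm

lemma adInv_adInv (x b : G) (v : GroupLieAlgebra (𝓡 n) G) :
    adInv x (adInv b v) = adInv (b * x) v := by
  have hd : ∀ c a : G, MDifferentiableAt (𝓡 n) (𝓡 n) (fun y : G => c⁻¹ * (y * c)) a := fun c a =>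
    (mdifferentiableAt_mul_left c⁻¹ (a * c)).comp a (mdifferentiableAt_mul_right c a)
  have h := mfderiv_comp (I := 𝓡 n) (I' := 𝓡 n) (I'' := 𝓡 n) (1 : G)
    (g := fun y : G => x⁻¹ * (y * x)) (f := fun y : G => b⁻¹ * (y * b)) (hd _ _) (hd _ _)
  have e : (fun y : G => x⁻¹ * (y * x)) ∘ (fun y : G => b⁻¹ * (y * b)) =
      fun y : G => (b * x)⁻¹ * (y * (b * x)) := by
    ext y
    simp only [Function.comp_apply, mul_inv_rev, mul_assoc]
  rw [e] at h
  have key : ∀ a : G, a = 1 → mfderiv (𝓡 n) (𝓡 n) (fun y : G => x⁻¹ * (y * x)) a (adInv b v) =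
      adInv x (adInv b v) := by
    rintro _ rfl
    exact (adInv_eq x _).symm
  rw [adInv_eq (b * x)]
  refine ((key (b⁻¹ * (1 * b)) (by simp)).symm.trans ?_).trans (congrArg (fun f => f v) h).symm
  rw [adInv_eq b]
  rfl

local notation "χ" => extChartAt (𝓡 n) (1 : G)

variable {g : Metric n G} {cov : Connection n G}

lemma inner_leftTrivial (hg : IsLeftInvariant g) (x : G) (a b : TangentSpace (𝓡 n) x) :
    g.inner 1 (leftTrivial x a) (leftTrivial x b) = g.inner x a b := by
  rw [← hg x, mulInvariantVectorField_leftTrivial, mulInvariantVectorField_leftTrivial]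

/-- The derivative of `Ad(x⁻¹) v` at the identity is `-ad(·) v`. -/
lemma hasFDerivAt_adInv (h : IsLeviCivita g cov) (hg : IsLeftInvariant g)
    (v u : GroupLieAlgebra (𝓡 n) G) : ∃ D : EuclideanSpace ℝ (Fin n) →L[ℝ] ℝ,
      HasFDerivAt (fun p => g.inner 1 (adInv ((χ).symm p) v) u) D (χ 1) ∧
      ∀ y : GroupLieAlgebra (𝓡 n) G, D y = -g.inner 1 ⁅y, v⁆ u := by
  let : Bundle.RiemannianBundle (TangentSpace (𝓡 n) : G → Type) := ⟨g.toRiemannianMetric⟩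
  obtain ⟨nabla, hn, htors, hmetr⟩ := h.exists_nabla hg
  have hψ : (fun x : G => g.inner 1 (adInv x v) u) = fun x : G =>
      inner ℝ (rightField v x : TangentSpace (𝓡 n) x) (mulInvariantVectorField u x) := by
    ext x
    rw [adInv, ← leftTrivial_mulInvariantVectorField x u, inner_leftTrivial hg]
    simp only [leftTrivial_mulInvariantVectorField]
    rfl
  have hd : MDifferentiableAt (𝓡 n) 𝓘(ℝ, ℝ) (fun x : G => g.inner 1 (adInv x v) u) 1 := by
    rw [hψ]
    exact (mdifferentiableAt_rightField v 1).inner_bundle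
      (mdifferentiableAt_mulInvariantVectorField u (g := 1))
  have hD := hd.hasMFDerivAt.2
  rw [ModelWithCorners.range_eq_univ] at hD
  refine ⟨_, hasFDerivWithinAt_univ.1 hD, fun y => ?_⟩
  have hm := CovariantDerivative.IsMetricCompatible.mvfderiv_inner_eq h.metric
    (mulInvariantVectorField y) (mdifferentiableAt_rightField v (1 : G))
    (mdifferentiableAt_mulInvariantVectorField u (g := (1 : G)))
  have ht := cov.torsion_eq_zero_iff.1 h.torsion_free
    (mdifferentiableAt_mulInvariantVectorField y (g := (1 : G)))
    (mdifferentiableAt_rightField v (1 : G))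
  rw [mlieBracket_rightField, sub_eq_zero, rightField_one, mulInvariantVectorField_one] at ht
  rw [← hψ] at hm
  simp only [mulInvariantVectorField_one, rightField_one] at hm
  have hn1 : ∀ v w : GroupLieAlgebra (𝓡 n) G, cov (mulInvariantVectorField w) 1 v = nabla v w :=
    fun v w => by
      have := congrFun (hn v w) 1
      simp only [mulInvariantVectorField_one] at this
      exact this
  rw [ht, hn1, hn1] at hm
  have e1 := hmetr y v u
  have e2 : g.inner 1 (nabla y v) u - g.inner 1 (nabla v y) u = g.inner 1 ⁅y, v⁆ u := by
    rw [← htors y v, map_sub]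
    rfl
  have e3 : mfderiv (𝓡 n) 𝓘(ℝ, ℝ) (fun x : G => g.inner 1 (adInv x v) u) 1 y =
      g.inner 1 (nabla v y) u + g.inner 1 v (nabla y u) := hm
  have e4 : g.inner 1 (nabla v y) u + g.inner 1 v (nabla y u) = -g.inner 1 ⁅y, v⁆ u := by
    linarith
  exact e3.trans e4

variable (g) in
lemma continuous_inner_adInv (hg : IsLeftInvariant g) (v w : GroupLieAlgebra (𝓡 n) G) :
    Continuous fun x : G => g.inner 1 (adInv x v) (adInv x w) := by
  let : Bundle.RiemannianBundle (TangentSpace (𝓡 n) : G → Type) := ⟨g.toRiemannianMetric⟩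
  have e : (fun x : G => g.inner 1 (adInv x v) (adInv x w)) = fun x : G =>
      inner ℝ (rightField v x : TangentSpace (𝓡 n) x) (rightField w x) := by
    ext x
    exact inner_leftTrivial hg x _ _
  rw [e]
  exact ((contMDiff_rightField v).inner_bundle (contMDiff_rightField w)).continuous

open MeasureTheory in
/-- Averaging an inner product over a compact group gives an inner product that is invariant under
the adjoint representation. -/
lemma exists_adInv_invariant [CompactSpace G] [T2Space G] (hg : IsLeftInvariant g) :
    ∃ F : LinearMap.BilinForm ℝ (GroupLieAlgebra (𝓡 n) G), IsInner F ∧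
      ∀ (b : G) (v w : GroupLieAlgebra (𝓡 n) G), F (adInv b v) (adInv b w) = F v w := by
  have : IsTopologicalGroup G := topologicalGroup_of_lieGroup (𝓡 n) ∞
  let _ : MeasurableSpace G := borel G
  have : BorelSpace G := ⟨rfl⟩
  let μ : Measure G := Measure.haar
  let f : GroupLieAlgebra (𝓡 n) G → GroupLieAlgebra (𝓡 n) G → G → ℝ := fun v w x =>
    g.inner 1 (adInv x v) (adInv x w)
  have hc : ∀ v w, Continuous (f v w) := fun v w => continuous_inner_adInv g hg v w
  have hi : ∀ v w, Integrable (f v w) μ := fun v w =>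
    (hc v w).integrable_of_hasCompactSupport (HasCompactSupport.of_compactSpace _)
  have fadd : ∀ v v' w, f (v + v') w = fun x => f v w x + f v' w x := fun v v' w => by
    ext x
    simp only [f, adInv_add, map_add]
    rfl
  have fsmul : ∀ (c : ℝ) v w, f (c • v) w = fun x => c * f v w x := fun c v w => by
    ext x
    simp only [f, adInv_smul, map_smul]
    rfl
  have fsymm : ∀ v w, f v w = f w v := fun v w => by
    ext x
    exact g.symm 1 _ _
  have hadd : ∀ v v' w, ∫ x, f (v + v') w x ∂μ = ∫ x, f v w x ∂μ + ∫ x, f v' w x ∂μ :=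
    fun v v' w => by rw [fadd, integral_add (hi v w) (hi v' w)]
  have hsmul : ∀ (c : ℝ) v w, ∫ x, f (c • v) w x ∂μ = c * ∫ x, f v w x ∂μ := fun c v w => by
    rw [fsmul, integral_const_mul]
  refine ⟨LinearMap.mk₂ ℝ (fun v w => ∫ x, f v w x ∂μ) hadd hsmul
    (fun v w w' => by rw [fsymm, hadd, fsymm w, fsymm w'])
    (fun c v w => by rw [fsymm, hsmul, fsymm w, smul_eq_mul]), ⟨fun v w => ?_, fun v hv => ?_⟩,
    fun b v w => ?_⟩
  · rw [LinearMap.mk₂_apply, LinearMap.mk₂_apply, fsymm]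
  · rw [LinearMap.mk₂_apply]
    refine (hc v v).integral_pos_of_hasCompactSupport_nonneg_nonzero (x := 1)
      (HasCompactSupport.of_compactSpace _) (fun x => ?_) ?_
    · by_cases h0 : adInv x v = 0
      · simp [f, h0]
      · exact (g.pos 1 _ h0).le
    · simp only [f, adInv_one]
      exact (g.pos 1 v hv).ne'
  · rw [LinearMap.mk₂_apply, LinearMap.mk₂_apply, ← integral_mul_left_eq_self (f v w) b]
    simp only [f, adInv_adInv]

/-- On the Lie algebra of a compact group there is an inner product for which `ad` is skew. -/
lemma exists_isInvariantInner [CompactSpace G] [T2Space G] (h : IsLeviCivita g cov)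
    (hg : IsLeftInvariant g) :
    ∃ F : LinearMap.BilinForm ℝ (GroupLieAlgebra (𝓡 n) G), IsInvariantInner F := by
  obtain ⟨F, hF, hinv⟩ := exists_adInv_invariant hg
  refine ⟨F, { hF with inv := fun y v w => ?_ }⟩
  let g₁ : LinearMap.BilinForm ℝ (GroupLieAlgebra (𝓡 n) G) :=
    LinearMap.mk₂ ℝ (fun v w => g.inner 1 v w) (fun a b c => by rw [map_add]; rfl)
      (fun r a c => by rw [map_smul]; rfl) (fun a b c => map_add _ _ _) (fun r a c => map_smul _ _ _)
  have hg₁ : IsInner g₁ := ⟨g.symm 1, g.pos 1⟩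
  let e := fun a => (hg₁.onb ⊤ a : GroupLieAlgebra (𝓡 n) G)
  have hrepr : ∀ x, ∑ a, g.inner 1 x (e a) • e a = x := fun x => by
    rw [← hg₁.proj_eq_self (Submodule.mem_top (x := x)), hg₁.proj_apply]
    refine Finset.sum_congr rfl fun a _ => ?_
    rw [← hg₁.proj_apply, hg₁.proj_eq_self (Submodule.mem_top (x := x))]
    exact congrArg (fun r : ℝ => r • e a) (g.symm 1 _ _)
  have hFe : ∀ x x', F x x' = ∑ a, ∑ b, g.inner 1 x (e a) * g.inner 1 x' (e b) * F (e a) (e b) :=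
    fun x x' => by
      conv_lhs => rw [← hrepr x, ← hrepr x']
      simp only [map_sum, map_smul, LinearMap.sum_apply, LinearMap.smul_apply, smul_eq_mul,
        Finset.mul_sum]
      rw [Finset.sum_comm]
      refine Finset.sum_congr rfl fun a _ => Finset.sum_congr rfl fun b _ => ?_
      ring
  choose Dv hDv hDv' using fun a => hasFDerivAt_adInv h hg v (e a)
  choose Dw hDw hDw' using fun a => hasFDerivAt_adInv h hg w (e a)
  have h1 : ∀ v : GroupLieAlgebra (𝓡 n) G, adInv ((χ).symm (χ 1)) v = v := fun v => by
    rw [extChartAt_to_inv, adInv_one]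
  have hder := HasFDerivAt.fun_sum (u := Finset.univ) fun a _ =>
    HasFDerivAt.fun_sum (u := Finset.univ) fun b _ =>
      ((hDv a).mul (hDw b)).mul_const (F (e a) (e b))
  have hconst : (fun p => ∑ a, ∑ b, g.inner 1 (adInv ((χ).symm p) v) (e a) *
      g.inner 1 (adInv ((χ).symm p) w) (e b) * F (e a) (e b)) = fun _ => F v w := by
    ext p
    rw [← hFe, hinv]
  have hzero := hder.unique (hconst ▸ hasFDerivAt_const (F v w) (χ 1))
  have hval : ∀ y : EuclideanSpace ℝ (Fin n), ∑ a, ∑ b,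
      (g.inner 1 v (e a) * Dw b y + g.inner 1 w (e b) * Dv a y) * F (e a) (e b) = 0 := fun y => by
    refine Eq.trans ?_ (congrArg (fun f => f y) hzero)
    rw [_root_.sum_apply]
    refine Finset.sum_congr rfl fun a _ => ?_
    rw [_root_.sum_apply]
    refine Finset.sum_congr rfl fun b _ => ?_
    rw [h1, h1, mul_comm]
    rfl
  have hexp : F ⁅y, v⁆ w + F v ⁅y, w⁆ = 0 := by
    rw [hFe ⁅y, v⁆ w, hFe v ⁅y, w⁆, ← Finset.sum_add_distrib, ← neg_eq_zero,
      ← Finset.sum_neg_distrib, ← hval y]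
    refine Finset.sum_congr rfl fun a _ => ?_
    rw [← Finset.sum_add_distrib, ← Finset.sum_neg_distrib]
    refine Finset.sum_congr rfl fun b _ => ?_
    rw [hDv', hDw']
    ring
  linarith

end AdjointRep

/-! ### The Killing form of a compact simple Lie algebra -/

section KillingForm

variable {L : Type*} [LieRing L] [LieAlgebra ℝ L] [FiniteDimensional ℝ L]

/-- If `ad` is skew for some inner product on a simple Lie algebra, the negative of the Killing
form is an inner product. -/
lemma IsInvariantInner.neg_killingForm (hs : LieAlgebra.IsSimple ℝ L)
    {F : LinearMap.BilinForm ℝ L} (hF : IsInvariantInner F) :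
    IsInvariantInner (-killingForm ℝ L) where
  symm x y := by
    rw [LinearMap.neg_apply, LinearMap.neg_apply, LinearMap.neg_apply, LinearMap.neg_apply,
      LieModule.traceForm_comm]
  pos x hx := by
    have e : -killingForm ℝ L x x =
        ∑ a, F ⁅x, (hF.onb ⊤ a : L)⁆ ⁅x, (hF.onb ⊤ a : L)⁆ := by
      have h1 : hF.proj ⊤ * (LieAlgebra.ad ℝ L x * LieAlgebra.ad ℝ L x) =
          LieAlgebra.ad ℝ L x * LieAlgebra.ad ℝ L x := by
        ext y
        exact hF.proj_eq_self Submodule.mem_top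
      have h2 : killingForm ℝ L x x = LinearMap.trace ℝ L
          (LieAlgebra.ad ℝ L x * LieAlgebra.ad ℝ L x) := killingForm_apply_apply ..
      rw [h2, ← h1, hF.trace_proj_comp, ← Finset.sum_neg_distrib]
      refine Finset.sum_congr rfl fun a _ => ?_
      rw [Module.End.mul_apply, LieAlgebra.ad_apply, LieAlgebra.ad_apply, ← hF.inv]
    rw [LinearMap.neg_apply, LinearMap.neg_apply, e]
    refine (Finset.sum_nonneg fun a _ => hF.nonneg _).lt_of_ne' fun h0 => hx ?_
    rw [Finset.sum_eq_zero_iff_of_nonneg fun a _ => hF.nonneg _] at h0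
    have had : LieAlgebra.ad ℝ L x ∘ₗ (⊤ : Submodule ℝ L).subtype = 0 :=
      (hF.onb ⊤).ext fun a => hF.eq_zero (h0 a (Finset.mem_univ a))
    refine eq_zero_of_central hs fun y => ?_
    rw [← lie_skew, neg_eq_zero]
    exact congrArg (fun f => f ⟨y, Submodule.mem_top⟩) had
  inv x y z := by
    simp only [LinearMap.neg_apply]
    rw [LieModule.traceForm_apply_lie_apply']

end KillingForm

end KaehlerC

end

theorem proposition8 {n : ℕ} {G : Type*} [TopologicalSpace G]
    [ChartedSpace (EuclideanSpace ℝ (Fin n)) G] [Group G] [LieGroup (𝓡 n) ∞ G]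
    [T2Space G] [CompactSpace G] [ConnectedSpace G]
    (hsimple : LieAlgebra.IsSimple ℝ (GroupLieAlgebra (𝓡 n) G))
    (t : LieSubalgebra ℝ (GroupLieAlgebra (𝓡 n) G)) (ht : KaehlerC.IsMaximalAbelian t)
    {ι : Type*} [Fintype ι] (α : ι → Module.Dual ℝ t) (hα : KaehlerC.IsFundamentalSystem t α)
    (i₀ : ι) (hIIb : KaehlerC.IsTypeIIb t α i₀)
    (h₁ h₂ : LieSubalgebra ℝ (GroupLieAlgebra (𝓡 n) G))
    (hdec : KaehlerC.IsIsotropyDecomposition t α i₀ h₁ h₂)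
    (u₀ u₁ u₂ x₁ x₂ : ℝ) (hu₀ : 0 < u₀) (hu₁ : 0 < u₁) (hu₂ : 0 < u₂) (hx₁ : 0 < x₁)
    (hx₂ : 0 < x₂)
    (g : KaehlerC.Metric n G) (hg : KaehlerC.IsLeftInvariant g)
    (hg₁ : KaehlerC.IsDiagonalForm (KaehlerC.summands t α i₀ h₁ h₂) ![u₀, u₁, u₂, x₁, x₂]
      (fun v w => g.inner 1 v w))
    (cov : KaehlerC.Connection n G) (hcov : KaehlerC.IsLeviCivita g cov)
    (d₁ d₂ d₃ d₄ : ℝ)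
    (hd₁ : d₁ = Module.finrank ℝ h₁) (hd₂ : d₂ = Module.finrank ℝ h₂)
    (hd₃ : d₃ = Module.finrank ℝ (KaehlerC.levelSpace t α i₀ 1))
    (hd₄ : d₄ = Module.finrank ℝ (KaehlerC.levelSpace t α i₀ 2)) :
    ∃ r₀ r₁ r₂ r₃ r₄ : ℝ,
      (∀ x : G, KaehlerC.IsDiagonalForm (KaehlerC.summands t α i₀ h₁ h₂)
        ![r₀ * u₀, r₁ * u₁, r₂ * u₂, r₃ * x₁, r₄ * x₂] (KaehlerC.ricci cov x)) ∧
      r₀ = u₀ / (4 * x₁ ^ 2) * (d₃ / (d₃ + 4 * d₄)) + u₀ / x₂ ^ 2 * (d₄ / (d₃ + 4 * d₄)) ∧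
      r₁ = 1 / (2 * d₁ * u₁) * (d₄ * (2 * d₁ + 2 - d₄) / (d₃ + 4 * d₄))
        + u₁ / (4 * x₁ ^ 2) * (d₃ / (d₃ + 4 * d₄))
        + u₁ / (2 * d₁ * x₂ ^ 2) * (d₄ * (d₄ - 2) / (d₃ + 4 * d₄)) ∧
      r₂ = 1 / (4 * d₂ * u₂)
          * (d₂ - d₃ * (d₃ + 2 * d₄ - 2 * d₁ - 2) / (2 * (d₃ + 4 * d₄)))
        + u₂ / (4 * d₂ * x₁ ^ 2)
          * (d₃ * (d₃ + 2 * d₄ - 2 * d₁ - 2) / (2 * (d₃ + 4 * d₄))) ∧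
      r₃ = 1 / (2 * x₁) - x₂ / (2 * x₁ ^ 2) * (d₄ / (d₃ + 4 * d₄))
        - 1 / (2 * x₁ ^ 2) * (u₀ * (1 / (d₃ + 4 * d₄)) + u₁ * (d₁ / (d₃ + 4 * d₄))
          + u₂ * ((d₃ + 2 * d₄ - 2 * d₁ - 2) / (2 * (d₃ + 4 * d₄)))) ∧
      r₄ = 1 / x₂ * (2 * d₄ / (d₃ + 4 * d₄)) + x₂ / (4 * x₁ ^ 2) * (d₃ / (d₃ + 4 * d₄))
        - 1 / x₂ ^ 2 * (u₀ * (2 / (d₃ + 4 * d₄)) + u₁ * ((d₄ - 2) / (d₃ + 4 * d₄))) := by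
  classical
  have hs := hsimple
  obtain ⟨F, hF⟩ := KaehlerC.exists_isInvariantInner hcov hg
  have hB := hF.neg_killingForm hs
  set B := -killingForm ℝ (GroupLieAlgebra (𝓡 n) G) with hBdef
  have hK : ∀ x y, B x y = -killingForm ℝ (GroupLieAlgebra (𝓡 n) G) x y := fun x y => rfl
  -- `α i₀` is `1` on `z`, and the other simple roots vanish on `z`.
  obtain ⟨z, hz⟩ := KaehlerC.exists_dual_vector hα.linearIndependent i₀
  have hS := hIIb.isSplitGrading hB hK ht hs hα hz hdec
  have hw : KaehlerC.summands t α i₀ h₁ h₂ = KaehlerC.splitSummands (z : GroupLieAlgebra (𝓡 n) G)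
      (KaehlerC.levelSpace t α i₀ 1) (KaehlerC.levelSpace t α i₀ 2) h₁ h₂ := by
    rw [KaehlerC.summands, KaehlerC.centerOf_isotropy hs hB ht hα hz]
    rfl
  rw [hw] at hg₁ ⊢
  set w := KaehlerC.splitSummands (z : GroupLieAlgebra (𝓡 n) G)
      (KaehlerC.levelSpace t α i₀ 1) (KaehlerC.levelSpace t α i₀ 2) h₁ h₂ with hwdef
  set c : Fin 5 → ℝ := ![u₀, u₁, u₂, x₁, x₂] with hc
  have hc0 : ∀ i, c i ≠ 0 := by
    intro i
    fin_cases i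
    exacts [hu₀.ne', hu₁.ne', hu₂.ne', hx₁.ne', hx₂.ne']
  let g₁ : LinearMap.BilinForm ℝ (GroupLieAlgebra (𝓡 n) G) :=
    LinearMap.mk₂ ℝ (fun v w => g.inner 1 v w) (fun a b c => by rw [map_add]; rfl)
      (fun r a c => by rw [map_smul]; rfl) (fun a b c => map_add _ _ _) (fun r a c => map_smul _ _ _)
  -- The metric at the identity is `B` composed with the diagonal endomorphism of coefficients `c`.
  have hgP : ∀ v v', g.inner 1 v v' = B (hB.diagonal w c v) v' := fun v v' =>
    hB.eq_form_diagonal hS.orthogonal hS.iSup_summands c (F := g₁) hg₁ v v'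
  obtain ⟨nabla, hn, htors, hmetr⟩ := hcov.exists_nabla hg
  refine ⟨_, _, _, _, _, fun x k l v hv v' hv' => ?_, rfl, rfl, rfl, rfl, rfl⟩
  obtain ⟨T, hT, htr⟩ := hB.trace_curvature hS.orthogonal hS.iSup_summands hc0 htors
    (fun x y u => by rw [← hgP, ← hgP]; exact hmetr x y u) hv hv'
  rw [KaehlerC.IsLeviCivita.ricci_eq_trace hn x hT, htr]
  exact hS.sum_curvature hK hd₁ hd₂ hd₃ hd₄ hu₀.ne' hu₁.ne' hu₂.ne' hx₁.ne' hx₂.ne'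
    rfl rfl rfl rfl rfl hc hv hv'
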